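/- **Conventions.** Let $P$ be a poset with the Alexandrov topology whose closed sets are the down-closed sets. A $P$-stratified space is a topological space $X$ with a continuous map $s\colon X\to P$; put $X_p=s^{-1}(p)$ and $X_{\le p}=s^{-1}(\{q\le p\})$, with the subspace topologies. Stratum-preserving maps are continuous maps over $P$. A flag $\mathcal J=[q_0\le\dots\le q_m]$ of $P$ defines the stratified simplex $|\Delta^{\mathcal J}|$, in which $u$ lies in the stratum $\max\{q_j : u_j>0\}$. A flag is regular if it is strictly increasing. For $p$ in a regular flag $\mathcal I$, $\mathcal I_{\ge p}$ and $\mathcal I_{\le p}$ denote the subflags of entries $\ge p$ and $\le p$. A *stratified cell complex* is a Hausdorff stratified space $X$ with a family of stratum-preserving maps $\sigma_i\colon|\Delta^{\mathcal J_i}|\to X$, $i\in J$, such that $X$ has the final topology with respect to the $\sigma_i$; each $\sigma_i$ restricts to a homeomorphism from the open simplex onto its image $e_i$; $X$ is the disjoint union of the $e_i$; and the transitive relation $\prec$ on $J$ generated by $i\prec j$ if $e_i\cap\sigma_j(|\partial\Delta^{\mathcal J_j}|)\ne\emptyset$ is irreflexive, each $i$ having only finitely many precursors. A *subcomplex* is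 a union of cells indexed by a subset of $J$ that is closed below under $\prec$. The complex is finite if $J$ is. Let $\mathcal I=[p_0<\dots<p_n]$ be a regular flag of $P$. An *aspire* on a stratified space $X$ is a stratum-preserving (in particular continuous) map $R\colon X_{p_n}\times|\Delta^{\mathcal I}|\to X$, the source being stratified by the second factor, such that for each $p\in\mathcal I$ the assignment $$(X_{p_n}\cup X_{\le p})\times|\Delta^{\mathcal I_{\ge p}}|\to X,\qquad (x,u)\mapsto R(x,u)\ \text{ if } s(x)=p_n,\qquad (x,u)\mapsto x\ \text{ if } s(x)\le p,$$ is well defined and continuous. **(1) Gluing.** Let $B$ and $X$ be finite stratified cell complexes, $A\subset B$ a subcomplex, $f\colon A\to X$ a stratum-preserving map, and $Y=X\cup_AB$ the pushout in $P$-stratified spaces, with structure maps $g\colon B\to Y$ and $i\colon X\to Y$. Let $\psi\colon B_{p_n}\to[0,1]$ be continuous with $\psi^{-1}(1)=A_{p_n}$. Let $R_X$ be an aspire on $X$, and let $R_B$ be an aspire on $B$ such that $R_B(b,u)\in A$ whenever $u_{p_n}=\psi(b)$. Then there is a unique map $R_Y\colon Y_{p_n}\times|\Delta^{\mathcal I}|\to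 Y$ such that * $R_Y(i(x),u)=i(R_X(x,u))$ for $x\in X_{p_n}$, $u\in|\Delta^{\mathcal I}|$; * for $b\in B_{p_n}$, $t=\psi(b)$, $p\in\mathcal I$, $y_0\in|\Delta^{\mathcal I_{\le p}}|$ and $y_1\in|\Delta^{\mathcal I_{\ge p}}|$, $$R_Y\big(g(b),(1-t)y_0+ty_1\big)=\widehat R_X\big(g(R_B(b,(1-t)y_0+tv_n)),\,y_1\big),$$ where $v_n$ is the last vertex of $|\Delta^{\mathcal I}|$, $\widehat R_X(i(x),u)=i(R_X(x,u))$ for $x\in X_{p_n}$, and $\widehat R_X(y,u)=y$ for $y\in Y\setminus i(X_{p_n})$. Moreover $R_Y$ is an aspire on $Y$ (and by the first condition it extends $R_X$). **(2) Standard neighborhoods.** Let $X$ be a finite stratified cell complex. For a flag $\mathcal J$, let $\mathrm{sd}\,\Delta^{\mathcal J}$ be the barycentric subdivision, whose vertices are the nonempty subflags of $\mathcal J$ and whose realization is stratified via the last vertex map; let $S_{\mathcal J}(p)$ be its full subcomplex on those subflags $\mathcal J'$ with $p\in\mathcal J'$ or with $q<p$ for all $q\in\mathcal J'$, and let $\partial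 S_{\mathcal J}(p)=S_{\mathcal J}(p)\cap\mathrm{sd}\,\partial\Delta^{\mathcal J}$. Let $\Psi$ be a barycentric subdivision of $X$, i.e. a family of stratum-preserving homeomorphisms $\Psi_i\colon|\mathrm{sd}\,\Delta^{\mathcal J_i}|\to|\Delta^{\mathcal J_i}|$ with $\Psi_i(|\mathrm{sd}\,\Delta^{\mathcal J}|)\subset|\Delta^{\mathcal J}|$ for every $\mathcal J\subset\mathcal J_i$. Suppose that $\Psi$ defines a standard neighborhood system, i.e. $$\sigma_i\Psi_i(|\partial S_{\mathcal J_i}(p)|)\subset\bigcup_{j\prec i}\sigma_j\Psi_j(|S_{\mathcal J_j}(p)|)\quad\text{for all } p\in P \text{ and all } i .$$ For a subcomplex $A$ of $X$ put $U_A(p)=\bigcup_{i}\sigma_i\Psi_i(|S_{\mathcal J_i}(p)|)$, the union over the cells of $A$, and $U_A(\mathcal I)=\bigcap_{p\in\mathcal I}U_A(p)$, with the stratification and topology inherited from $X$. Call an aspire on $U_A(\mathcal I)$ *compatible with subcomplexes* if for every subcomplex $B$ of $A$ it restricts to an aspire on $U_B(\mathcal I)$. Then $U_X(\mathcal I)$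 admits an aspire that is compatible with subcomplexes. Furthermore, for every subcomplex $A$ of $X$ and every aspire $R_A$ on $U_A(\mathcal I)$ that is compatible with subcomplexes, there is an aspire on $U_X(\mathcal I)$ that is compatible with subcomplexes and extends $R_A$. -/

import Mathlib

open Topology

universe u v w

noncomputable section

namespace StratCell

/-! ### Stratified spaces -/

/-- A stratification of a topological space `X` over a poset `P`: a continuous map `X → P`, where
`P` carries the Alexandrov topology whose closed sets are the downward closed sets. -/
structure Stratification (P : Type*) [PartialOrder P] (X : Type*) [TopologicalSpace X] where
  toFun : X → P
  continuous_toFun' : Continuous fun x => WithUpperSet.toUpperSet (toFun x)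

instance (P : Type*) [PartialOrder P] (X : Type*) [TopologicalSpace X] :
    CoeFun (Stratification P X) (fun _ => X → P) := ⟨Stratification.toFun⟩

/-- The stratification inherited by a subspace. -/
def Stratification.restrict {P : Type*} [PartialOrder P] {X : Type*} [TopologicalSpace X]
    (s : Stratification P X) (S : Set X) : Stratification P S where
  toFun x := s x
  continuous_toFun' := s.continuous_toFun'.comp continuous_subtype_val

/-- The `p`-stratum `X_p`, with the subspace topology. -/
abbrev Stratum {P : Type*} [PartialOrder P] {X : Type*} [TopologicalSpace X]
    (s : Stratification P X) (p : P) : Type _ := {x : X // s x = p}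

/-- Stratum-preserving (continuous) maps. -/
structure StratMap {P : Type*} [PartialOrder P] {X Y : Type*} [TopologicalSpace X]
    [TopologicalSpace Y] (s : Stratification P X) (t : Stratification P Y) extends C(X, Y) where
  map_strat : ∀ x, t (toFun x) = s x

instance {P : Type*} [PartialOrder P] {X Y : Type*} [TopologicalSpace X]
    [TopologicalSpace Y] (s : Stratification P X) (t : Stratification P Y) :
    CoeFun (StratMap s t) (fun _ => X → Y) := ⟨fun f => f.toFun⟩

/-- The restriction of a stratum-preserving map to `p`-strata. -/
def StratMap.onStratum {P : Type*} [PartialOrder P] {X Y : Type*} [TopologicalSpace X]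
    [TopologicalSpace Y] {s : Stratification P X} {t : Stratification P Y} (f : StratMap s t)
    (p : P) (x : Stratum s p) : Stratum t p := ⟨f x.1, (f.map_strat x.1).trans x.2⟩

/-! ### Stratified simplices

A flag `[p₀ ≤ ⋯ ≤ pₙ]` of `P` is a monotone map `Fin (n + 1) →o P`; a regular flag
`[p₀ < ⋯ < pₙ]` is an order embedding `Fin (n + 1) ↪o P`. -/

/-- The topological `n`-simplex, with barycentric coordinates `u 0, …, u n`. -/
abbrev Simplex (n : ℕ) : Type := stdSimplex ℝ (Fin (n + 1))

lemma support_nonempty {n : ℕ} (u : Simplex n) :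
    (Finset.univ.filter fun j => 0 < u j).Nonempty := by
  by_contra h
  rw [Finset.not_nonempty_iff_eq_empty, Finset.filter_eq_empty_iff] at h
  have h0 : ∀ j, u j = 0 := fun j =>
    le_antisymm (not_lt.1 (h (Finset.mem_univ j))) (stdSimplex.zero_le u j)
  have := stdSimplex.sum_eq_one u
  simp [h0] at this

/-- The largest index with positive barycentric coordinate. -/
def maxIndex {n : ℕ} (u : Simplex n) : Fin (n + 1) :=
  (Finset.univ.filter fun j => 0 < u j).max' (support_nonempty u)

lemma maxIndex_pos {n : ℕ} (u : Simplex n) : 0 < u (maxIndex u) :=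
  (Finset.mem_filter.1 (Finset.max'_mem _ (support_nonempty u))).2

lemma le_maxIndex {n : ℕ} {u : Simplex n} {j : Fin (n + 1)} (h : 0 < u j) : j ≤ maxIndex u :=
  Finset.le_max' _ _ (by simpa using h)

/-- The stratified simplex `|Δ^J|`: a point `u` lies in the stratum `sup {J j | 0 < u j}`. -/
def simplexStrat {P : Type*} [PartialOrder P] {n : ℕ} (J : Fin (n + 1) →o P) :
    Stratification P (Simplex n) where
  toFun u := J (maxIndex u)
  continuous_toFun' := by
    refine ⟨fun U hU => isOpen_iff_mem_nhds.2 fun u hu => ?_⟩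
    have hc : Continuous fun v : Simplex n => v (maxIndex u) :=
      (continuous_apply (maxIndex u)).comp continuous_subtype_val
    filter_upwards [(isOpen_lt continuous_const hc).mem_nhds (maxIndex_pos u)] with v hv
    exact (show IsUpperSet U from hU)
      (WithUpperSet.toUpperSet_le_iff.2 (J.monotone (le_maxIndex hv))) hu

/-- The open simplex `|Δⁿ| \ |∂Δⁿ|`. -/
def simplexInterior (n : ℕ) : Set (Simplex n) := {u | ∀ j, 0 < u j}

/-- The boundary `|∂Δⁿ|`. -/
def simplexBoundary (n : ℕ) : Set (Simplex n) := {u | ∃ j, u j = 0}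

/-- The closed face of `|Δⁿ|` spanned by a set `F` of vertices. -/
def simplexFace {n : ℕ} (F : Finset (Fin (n + 1))) : Set (Simplex n) := {u | ∀ j ∉ F, u j = 0}

/-- The point `(1 - t) a + t b`. -/
def combo {n : ℕ} (t : unitInterval) (a b : Simplex n) : Simplex n :=
  ⟨fun j => (1 - (t : ℝ)) * a j + t * b j,
    convex_stdSimplex ℝ (Fin (n + 1)) a.2 b.2 (sub_nonneg.2 t.2.2) t.2.1 (by ring)⟩

/-! ### The barycentric subdivision of a simplex -/

/-- Vertices of `sd Δⁿ`: nonempty sets of vertices of `Δⁿ`, that is, nonempty subflags of a flag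
indexed by `Fin (n + 1)`. -/
abbrev SdVertex (n : ℕ) : Type := {S : Finset (Fin (n + 1)) // S.Nonempty}

/-- The realization `|sd Δⁿ|`: the points of the simplex on all vertices of `sd Δⁿ` whose support
is a chain with respect to inclusion. -/
abbrev SdSimplex (n : ℕ) : Type :=
  {w : stdSimplex ℝ (SdVertex n) // IsChain (· ≤ ·) {S : SdVertex n | 0 < w S}}

/-- The last vertex map on vertices. -/
def lastVertex {n : ℕ} (S : SdVertex n) : Fin (n + 1) := S.1.max' S.2

/-- The stratification of `|sd Δ^J|` induced by the realization `|sd Δ^J| → |Δ^J|` of the last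
vertex map. -/
def sdStrat {P : Type*} [PartialOrder P] {n : ℕ} (J : Fin (n + 1) →o P) :
    Stratification P (SdSimplex n) where
  toFun w := simplexStrat J (stdSimplex.map lastVertex w.1)
  continuous_toFun' := (simplexStrat J).continuous_toFun'.comp
    ((stdSimplex.continuous_map lastVertex).comp continuous_subtype_val)

/-- The subcomplex `|sd Δ^F| ⊆ |sd Δⁿ|` for the face of `Δⁿ` spanned by `F`. -/
def sdFace {n : ℕ} (F : Finset (Fin (n + 1))) : Set (SdSimplex n) :=
  {w | ∀ S : SdVertex n, 0 < w.1 S → S.1 ⊆ F}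

/-- The subcomplex `|sd ∂Δⁿ| ⊆ |sd Δⁿ|`. -/
def sdBoundary (n : ℕ) : Set (SdSimplex n) :=
  {w | ∀ S : SdVertex n, 0 < w.1 S → S.1 ≠ Finset.univ}

/-- The combinatorial standard neighborhood of the `p`-stratum in `|sd Δ^J|`: the full subcomplex
spanned by the subflags which contain `p` or have all their entries `< p`. -/
def sdNbhd {P : Type*} [PartialOrder P] {n : ℕ} (J : Fin (n + 1) →o P) (p : P) :
    Set (SdSimplex n) :=
  {w | ∀ S : SdVertex n, 0 < w.1 S → (∃ j ∈ S.1, J j = p) ∨ ∀ j ∈ S.1, J j < p}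

/-! ### Stratified cell complexes -/

/-- The relation `e_i ∩ ∂e_j ≠ ∅` for a family of maps from simplices. -/
def attaches {X ι : Type*} {d : ι → ℕ} (σ : ∀ i, Simplex (d i) → X) (i j : ι) : Prop :=
  (σ i '' simplexInterior (d i) ∩ σ j '' simplexBoundary (d j)).Nonempty

/-- A stratified cell structure with cells indexed by `ι`. -/
structure CellStructure {P : Type*} [PartialOrder P] {X : Type*} [TopologicalSpace X]
    (s : Stratification P X) (ι : Type*) where
  dim : ι → ℕ
  flag : ∀ i, Fin (dim i + 1) →o P
  map : ∀ i, StratMap (simplexStrat (flag i)) s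
  /-- `X` has the final topology with respect to the cells -/
  isOpen_iff : ∀ U : Set X, IsOpen U ↔ ∀ i, IsOpen (map i ⁻¹' U)
  /-- each `σ_i` restricts to a homeomorphism from the open simplex onto its image `e_i` -/
  isEmbedding : ∀ i, IsEmbedding fun u : simplexInterior (dim i) => map i u
  /-- `X` is the disjoint union of the `e_i` -/
  disjoint_union : ∀ x, ∃! i, x ∈ map i '' simplexInterior (dim i)
  /-- the precursor relation is irreflexive -/
  prec_irrefl : ∀ i, ¬ Relation.TransGen (attaches fun i => ⇑(map i).toContinuousMap) i i
  /-- each cell has finitely many precursors -/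
  prec_finite : ∀ i,
    {j | Relation.TransGen (attaches fun i => ⇑(map i).toContinuousMap) j i}.Finite

namespace CellStructure

variable {P : Type*} [PartialOrder P] {X : Type*} [TopologicalSpace X]
  {s : Stratification P X} {ι : Type*}

/-- The cell `e_i`. -/
def openCell (C : CellStructure s ι) (i : ι) : Set X := C.map i '' simplexInterior (C.dim i)

/-- The precursor relation `i ≺ j`. -/
def Prec (C : CellStructure s ι) : ι → ι → Prop :=
  Relation.TransGen (attaches fun i => ⇑(C.map i).toContinuousMap)

/-- A stratified subcomplex, given by a set of cells closed below under `≺`. -/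
structure Subcomplex (C : CellStructure s ι) where
  cells : Set ι
  closed_below : ∀ i j, C.Prec i j → j ∈ cells → i ∈ cells

/-- The underlying subspace of a subcomplex. -/
def Subcomplex.carrier {C : CellStructure s ι} (A : C.Subcomplex) : Set X :=
  ⋃ i ∈ A.cells, C.openCell i

/-- The whole complex as a subcomplex of itself. -/
def whole (C : CellStructure s ι) : C.Subcomplex := ⟨Set.univ, fun _ _ _ _ => trivial⟩

/-- A barycentric subdivision of a stratified cell complex: stratum-preserving homeomorphisms
`Ψ_i : |sd Δ^{J_i}| ≃ |Δ^{J_i}|` which map `|sd Δ^J|` into `|Δ^J|` for each face. -/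
structure Subdivision (C : CellStructure s ι) where
  homeo : ∀ i, SdSimplex (C.dim i) ≃ₜ Simplex (C.dim i)
  homeo_strat : ∀ i w, simplexStrat (C.flag i) (homeo i w) = sdStrat (C.flag i) w
  homeo_face : ∀ i (F : Finset (Fin (C.dim i + 1))), Set.MapsTo (homeo i) (sdFace F) (simplexFace F)

/-- The map `σ_i ∘ Ψ_i : |sd Δ^{J_i}| → X`. -/
def Subdivision.cellMap {C : CellStructure s ι} (Ψ : C.Subdivision) (i : ι) :
    SdSimplex (C.dim i) → X := fun w => C.map i (Ψ.homeo i w)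

/-- `Ψ` defines a standard neighborhood system. -/
def Subdivision.DefinesStandardNbhdSystem {C : CellStructure s ι} (Ψ : C.Subdivision) : Prop :=
  ∀ (p : P) (i : ι), Ψ.cellMap i '' (sdNbhd (C.flag i) p ∩ sdBoundary (C.dim i)) ⊆
    ⋃ j ∈ {j | C.Prec j i}, Ψ.cellMap j '' sdNbhd (C.flag j) p

/-- For a subcomplex `A` of `X`, the `p`-th standard neighborhood `U_A(p)` associated to the
restriction of `Ψ` to `A`, as a subset of `A ⊆ X`. For `A = C.whole` this is `U_X(p)`. -/
def Subdivision.nbhd {C : CellStructure s ι} (Ψ : C.Subdivision) (A : C.Subcomplex) (p : P) :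
    Set X := ⋃ i ∈ A.cells, Ψ.cellMap i '' sdNbhd (C.flag i) p

/-- `U_A(I) = ⋂_{p ∈ I} U_A(p)` for a regular flag `I`. -/
def Subdivision.flagNbhd {C : CellStructure s ι} (Ψ : C.Subdivision) (A : C.Subcomplex)
    {n : ℕ} (I : Fin (n + 1) ↪o P) : Set X := ⋂ k, Ψ.nbhd A (I k)

end CellStructure

/-! ### Almost stratum-preserving retractions (aspires) -/

section Aspire

variable {P : Type*} [PartialOrder P] {n : ℕ}

/-- `R : X_{pₙ} × |Δ^I| → X` is an aspire for the regular flag `I = [p₀ < ⋯ < pₙ]`: it is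
continuous and stratum-preserving, and for every `p = I k` the assignment `(x, u) ↦ R (x, u)` if
`s x = pₙ`, `(x, u) ↦ x` if `s x ≤ p`, is well defined and continuous on
`(X_{pₙ} ∪ X_{≤ p}) × |Δ^{I_{≥ p}}|`. -/
structure IsAspire {X : Type*} [TopologicalSpace X] (s : Stratification P X)
    (I : Fin (n + 1) ↪o P) (R : Stratum s (I (Fin.last n)) → Simplex n → X) : Prop where
  continuous : Continuous fun z : Stratum s (I (Fin.last n)) × Simplex n => R z.1 z.2
  strat : ∀ x u, s (R x u) = simplexStrat I.toOrderHom u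
  lower : ∀ k : Fin (n + 1),
    ∃ F : {x : X // s x = I (Fin.last n) ∨ s x ≤ I k} × {u : Simplex n // ∀ j < k, u j = 0} → X,
      Continuous F ∧
      (∀ z, ∀ h : s z.1.1 = I (Fin.last n), F z = R ⟨z.1.1, h⟩ z.2.1) ∧
      (∀ z, s z.1.1 ≤ I k → F z = z.1.1)

/-- An aspire on a subspace `T` extends (restricts to) one on a subspace `S ⊆ T`. -/
def Extends {X : Type*} [TopologicalSpace X] (s : Stratification P X) (I : Fin (n + 1) ↪o P)
    {S T : Set X} (RT : Stratum (s.restrict T) (I (Fin.last n)) → Simplex n → T)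
    (RS : Stratum (s.restrict S) (I (Fin.last n)) → Simplex n → S) : Prop :=
  ∀ (x : X) (hS : x ∈ S) (hT : x ∈ T) (hx : s x = I (Fin.last n)) (u : Simplex n),
    (RT ⟨⟨x, hT⟩, hx⟩ u : X) = RS ⟨⟨x, hS⟩, hx⟩ u

/-- An aspire on `U_A(I)` is compatible with subcomplexes if it restricts to an aspire on `U_B(I)`
for every subcomplex `B` of `A`. -/
def IsCompatible {X : Type*} [TopologicalSpace X] {s : Stratification P X} {ι : Type*}
    {C : CellStructure s ι} (Ψ : C.Subdivision) (I : Fin (n + 1) ↪o P) (A : C.Subcomplex)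
    (R : Stratum (s.restrict (Ψ.flagNbhd A I)) (I (Fin.last n)) → Simplex n → Ψ.flagNbhd A I) :
    Prop :=
  ∀ B : C.Subcomplex, B.cells ⊆ A.cells →
    ∃ R' : Stratum (s.restrict (Ψ.flagNbhd B I)) (I (Fin.last n)) → Simplex n → Ψ.flagNbhd B I,
      IsAspire (s.restrict (Ψ.flagNbhd B I)) I R' ∧ Extends s I R R'

/-- For a map `i : X → Y` and `R : X_{pₙ} × |Δ^I| → X`, the (not necessarily continuous) extension
of `R` to `Y`: `(i x, u) ↦ i (R x u)` on the image of `X_{pₙ}` and `(y, u) ↦ y` elsewhere. -/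
def extendByPoint {X Y : Type*} [TopologicalSpace X] [TopologicalSpace Y]
    {sX : Stratification P X} {sY : Stratification P Y} (i : StratMap sX sY)
    (I : Fin (n + 1) ↪o P) (R : Stratum sX (I (Fin.last n)) → Simplex n → X) :
    Y → Simplex n → Y :=
  Function.extend (fun x : Stratum sX (I (Fin.last n)) => i x.1) (fun x u => i (R x u))
    (fun y _ => y)

/-- `τ = σ ⋆_t R`. In join coordinates, `u = (1 - t) y₀ + t y₁` with `y₀` in the face
`|Δ^{I_{≤ p}}|` and `y₁` in the face `|Δ^{I_{≥ p}}|` for some `p = I k`, and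
`(σ ⋆_t R) u = R (σ ((1 - t) y₀ + t vₙ), y₁)`, where `vₙ` is the maximal vertex. -/
def IsStar {Y : Type*} (σ : Simplex n → Y) (t : unitInterval) (R : Y → Simplex n → Y)
    (τ : Simplex n → Y) : Prop :=
  ∀ (k : Fin (n + 1)) (y₀ y₁ : Simplex n), (∀ j, k < j → y₀ j = 0) → (∀ j < k, y₁ j = 0) →
    τ (combo t y₀ y₁) = R (σ (combo t y₀ (stdSimplex.vertex (Fin.last n)))) y₁

/-- `R` is the map glued from `RX` and `RB`: on classes of points `b` of `B` it is
`(g ∘ RB b) ⋆_{ψ b} RX`, and on classes of points of `X` it is `RX`. -/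
structure IsGlued {X B Y : Type*} [TopologicalSpace X] [TopologicalSpace B] [TopologicalSpace Y]
    {sX : Stratification P X} {sB : Stratification P B} {sY : Stratification P Y}
    (g : StratMap sB sY) (i : StratMap sX sY) (I : Fin (n + 1) ↪o P)
    (ψ : C(Stratum sB (I (Fin.last n)), unitInterval))
    (RX : Stratum sX (I (Fin.last n)) → Simplex n → X)
    (RB : Stratum sB (I (Fin.last n)) → Simplex n → B)
    (R : Stratum sY (I (Fin.last n)) → Simplex n → Y) : Prop where
  on_B : ∀ b, IsStar (fun u => g (RB b u)) (ψ b) (extendByPoint i I RX) (R (g.onStratum _ b))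
  on_X : ∀ x u, R (i.onStratum _ x) u = i (RX x u)

end Aspire

end StratCell

end

namespace StratCell

noncomputable section

/-! ### Cutting points of a simplex -/

section Cut

variable {n : ℕ}

/-! Gluing. Order the mass of `u` by vertices. If u = (1-t)y₀ + t y₁ in join coordinates, then t y₁
is the last t units of this mass. For t > 0 the decomposition therefore determines y₁, by an
explicit formula, and the star formula becomes the map (b, u) ↦ R̂_X(g(R_B(b, pushTop u)), topPart
u) of `starMap`. Its continuity is the main issue. Where u_{p_n} ≥ ψ(b) it is g(R_B(b, u)). Where
u_{p_n} < ψ(b) the inner point has last coordinate ψ(b) > 0, so it lies in A and in the p_n-stratum,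
where R̂_X is continuous. The delicate points have ψ(b) = u_{p_n} = 0: there `topPart` has no limit,
but the inner point lies in a lower stratum, near which R_X displaces points by little, uniformly
over the relevant face of the simplex. This smallness is a pointwise form of the aspire condition
(`IsAspire.eventually_mem`, `IsAspire.of_eventually_mem`). Since i is a closed embedding and g is
proper, continuity on Y is checked on the two pieces (`exists_isGlued`).

Standard neighborhoods. Cells are attached one at a time, each step being an instance of
`exists_isGlued`, so only an aspire and a level function ψ on a single subdivided simplex are needed
(`exists_standardAspire`). Recording for each vertex of Δᵐ the total weight of the subflags
containing it identifies |sd Δᵐ| with the functions on vertices with maximum 1. In these heights the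
neighborhood of p says that every vertex of positive height whose label is not below p is dominated
by one labelled p. The aspire lowers all heights by a cutoff and multiplies the height at label q by
the mass of u at or above q. The level ψ is chosen so that at u_{p_n} = ψ some height becomes 0,
that is, the boundary is reached. The same cell data serve every subcomplex containing the cell,
which gives compatibility (`extends_of_isGlued`).

One topological input remains. A subdivision is only assumed to map faces into faces, while the
attaching step needs interiors to go to interiors. This follows because a continuous face-preserving
self-map of a simplex maps each face onto itself (`surjective_of_face_preserving`), which is proved
from Sperner's lemma on iterated barycentric subdivisions, with mod 2 chains. -/

lemma simplex_ext {u v : Simplex n} (h : ∀ j, u j = v j) : u = v :=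
  stdSimplex.ext (funext h)

lemma continuous_coord (j : Fin (n + 1)) : Continuous fun u : Simplex n => u j :=
  (continuous_apply j).comp continuous_subtype_val

lemma vertex_last_apply (j : Fin (n + 1)) :
    (stdSimplex.vertex (S := ℝ) (Fin.last n) : Simplex n) j = if j = Fin.last n then 1 else 0 := by
  rw [stdSimplex.vertex_coe, Pi.single_apply]

lemma eq_vertex_last {u : Simplex n} (h : ∀ j < Fin.last n, u j = 0) :
    u = stdSimplex.vertex (Fin.last n) := by
  have h1 := stdSimplex.sum_eq_one u
  rw [Finset.sum_eq_single (Fin.last n) (fun j _ hj => h j (lt_of_le_of_ne (Fin.le_last j) hj))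
    (by simp)] at h1
  refine simplex_ext fun j => ?_
  rw [vertex_last_apply]
  split_ifs with hj
  · rw [hj, h1]
  · exact h j (lt_of_le_of_ne (Fin.le_last j) hj)

lemma eq_vertex_last_of_eq_one {u : Simplex n} (h : u (Fin.last n) = 1) :
    u = stdSimplex.vertex (Fin.last n) := by
  refine eq_vertex_last fun j hj => ?_
  have h1 := stdSimplex.sum_eq_one u
  rw [← Finset.add_sum_erase _ _ (Finset.mem_univ (Fin.last n)), h, add_eq_left,
    Finset.sum_eq_zero_iff_of_nonneg fun _ _ => stdSimplex.zero_le _ _] at h1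
  exact h1 j (Finset.mem_erase.2 ⟨hj.ne, Finset.mem_univ _⟩)

lemma maxIndex_eq {u : Simplex n} {j : Fin (n + 1)} (hj : 0 < u j) (h : ∀ l, j < l → u l = 0) :
    maxIndex u = j := by
  refine le_antisymm (not_lt.1 fun hl => ?_) (le_maxIndex hj)
  exact (maxIndex_pos u).ne' (h _ hl)

lemma eq_zero_of_maxIndex_lt {u : Simplex n} {j : Fin (n + 1)} (h : maxIndex u < j) : u j = 0 :=
  le_antisymm (not_lt.1 fun hj => (le_maxIndex hj).not_gt h) (stdSimplex.zero_le _ _)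

lemma combo_apply (t : unitInterval) (a b : Simplex n) (j : Fin (n + 1)) :
    combo t a b j = (1 - (t : ℝ)) * a j + t * b j := rfl

/-- The sum of the barycentric coordinates from index `k` on. -/
def tail (u : Simplex n) (k : ℕ) : ℝ := ∑ j : Fin (n + 1), if k ≤ (j : ℕ) then u j else 0

lemma tail_zero (u : Simplex n) : tail u 0 = 1 := by simp [tail]

lemma tail_eq_zero (u : Simplex n) {k : ℕ} (h : ∀ j : Fin (n + 1), k ≤ (j : ℕ) → u j = 0) :
    tail u k = 0 :=
  Finset.sum_eq_zero fun j _ => by split_ifs with hj; exacts [h j hj, rfl]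

lemma tail_eq_one (u : Simplex n) {k : ℕ} (h : ∀ j : Fin (n + 1), (j : ℕ) < k → u j = 0) :
    tail u k = 1 := by
  rw [← stdSimplex.sum_eq_one u]
  refine Finset.sum_congr rfl fun j _ => ?_
  split_ifs with hj
  · rfl
  · exact (h j (not_le.1 hj)).symm

lemma tail_succ (u : Simplex n) (j : Fin (n + 1)) : tail u j = u j + tail u (j + 1) := by
  have : u j = ∑ l : Fin (n + 1), if l = j then u l else 0 := by simp
  rw [this, tail, tail, ← Finset.sum_add_distrib]
  refine Finset.sum_congr rfl fun l _ => ?_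
  by_cases h : l = j
  · subst h; simp
  · have h' : (l : ℕ) ≠ j := fun e => h (Fin.ext e)
    simp only [if_neg h]
    by_cases h2 : (j : ℕ) ≤ l
    · rw [if_pos h2, if_pos (by omega)]; ring
    · rw [if_neg h2, if_neg (by omega)]; ring

lemma tail_antitone (u : Simplex n) : Antitone (tail u) := fun a b hab => by
  refine Finset.sum_le_sum fun j _ => ?_
  split_ifs <;> first | exact le_rfl | exact stdSimplex.zero_le _ _ | omega

lemma tail_nonneg (u : Simplex n) (k : ℕ) : 0 ≤ tail u k :=
  Finset.sum_nonneg fun j _ => by split_ifs; exacts [stdSimplex.zero_le _ _, le_rfl]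

lemma tail_last (u : Simplex n) : tail u n = u (Fin.last n) := by
  have := tail_succ u (Fin.last n)
  rw [tail_eq_zero u (k := (Fin.last n : ℕ) + 1) (fun j hj => by simp at hj; omega)] at this
  simpa using this

lemma tail_combo (t : unitInterval) (a b : Simplex n) (k : ℕ) :
    tail (combo t a b) k = (1 - (t : ℝ)) * tail a k + t * tail b k := by
  simp only [tail, Finset.mul_sum, ← Finset.sum_add_distrib]
  refine Finset.sum_congr rfl fun j _ => ?_
  split_ifs
  · rw [combo_apply]
  · ring

lemma continuous_tail (k : ℕ) : Continuous fun u : Simplex n => tail u k := by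
  refine continuous_finsetSum _ fun j _ => ?_
  split_ifs
  · exact continuous_coord j
  · exact continuous_const

/-- The part of the coordinates of `u` which makes up the last `t` units of mass. -/
def cut (t : ℝ) (u : Simplex n) (j : Fin (n + 1)) : ℝ := min (tail u j) t - min (tail u (j + 1)) t

lemma cut_nonneg (t : ℝ) (u : Simplex n) (j : Fin (n + 1)) : 0 ≤ cut t u j :=
  sub_nonneg.2 (min_le_min_right _ (tail_antitone u (Nat.le_succ _)))

lemma cut_le (t : ℝ) (u : Simplex n) (j : Fin (n + 1)) : cut t u j ≤ u j := by
  have := tail_succ u j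
  have h0 := stdSimplex.zero_le u j
  unfold cut
  rcases le_total (tail u (j + 1)) t with h | h <;> rcases le_total (tail u j) t with h' | h' <;>
    simp only [min_eq_left h, min_eq_right h, min_eq_left h', min_eq_right h'] <;> linarith

lemma sum_cut {t : ℝ} (h0 : 0 ≤ t) (h1 : t ≤ 1) (u : Simplex n) : ∑ j, cut t u j = t := by
  have := Fin.sum_univ_eq_sum_range (fun j => min (tail u j) t - min (tail u (j + 1)) t) (n + 1)
  unfold cut
  rw [this, Finset.sum_range_sub', tail_zero, tail_eq_zero u (fun j hj => by omega),
    min_eq_right h1, min_eq_left h0, sub_zero]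

lemma continuous_cut (j : Fin (n + 1)) :
    Continuous fun z : ℝ × Simplex n => cut z.1 z.2 j :=
  (((continuous_tail _).comp continuous_snd).min continuous_fst).sub
    (((continuous_tail _).comp continuous_snd).min continuous_fst)

/-- No vertex carrying y₀ comes after a vertex carrying y₁, so the last `t` units of mass of the
combination are exactly those of `y₁`. -/
lemma cut_combo (t : unitInterval) {y₀ y₁ : Simplex n} {k : Fin (n + 1)}
    (h₀ : ∀ j, k < j → y₀ j = 0) (h₁ : ∀ j < k, y₁ j = 0) (j : Fin (n + 1)) :
    cut t (combo t y₀ y₁) j = t * y₁ j := by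
  -- Up to index `k` the tail of `y₁` is everything, so the minimum saturates at `t`; beyond `k` the
  -- point `y₀` contributes nothing.
  have key : ∀ l : ℕ, min (tail (combo t y₀ y₁) l) t = t * tail y₁ l := fun l => by
    have ht0 := t.2.1
    have ht1 := t.2.2
    have hl1 : tail y₁ l ≤ 1 := (tail_zero y₁) ▸ tail_antitone y₁ (Nat.zero_le l)
    rw [tail_combo]
    rcases le_or_gt l k with hl | hl
    · rw [tail_eq_one y₁ fun j hj => h₁ j (Fin.lt_def.2 (by omega)), mul_one, min_eq_right]
      exact le_add_of_nonneg_left (mul_nonneg (sub_nonneg.2 ht1) (tail_nonneg _ _))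
    · rw [tail_eq_zero y₀ fun j hj => h₀ j (Fin.lt_def.2 (by omega)), mul_zero, zero_add,
        min_eq_left (mul_le_of_le_one_right ht0 hl1)]
  rw [cut, key, key, tail_succ y₁ j]
  ring

/-- The last `t` units of mass of `u`, normalized. -/
def topPart (t : unitInterval) (u : Simplex n) : Simplex n :=
  if h : 0 < (t : ℝ) then
    ⟨fun j => cut t u j / t, fun j => div_nonneg (cut_nonneg _ _ _) h.le, by
      rw [← Finset.sum_div, sum_cut t.2.1 t.2.2, div_self h.ne']⟩
  -- At level 0 the point y₁ is arbitrary. The last vertex is the right default because aspires are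
  -- the identity there.
  else stdSimplex.vertex (Fin.last n)

/-- The point obtained from `u` by moving the last `t` units of mass to the last vertex. -/
def pushTop (t : unitInterval) (u : Simplex n) : Simplex n :=
  ⟨fun j => u j - cut t u j + t * stdSimplex.vertex (S := ℝ) (Fin.last n) j, fun j =>
    add_nonneg (sub_nonneg.2 (cut_le _ _ _)) (mul_nonneg t.2.1 (stdSimplex.zero_le _ _)), by
    rw [Finset.sum_add_distrib, Finset.sum_sub_distrib, sum_cut t.2.1 t.2.2, ← Finset.mul_sum,
      stdSimplex.sum_eq_one, stdSimplex.sum_eq_one]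
    ring⟩

lemma topPart_apply {t : unitInterval} (h : 0 < (t : ℝ)) (u : Simplex n) (j : Fin (n + 1)) :
    topPart t u j = cut t u j / t := by
  rw [topPart, dif_pos h]; rfl

lemma topPart_zero {t : unitInterval} (h : ¬ 0 < (t : ℝ)) (u : Simplex n) :
    topPart t u = stdSimplex.vertex (Fin.last n) := dif_neg h

lemma pushTop_apply (t : unitInterval) (u : Simplex n) (j : Fin (n + 1)) :
    pushTop t u j = u j - cut t u j + t * stdSimplex.vertex (S := ℝ) (Fin.last n) j := rfl

lemma continuous_pushTop : Continuous fun z : unitInterval × Simplex n => pushTop z.1 z.2 := by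
  refine Continuous.subtype_mk (continuous_pi fun j => ?_) _
  refine (((continuous_coord j).comp continuous_snd).sub ?_).add
    ((continuous_subtype_val.comp continuous_fst).mul continuous_const)
  exact (continuous_cut j).comp ((continuous_subtype_val.comp continuous_fst).prodMk continuous_snd)

lemma continuousOn_topPart :
    ContinuousOn (fun z : unitInterval × Simplex n => topPart z.1 z.2) {z | 0 < (z.1 : ℝ)} := by
  rw [continuousOn_iff_continuous_domRestrict]
  refine Topology.IsInducing.subtypeVal.continuous_iff.2 (continuous_pi fun j => ?_)
  have : (fun z : {z : unitInterval × Simplex n | 0 < (z.1 : ℝ)} =>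
      topPart z.1.1 z.1.2 j) = fun z => cut z.1.1 z.1.2 j / (z.1.1 : ℝ) :=
    funext fun z => topPart_apply z.2 _ _
  refine (continuous_congr (fun z => congrFun this z)).2 (Continuous.div ?_ ?_ fun z => ne_of_gt z.2)
  · exact (continuous_cut j).comp ((continuous_subtype_val.comp
      (continuous_fst.comp continuous_subtype_val)).prodMk
      (continuous_snd.comp continuous_subtype_val))
  · exact continuous_subtype_val.comp (continuous_fst.comp continuous_subtype_val)

lemma pushTop_combo (t : unitInterval) {y₀ y₁ : Simplex n} {k : Fin (n + 1)}
    (h₀ : ∀ j, k < j → y₀ j = 0) (h₁ : ∀ j < k, y₁ j = 0) :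
    pushTop t (combo t y₀ y₁) = combo t y₀ (stdSimplex.vertex (Fin.last n)) := by
  refine simplex_ext fun j => ?_
  rw [pushTop_apply, cut_combo t h₀ h₁, combo_apply, combo_apply]
  ring

lemma topPart_combo {t : unitInterval} (ht : 0 < (t : ℝ)) {y₀ y₁ : Simplex n} {k : Fin (n + 1)}
    (h₀ : ∀ j, k < j → y₀ j = 0) (h₁ : ∀ j < k, y₁ j = 0) :
    topPart t (combo t y₀ y₁) = y₁ := by
  refine simplex_ext fun j => ?_
  rw [topPart_apply ht, cut_combo t h₀ h₁, mul_div_cancel_left₀ _ ht.ne']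

lemma combo_of_eq_zero {t : unitInterval} (ht : (t : ℝ) = 0) (a b : Simplex n) :
    combo t a b = a :=
  simplex_ext fun j => by rw [combo_apply, ht]; ring

lemma combo_of_eq_one {t : unitInterval} (ht : (t : ℝ) = 1) (a b : Simplex n) :
    combo t a b = b :=
  simplex_ext fun j => by rw [combo_apply, ht]; ring

/-- The units to be moved already sit at the last vertex. -/
lemma pushTop_of_le {t : unitInterval} {u : Simplex n} (h : (t : ℝ) ≤ u (Fin.last n)) :
    pushTop t u = u := by
  refine simplex_ext fun j => ?_
  have key : cut t u j = t * stdSimplex.vertex (S := ℝ) (Fin.last n) j := by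
    rw [vertex_last_apply, cut]
    have hj : (t : ℝ) ≤ tail u j :=
      h.trans (tail_last u ▸ tail_antitone u (Nat.lt_succ_iff.1 j.2))
    rw [min_eq_right hj]
    split_ifs with e
    · rw [tail_eq_zero u (fun l hl => by subst e; simp at hl; omega), min_eq_left t.2.1]
      ring
    · have : (j : ℕ) + 1 ≤ n := by
        have := Fin.lt_last_iff_ne_last.2 e
        exact this
      rw [min_eq_right (h.trans (tail_last u ▸ tail_antitone u this))]
      ring
  rw [pushTop_apply, key]
  ring

lemma topPart_of_le {t : unitInterval} {u : Simplex n} (h : (t : ℝ) ≤ u (Fin.last n)) :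
    topPart t u = stdSimplex.vertex (Fin.last n) := by
  by_cases ht : 0 < (t : ℝ)
  · refine simplex_ext fun j => ?_
    have := congrArg (fun v : Simplex n => v j) (pushTop_of_le h)
    simp only [pushTop_apply] at this
    rw [topPart_apply ht, div_eq_iff ht.ne']
    linarith
  · exact topPart_zero ht u

lemma pushTop_last_of_le {t : unitInterval} {u : Simplex n} (h : u (Fin.last n) ≤ t) :
    pushTop t u (Fin.last n) = t := by
  rw [pushTop_apply, vertex_last_apply, if_pos rfl, cut, Fin.val_last, tail_last,
    tail_eq_zero u (fun l hl => by omega), min_eq_left h, min_eq_left t.2.1]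
  ring

lemma pushTop_of_one {t : unitInterval} (ht : (t : ℝ) = 1) (u : Simplex n) :
    pushTop t u = stdSimplex.vertex (Fin.last n) :=
  eq_vertex_last_of_eq_one ((pushTop_last_of_le (ht ▸ stdSimplex.le_one _ _)).trans ht)

lemma topPart_of_one {t : unitInterval} (ht : (t : ℝ) = 1) (u : Simplex n) :
    topPart t u = u := by
  conv_lhs => rw [← combo_of_eq_one ht (stdSimplex.vertex 0) u]
  refine topPart_combo (k := 0) (by rw [ht]; norm_num) (fun j hj => ?_) (fun j hj => ?_)
  · rw [stdSimplex.vertex_coe, Pi.single_apply, if_neg hj.ne']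
  · simp at hj

lemma topPart_eq_zero {t : unitInterval} (ht : 0 < (t : ℝ)) {u : Simplex n} {k : Fin (n + 1)}
    (h : (t : ℝ) ≤ tail u k) : ∀ j < k, topPart t u j = 0 := fun j hj => by
  rw [topPart_apply ht, cut, min_eq_right (h.trans (tail_antitone u (Fin.lt_def.1 hj).le)),
    min_eq_right (h.trans (tail_antitone u (Fin.lt_def.1 hj))), sub_self, zero_div]

lemma pushTop_eq_zero {t : unitInterval} {u : Simplex n} {j : Fin (n + 1)}
    (hj : j ≠ Fin.last n) (h : u j = 0) : pushTop t u j = 0 := by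
  have h1 := cut_le t u j
  have h2 := cut_nonneg t u j
  rw [pushTop_apply, vertex_last_apply, if_neg hj, h]
  linarith

/-- Every point of the simplex decomposes in join coordinates at each level `t`. -/
lemma exists_combo (t : unitInterval) (u : Simplex n) :
    ∃ (k : Fin (n + 1)) (y₀ y₁ : Simplex n), (∀ j, k < j → y₀ j = 0) ∧ (∀ j < k, y₁ j = 0) ∧
      combo t y₀ y₁ = u := by
  rcases t.2.1.eq_or_lt with h0 | h0
  · refine ⟨Fin.last n, u, stdSimplex.vertex (Fin.last n), fun j hj => ?_, fun j hj => ?_,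
      combo_of_eq_zero h0.symm _ _⟩
    · exact absurd (Fin.le_last j) hj.not_ge
    · rw [vertex_last_apply, if_neg hj.ne]
  rcases t.2.2.eq_or_lt with h1 | h1
  · refine ⟨0, stdSimplex.vertex 0, u, fun j hj => ?_, fun j hj => ?_, combo_of_eq_one h1 _ _⟩
    · rw [stdSimplex.vertex_coe, Pi.single_apply, if_neg hj.ne']
    · simp at hj
  -- The index `k` is the vertex at which the cut falls: the last one whose tail still has mass at
  -- least `t`. Levels 0 and 1 were split off because the two pieces are normalized by `t` and `1 -
  -- t`.
  let S := Finset.univ.filter fun k : Fin (n + 1) => (t : ℝ) ≤ tail u k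
  have hS : S.Nonempty := ⟨0, by simp [S, tail_zero, t.2.2]⟩
  have hk := (Finset.mem_filter.1 (S.max'_mem hS)).2
  have h1' : (1 : ℝ) - t ≠ 0 := (sub_pos.2 h1).ne'
  refine ⟨S.max' hS, ⟨fun j => (u j - cut t u j) / (1 - t), fun j =>
    div_nonneg (sub_nonneg.2 (cut_le _ _ _)) (sub_pos.2 h1).le, ?_⟩, topPart t u,
    fun j hj => ?_, topPart_eq_zero h0 hk, ?_⟩
  · rw [← Finset.sum_div, Finset.sum_sub_distrib, sum_cut t.2.1 t.2.2, stdSimplex.sum_eq_one,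
      div_self h1']
  · have hj' : tail u j < t := by
      by_contra hc
      exact hj.not_ge (S.le_max' j (by simpa [S] using hc))
    change (u j - cut t u j) / (1 - t) = 0
    have h2 : tail u (j + 1) < t := (tail_antitone u (Nat.le_succ _)).trans_lt hj'
    rw [cut, min_eq_left hj'.le, min_eq_left h2.le, tail_succ u j]
    simp
  · refine simplex_ext fun j => ?_
    rw [combo_apply, topPart_apply h0]
    change (1 - (t : ℝ)) * ((u j - cut t u j) / (1 - t)) + _ = _
    field_simp
    ring

end Cut

/-! ### A pointwise description of aspires -/

section Tube

variable {P : Type*} [PartialOrder P] {n : ℕ} {I : Fin (n + 1) ↪o P}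

lemma Stratification.isClosed_le {X : Type*} [TopologicalSpace X] (s : Stratification P X) (p : P) :
    IsClosed {x | s x ≤ p} := by
  refine ⟨s.continuous_toFun'.isOpen_preimage {q | ¬ WithUpperSet.ofUpperSet q ≤ p} ?_⟩
  change IsUpperSet _
  exact fun a b hab ha hb => ha (le_trans hab hb)

variable {X : Type*} [TopologicalSpace X] {s : Stratification P X}
  {R : Stratum s (I (Fin.last n)) → Simplex n → X}

lemma IsAspire.apply_last (h : IsAspire s I R) (x : Stratum s (I (Fin.last n))) :
    R x (stdSimplex.vertex (Fin.last n)) = x.1 := by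
  obtain ⟨F, -, h1, h2⟩ := h.lower (Fin.last n)
  have h0 : ∀ j < Fin.last n, (stdSimplex.vertex (Fin.last n) : Simplex n) j = 0 := fun j hj => by
    rw [vertex_last_apply, if_neg hj.ne]
  exact (h1 (⟨x.1, Or.inl x.2⟩, ⟨_, h0⟩) x.2).symm.trans (h2 (⟨x.1, Or.inl x.2⟩, ⟨_, h0⟩) x.2.le)

/-- Tube lemma: the extended map is constant with value `x₀` on `x₀` times the face, and the face is
compact, so one neighborhood of `x₀` works for all `u`. -/
lemma IsAspire.eventually_mem (h : IsAspire s I R) {k : Fin (n + 1)} {x₀ : X} (hx : s x₀ ≤ I k)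
    {V : Set X} (hV : V ∈ 𝓝 x₀) :
    ∀ᶠ x in 𝓝 x₀, ∀ (hx : s x = I (Fin.last n)) (u : Simplex n), (∀ j < k, u j = 0) →
      R ⟨x, hx⟩ u ∈ V := by
  obtain ⟨F, hF, h1, h2⟩ := h.lower k
  have hc : IsClosed {u : Simplex n | ∀ j < k, u j = 0} := by
    simp only [Set.ofPred_forall]
    exact isClosed_iInter fun j => isClosed_iInter fun _ =>
      isClosed_eq (continuous_coord j) continuous_const
  have : CompactSpace {u : Simplex n // ∀ j < k, u j = 0} :=
    isCompact_iff_compactSpace.1 hc.isCompact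
  have key := isCompact_univ.eventually_forall_of_forall_eventually
    (x₀ := (⟨x₀, Or.inr hx⟩ : {x : X // s x = I (Fin.last n) ∨ s x ≤ I k}))
    (K := (Set.univ : Set {u : Simplex n // ∀ j < k, u j = 0}))
    (P := fun x u => F (x, u) ∈ V) (fun u _ => hF.continuousAt.eventually_mem (by
      rw [h2 _ hx]; exact hV))
  rw [nhds_subtype_eq_comap, Filter.eventually_comap] at key
  filter_upwards [key] with x hx' hxn u hu
  have := hx' ⟨x, Or.inl hxn⟩ rfl ⟨u, hu⟩ trivial
  rwa [h1 _ hxn] at this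

/-- For `k` the last index the face is a single vertex and the condition is `hl`. For smaller `k`
the p_n-stratum is open in X_{p_n} ∪ X_{≤ p}, being the complement of a closed set, so beyond
continuity of `R` only the points of X_{≤ p} need an argument. -/
lemma IsAspire.of_eventually_mem
    (hc : Continuous fun z : Stratum s (I (Fin.last n)) × Simplex n => R z.1 z.2)
    (hs : ∀ x u, s (R x u) = simplexStrat I.toOrderHom u)
    (hl : ∀ x, R x (stdSimplex.vertex (Fin.last n)) = x.1)
    (ht : ∀ (k : Fin (n + 1)) (x₀ : X), k < Fin.last n → s x₀ ≤ I k → ∀ V ∈ 𝓝 x₀,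
      ∀ᶠ x in 𝓝 x₀, ∀ (hx : s x = I (Fin.last n)) (u : Simplex n), (∀ j < k, u j = 0) →
        R ⟨x, hx⟩ u ∈ V) :
    IsAspire s I R := by
  classical
  refine ⟨hc, hs, fun k => ?_⟩
  rcases eq_or_ne k (Fin.last n) with rfl | hk
  · refine ⟨fun z => z.1.1, continuous_subtype_val.comp continuous_fst, fun z h => ?_,
      fun z _ => rfl⟩
    rw [eq_vertex_last z.2.2, hl]
  have hk := lt_of_le_of_ne (Fin.le_last k) hk
  have hdis : ∀ x, s x ≤ I k → s x ≠ I (Fin.last n) := fun x h1 h2 =>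
    ((I.lt_iff_lt.2 hk).trans_eq h2.symm).not_ge h1
  refine ⟨fun z => if h : s z.1.1 = I (Fin.last n) then R ⟨z.1.1, h⟩ z.2.1 else z.1.1, ?_,
    fun z h => dif_pos h, fun z h => dif_neg (hdis _ h)⟩
  refine continuous_iff_continuousAt.2 fun z => ?_
  by_cases h : s z.1.1 = I (Fin.last n)
  · have ho : IsOpen {z : {x : X // s x = I (Fin.last n) ∨ s x ≤ I k} ×
        {u : Simplex n // ∀ j < k, u j = 0} | s z.1.1 = I (Fin.last n)} := by
      have := (s.isClosed_le (I k)).preimage (continuous_subtype_val.comp (continuous_fst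
        (X := {x : X // s x = I (Fin.last n) ∨ s x ≤ I k})
        (Y := {u : Simplex n // ∀ j < k, u j = 0})))
      convert this.isOpen_compl using 1
      ext z
      exact ⟨fun h1 h2 => hdis _ h2 h1, fun h1 => z.1.2.resolve_right h1⟩
    refine ContinuousOn.continuousAt ?_ (ho.mem_nhds h)
    rw [continuousOn_iff_continuous_domRestrict]
    have : Continuous fun z : {z : {x : X // s x = I (Fin.last n) ∨ s x ≤ I k} ×
        {u : Simplex n // ∀ j < k, u j = 0} | s z.1.1 = I (Fin.last n)} =>
        R ⟨z.1.1.1, z.2⟩ z.1.2.1 :=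
      hc.comp (Continuous.prodMk (Continuous.subtype_mk (continuous_subtype_val.comp
        (continuous_fst.comp continuous_subtype_val)) _)
        (continuous_subtype_val.comp (continuous_snd.comp continuous_subtype_val)))
    refine this.congr fun z => ?_
    have hz : s z.1.1.1 = I (Fin.last n) := z.2
    rw [Set.domRestrict_apply, dif_pos hz]
  · have hle := z.1.2.resolve_left h
    intro V hV
    simp only [dif_neg h] at hV
    have hz : ContinuousAt (fun z : {x : X // s x = I (Fin.last n) ∨ s x ≤ I k} ×
        {u : Simplex n // ∀ j < k, u j = 0} => z.1.1) z :=
      (continuous_subtype_val.comp continuous_fst).continuousAt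
    have h1 := hz.eventually (ht k z.1.1 hk hle V hV)
    have h2 := hz.eventually_mem hV
    change ∀ᶠ y in 𝓝 z, (if h : s y.1.1 = I (Fin.last n) then R ⟨y.1.1, h⟩ y.2.1 else y.1.1) ∈ V
    filter_upwards [h1, h2] with y h1 h2
    split_ifs with hy
    · exact h1 hy _ y.2.2
    · exact h2

end Tube

/-! ### Closed covers by two maps -/

section ClosedCover

lemma continuous_of_closed_cover {X B Y Z : Type*} [TopologicalSpace X] [TopologicalSpace B]
    [TopologicalSpace Y] [TopologicalSpace Z] {i : X → Y} {g : B → Y} (hi : IsClosedMap i)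
    (hg : IsClosedMap g) (hc : ∀ y, y ∈ Set.range i ∨ y ∈ Set.range g) {F : Y → Z}
    (hFi : Continuous (F ∘ i)) (hFg : Continuous (F ∘ g)) : Continuous F := by
  refine continuous_iff_isClosed.2 fun K hK => ?_
  convert (hi _ (hK.preimage hFi)).union (hg _ (hK.preimage hFg)) using 1
  ext y
  constructor
  · intro hy
    rcases hc y with ⟨x, rfl⟩ | ⟨x, rfl⟩
    · exact Or.inl ⟨x, hy, rfl⟩
    · exact Or.inr ⟨x, hy, rfl⟩
  · rintro (⟨x, hx, rfl⟩ | ⟨x, hx, rfl⟩) <;> exact hx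

/-- Properness is used instead of closedness because the map has to remain closed after taking the
product with a simplex. -/
lemma StratMap.isProperMap_onStratum {P : Type*} [PartialOrder P] {X Y : Type*}
    [TopologicalSpace X] [TopologicalSpace Y] {s : Stratification P X} {t : Stratification P Y}
    {f : StratMap s t} (hf : IsProperMap f) (p : P) : IsProperMap (f.onStratum p) := by
  have h := hf.restrictPreimage {y | t y = p}
  have e : {x | s x = p} = f ⁻¹' {y | t y = p} := by
    ext x
    exact (f.map_strat x ▸ Iff.rfl : s x = p ↔ t (f x) = p)
  exact h.comp (Homeomorph.setCongr e).isProperMap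

end ClosedCover

/-! ### Gluing of aspires -/

section Glue

variable {P : Type*} [PartialOrder P] {n : ℕ} {I : Fin (n + 1) ↪o P}
  {X Y : Type*} [TopologicalSpace X] [TopologicalSpace Y]
  {sX : Stratification P X} {sY : Stratification P Y} {i : StratMap sX sY}
  {RX : Stratum sX (I (Fin.last n)) → Simplex n → X}

lemma extendByPoint_apply (hi : Function.Injective i) (x : Stratum sX (I (Fin.last n)))
    (u : Simplex n) : extendByPoint i I RX (i x.1) u = i (RX x u) := by
  have : Function.Injective fun x : Stratum sX (I (Fin.last n)) => i x.1 :=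
    fun a b h => Subtype.ext (hi h)
  exact congrFun (this.extend_apply (fun x u => i (RX x u)) (fun y _ => y) x) u

lemma extendByPoint_of_notMem {y : Y} (h : ¬ ∃ x : Stratum sX (I (Fin.last n)), i x.1 = y)
    (u : Simplex n) : extendByPoint i I RX y u = y :=
  congrFun (Function.extend_apply' (fun x u => i (RX x u)) (fun y _ => y) y h) u

lemma extendByPoint_of_strat_ne {y : Y} (h : sY y ≠ I (Fin.last n)) (u : Simplex n) :
    extendByPoint i I RX y u = y := by
  refine extendByPoint_of_notMem ?_ u
  rintro ⟨x, rfl⟩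
  exact h ((i.map_strat x.1).trans x.2)

lemma extendByPoint_last (hi : Function.Injective i) (hR : IsAspire sX I RX) (y : Y) :
    extendByPoint i I RX y (stdSimplex.vertex (Fin.last n)) = y := by
  by_cases h : ∃ x : Stratum sX (I (Fin.last n)), i x.1 = y
  · obtain ⟨x, rfl⟩ := h
    rw [extendByPoint_apply hi, hR.apply_last]
  · exact extendByPoint_of_notMem h _

/-- The extension by the identity need not be continuous, but it moves points little near a lower
stratum: a nearby `y` is either fixed, or comes from a point of X close to the fiber over `y₀`
because `i` is closed. -/
lemma extendByPoint_eventually_mem (hi : IsClosedEmbedding i) (hR : IsAspire sX I RX)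
    {k : Fin (n + 1)} {y₀ : Y} (hy : sY y₀ ≤ I k) {V : Set Y} (hV : V ∈ 𝓝 y₀) :
    ∀ᶠ y in 𝓝 y₀, ∀ u : Simplex n, (∀ j < k, u j = 0) → extendByPoint i I RX y u ∈ V := by
  have h := hi.isClosedMap.eventually_nhds_fiber (y₀ := y₀) (p := fun x =>
    ∀ (hx : sX x = I (Fin.last n)) (u : Simplex n), (∀ j < k, u j = 0) → RX ⟨x, hx⟩ u ∈ i ⁻¹' V)
    (fun x₀ hx₀ => by
      obtain rfl : i x₀ = y₀ := hx₀
      refine hR.eventually_mem ?_ (i.continuous_toFun.continuousAt.preimage_mem_nhds hV)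
      rwa [← i.map_strat])
  filter_upwards [h, hV] with y h1 h2 u hu
  by_cases h : ∃ x : Stratum sX (I (Fin.last n)), i x.1 = y
  · obtain ⟨x, rfl⟩ := h
    rw [extendByPoint_apply hi.injective]
    exact h1 x.1 rfl x.2 u hu
  · rwa [extendByPoint_of_notMem h]

lemma continuousOn_extendByPoint (hi : IsClosedEmbedding i) (hR : IsAspire sX I RX) :
    ContinuousOn (fun z : Y × Simplex n => extendByPoint i I RX z.1 z.2)
      {z | ∃ x : Stratum sX (I (Fin.last n)), i x.1 = z.1} := by
  let e : Stratum sX (I (Fin.last n)) × Simplex n → Y × Simplex n := fun z => (i z.1.1, z.2)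
  have he : IsInducing e :=
    (hi.isInducing.comp IsInducing.subtypeVal).prodMap IsInducing.id
  have hr : {z : Y × Simplex n | ∃ x : Stratum sX (I (Fin.last n)), i x.1 = z.1} = Set.range e := by
    ext ⟨y, u⟩
    constructor
    · rintro ⟨x, rfl⟩
      exact ⟨(x, u), rfl⟩
    · rintro ⟨⟨x, v⟩, hx⟩
      exact ⟨x, congrArg Prod.fst hx⟩
  rw [hr]
  rintro _ ⟨z, rfl⟩
  rw [ContinuousWithinAt, ← he.map_nhds_eq, Filter.tendsto_map'_iff]
  refine (Continuous.tendsto ?_ z)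
  exact (i.continuous_toFun.comp hR.continuous).congr fun z =>
    (extendByPoint_apply hi.injective z.1 z.2).symm

variable {B : Type*} [TopologicalSpace B] {sB : Stratification P B} {g : StratMap sB sY}
  {ψ : C(Stratum sB (I (Fin.last n)), unitInterval)}
  {RB : Stratum sB (I (Fin.last n)) → Simplex n → B}

/-- The map `(b, u) ↦ ((g ∘ RB b) ⋆_{ψ b} RX) u`. -/
def starMap (g : StratMap sB sY) (i : StratMap sX sY)
    (ψ : C(Stratum sB (I (Fin.last n)), unitInterval))
    (RX : Stratum sX (I (Fin.last n)) → Simplex n → X)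
    (RB : Stratum sB (I (Fin.last n)) → Simplex n → B)
    (b : Stratum sB (I (Fin.last n))) (u : Simplex n) : Y :=
  extendByPoint i I RX (g (RB b (pushTop (ψ b) u))) (topPart (ψ b) u)

lemma starMap_of_le (hi : Function.Injective i) (hRX : IsAspire sX I RX)
    {b : Stratum sB (I (Fin.last n))} {u : Simplex n} (h : (ψ b : ℝ) ≤ u (Fin.last n)) :
    starMap g i ψ RX RB b u = g (RB b u) := by
  rw [starMap, pushTop_of_le h, topPart_of_le h, extendByPoint_last hi hRX]

/-- At level 1 all mass is moved to the last vertex, where `RB` is the identity. Hence the star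
formula agrees on A with the prescription coming from X. -/
lemma starMap_of_eq_one (hRB : IsAspire sB I RB) {b : Stratum sB (I (Fin.last n))}
    (h : (ψ b : ℝ) = 1) (u : Simplex n) :
    starMap g i ψ RX RB b u = extendByPoint i I RX (g b.1) u := by
  rw [starMap, pushTop_of_one h, topPart_of_one h, hRB.apply_last]

lemma IsAspire.strat_eq_last (hRB : IsAspire sB I RB) (b : Stratum sB (I (Fin.last n)))
    {u : Simplex n} (h : 0 < u (Fin.last n)) : sB (RB b u) = I (Fin.last n) := by
  rw [hRB.strat]
  exact congrArg I (maxIndex_eq h fun l hl => absurd (Fin.le_last l) hl.not_ge)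

/-- Only level 0 needs care, since there `y₁` is not determined by the combination. If `y₀` has no
mass at p_n, the inner point lies outside the p_n-stratum and is fixed for every `y₁`; otherwise the
face condition forces `y₁` to be the last vertex. -/
lemma isStar_starMap (hi : Function.Injective i) (hRX : IsAspire sX I RX)
    (hRB : IsAspire sB I RB) (b : Stratum sB (I (Fin.last n))) :
    IsStar (fun u => g (RB b u)) (ψ b) (extendByPoint i I RX) (starMap g i ψ RX RB b) := by
  intro k y₀ y₁ h₀ h₁
  rcases (ψ b).2.1.eq_or_lt with h | h
  · rw [starMap_of_le hi hRX (h ▸ stdSimplex.zero_le _ _), combo_of_eq_zero h.symm,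
      combo_of_eq_zero h.symm]
    rcases (stdSimplex.zero_le y₀ (Fin.last n)).eq_or_lt with h' | h'
    · refine (extendByPoint_of_strat_ne ?_ _).symm
      rw [g.map_strat, hRB.strat]
      intro e
      have := maxIndex_pos y₀
      rw [I.injective e] at this
      exact this.ne h'
    · have hk : k = Fin.last n := by
        by_contra hk
        exact h'.ne' (h₀ _ (lt_of_le_of_ne (Fin.le_last _) hk))
      subst hk
      rw [eq_vertex_last h₁, extendByPoint_last hi hRX]
  · rw [starMap, pushTop_combo _ h₀ h₁, topPart_combo h h₀ h₁]

/-- Any positive amount of mass taken from the top includes mass at the highest vertex of the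
support. -/
lemma maxIndex_topPart {t : unitInterval} (ht : 0 < (t : ℝ)) (u : Simplex n) :
    maxIndex (topPart t u) = maxIndex u := by
  refine maxIndex_eq ?_ fun l hl => ?_
  · rw [topPart_apply ht, cut, tail_eq_zero u (k := (maxIndex u : ℕ) + 1)
      (fun j hj => eq_zero_of_maxIndex_lt (Fin.lt_def.2 hj)), min_eq_left ht.le, sub_zero]
    refine div_pos (lt_min (lt_of_lt_of_le (maxIndex_pos u) ?_) ht) ht
    rw [tail_succ]
    exact le_add_of_nonneg_right (tail_nonneg _ _)
  · have h1 := cut_le t u l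
    have h2 := cut_nonneg t u l
    rw [eq_zero_of_maxIndex_lt hl] at h1
    rw [topPart_apply ht, le_antisymm h1 h2, zero_div]

/-- Below the level the inner point has last coordinate exactly `ψ b > 0`, so it comes from a point
of X_{p_n}, and then `RX` applied to the top part decides the stratum. -/
lemma strat_starMap (hi : Function.Injective i) (hRX : IsAspire sX I RX)
    (hRB : IsAspire sB I RB)
    (hmem : ∀ b u, u (Fin.last n) = (ψ b : ℝ) → g (RB b u) ∈ Set.range i)
    (b : Stratum sB (I (Fin.last n))) (u : Simplex n) :
    sY (starMap g i ψ RX RB b u) = simplexStrat I.toOrderHom u := by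
  rcases le_or_gt (ψ b : ℝ) (u (Fin.last n)) with h | h
  · rw [starMap_of_le hi hRX h, g.map_strat, hRB.strat]
  · have ht : 0 < (ψ b : ℝ) := (stdSimplex.zero_le _ _).trans_lt h
    have hw := pushTop_last_of_le h.le
    obtain ⟨x, hx⟩ := hmem b _ hw
    have hs : sX x = I (Fin.last n) := by
      rw [← i.map_strat]
      exact (congrArg sY hx).trans ((g.map_strat _).trans (hRB.strat_eq_last b (by rwa [hw])))
    rw [starMap, ← hx]
    refine (congrArg sY (extendByPoint_apply hi ⟨x, hs⟩ _)).trans ((i.map_strat _).trans ?_)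
    rw [hRX.strat]
    exact congrArg I (maxIndex_topPart ht u)

/-- Two smallness estimates compose: `RB` keeps points near `b₀`, and the extension of `RX` keeps
points near `g b₀`. Both apply because cutting does not leave the face of indices at least `k`. -/
lemma starMap_eventually_mem (hi : IsClosedEmbedding i) (hRX : IsAspire sX I RX)
    (hRB : IsAspire sB I RB) {k : Fin (n + 1)} (hk : k < Fin.last n) {b₀ : B} (hb : sB b₀ ≤ I k)
    {V : Set Y} (hV : V ∈ 𝓝 (g b₀)) :
    ∀ᶠ b in 𝓝 b₀, ∀ (hb : sB b = I (Fin.last n)) (u : Simplex n), (∀ j < k, u j = 0) →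
      starMap g i ψ RX RB ⟨b, hb⟩ u ∈ V := by
  have h1 := extendByPoint_eventually_mem (RX := RX) hi hRX
    (show sY (g b₀) ≤ I k from (g.map_strat b₀).trans_le hb) hV
  filter_upwards [hRB.eventually_mem hb (g.continuous_toFun.continuousAt.eventually h1)]
    with b h hbn u hu
  refine h hbn _ (fun j hj => pushTop_eq_zero (hj.trans hk).ne (hu j hj)) _ fun j hj => ?_
  by_cases ht : 0 < (ψ ⟨b, hbn⟩ : ℝ)
  · have h1 := cut_le (ψ ⟨b, hbn⟩) u j
    have h2 := cut_nonneg (ψ ⟨b, hbn⟩) u j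
    rw [hu j hj] at h1
    rw [topPart_apply ht, le_antisymm h1 h2, zero_div]
  · rw [topPart_zero ht, vertex_last_apply, if_neg (hj.trans hk).ne]

lemma continuous_starMap (hi : IsClosedEmbedding i) (hRX : IsAspire sX I RX)
    (hRB : IsAspire sB I RB)
    (hmem : ∀ b u, u (Fin.last n) = (ψ b : ℝ) → g (RB b u) ∈ Set.range i) :
    Continuous fun z : Stratum sB (I (Fin.last n)) × Simplex n =>
      starMap g i ψ RX RB z.1 z.2 := by
  have hψ : Continuous fun z : Stratum sB (I (Fin.last n)) × Simplex n => (ψ z.1 : ℝ) :=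
    continuous_subtype_val.comp (ψ.continuous.comp continuous_fst)
  have hlast : Continuous fun z : Stratum sB (I (Fin.last n)) × Simplex n => z.2 (Fin.last n) :=
    (continuous_coord _).comp continuous_snd
  have hgRB : Continuous fun z : Stratum sB (I (Fin.last n)) × Simplex n => g (RB z.1 z.2) :=
    g.continuous_toFun.comp hRB.continuous
  have hpair : Continuous fun z : Stratum sB (I (Fin.last n)) × Simplex n => (ψ z.1, z.2) :=
    (ψ.continuous.comp continuous_fst).prodMk continuous_snd
  have hpush : Continuous fun z : Stratum sB (I (Fin.last n)) × Simplex n =>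
      g (RB z.1 (pushTop (ψ z.1) z.2)) :=
    hgRB.comp (continuous_fst.prodMk (continuous_pushTop.comp hpair))
  -- On the closed set `D` the map is `g ∘ RB`; what remains is the limit from the complement of
  -- `D`.
  let D := {z : Stratum sB (I (Fin.last n)) × Simplex n | (ψ z.1 : ℝ) ≤ z.2 (Fin.last n)}
  have hD : IsClosed D := isClosed_le hψ hlast
  refine continuous_iff_continuousAt.2 fun z => ?_
  rw [← continuousWithinAt_univ, ← Set.union_compl_self D, continuousWithinAt_union]
  constructor
  · by_cases hz : z ∈ D
    · exact hgRB.continuousWithinAt.congr (fun y hy => starMap_of_le hi.injective hRX hy)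
        (starMap_of_le hi.injective hRX hz)
    · exact continuousWithinAt_of_notMem_closure (by rwa [hD.closure_eq])
  · by_cases hz : z ∈ closure Dᶜ
    swap
    · exact continuousWithinAt_of_notMem_closure hz
    have hle : z.2 (Fin.last n) ≤ ψ z.1 :=
      closure_minimal (fun y hy => (not_le.1 hy).le) (isClosed_le hlast hψ) hz
    have hDpos : ∀ y ∈ Dᶜ, 0 < (ψ y.1 : ℝ) := fun y hy =>
      (stdSimplex.zero_le _ _).trans_lt (not_le.1 hy)
    rcases (ψ z.1).2.1.eq_or_lt with h0 | h0
    -- Level 0: `topPart` need not converge. However, nearby top parts lie in the face starting at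
    -- the highest vertex of `z.2`, because the level is eventually smaller than the mass there, and
    -- on this face the extension of `RX` is uniformly close to the identity near the limit point.
    · have hz0 : z.2 (Fin.last n) = 0 := le_antisymm (hle.trans h0.ge) (stdSimplex.zero_le _ _)
      have hzD : (ψ z.1 : ℝ) ≤ z.2 (Fin.last n) := h0 ▸ hz0.ge
      have hs : sY (g (RB z.1 z.2)) = I (maxIndex z.2) := by
        rw [g.map_strat, hRB.strat]; rfl
      intro V hV
      simp only [starMap_of_le hi.injective hRX hzD] at hV
      have h1 := extendByPoint_eventually_mem (RX := RX) hi hRX hs.le hV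
      have h2 : ∀ᶠ y in 𝓝 z, ∀ u : Simplex n, (∀ j < maxIndex z.2, u j = 0) →
          extendByPoint i I RX (g (RB y.1 (pushTop (ψ y.1) y.2))) u ∈ V :=
        (hpush.tendsto' z (g (RB z.1 z.2)) (by simp only [pushTop_of_le hzD])).eventually h1
      have h3 : ∀ᶠ y in 𝓝 z, (ψ y.1 : ℝ) < tail y.2 (maxIndex z.2) := by
        refine hψ.continuousAt.eventually_lt
          ((continuous_tail _).comp continuous_snd).continuousAt ?_
        change (ψ z.1 : ℝ) < tail z.2 (maxIndex z.2)
        rw [tail_succ, ← show (0 : ℝ) = ψ z.1 from h0]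
        exact add_pos_of_pos_of_nonneg (maxIndex_pos _) (tail_nonneg _ _)
      change ∀ᶠ y in 𝓝[Dᶜ] z, starMap g i ψ RX RB y.1 y.2 ∈ V
      filter_upwards [nhdsWithin_le_nhds h2, nhdsWithin_le_nhds h3, self_mem_nhdsWithin]
        with y h2 h3 hy
      exact h2 _ (topPart_eq_zero (hDpos y hy) h3.le)
    -- Positive level: the inner points lie in i(X_{p_n}), where the extension of `RX` is
    -- continuous, and `topPart` is continuous too.
    · have hex : ∀ y : Stratum sB (I (Fin.last n)) × Simplex n, 0 < (ψ y.1 : ℝ) →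
          y.2 (Fin.last n) ≤ ψ y.1 → ∃ x : Stratum sX (I (Fin.last n)),
            i x.1 = g (RB y.1 (pushTop (ψ y.1) y.2)) := fun y hy hy' => by
        have hw := pushTop_last_of_le hy'
        obtain ⟨x, hx⟩ := hmem y.1 _ hw
        refine ⟨⟨x, ?_⟩, hx⟩
        rw [← i.map_strat]
        exact (congrArg sY hx).trans ((g.map_strat _).trans (hRB.strat_eq_last _ (by rwa [hw])))
      have htop : ContinuousAt (fun y : Stratum sB (I (Fin.last n)) × Simplex n =>
          topPart (ψ y.1) y.2) z := by
        refine ContinuousAt.comp (f := fun y : Stratum sB (I (Fin.last n)) × Simplex n =>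
          (ψ y.1, y.2)) (g := fun z : unitInterval × Simplex n => topPart z.1 z.2)
          (continuousOn_topPart.continuousAt ((isOpen_lt continuous_const
            (continuous_subtype_val.comp continuous_fst)).mem_nhds h0)) hpair.continuousAt
      exact ContinuousWithinAt.comp (f := fun y : Stratum sB (I (Fin.last n)) × Simplex n =>
        (g (RB y.1 (pushTop (ψ y.1) y.2)), topPart (ψ y.1) y.2))
        (continuousOn_extendByPoint hi hRX _ (hex z h0 hle))
        (hpush.continuousAt.prodMk htop).continuousWithinAt
        (fun y hy => hex y (hDpos y hy) (le_of_not_ge (show ¬ (ψ y.1 : ℝ) ≤ _ from hy)))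

/-- Gluing of aspires along a closed cover of `Y` by a closed embedding `i : X → Y` and a proper
map `g : B → Y` which is injective away from `X`. -/
theorem exists_isGlued (hi : IsClosedEmbedding i) (hg : IsProperMap g)
    (hc : ∀ y, y ∈ Set.range i ∨ y ∈ Set.range g)
    (hinj : ∀ b b', g b = g b' → b = b' ∨ g b ∈ Set.range i)
    (hψ : ∀ b, g b.1 ∈ Set.range i → ψ b = 1)
    (hRX : IsAspire sX I RX) (hRB : IsAspire sB I RB)
    (hmem : ∀ b u, u (Fin.last n) = (ψ b : ℝ) → g (RB b u) ∈ Set.range i) :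
    ∃ RY : Stratum sY (I (Fin.last n)) → Simplex n → Y,
      IsGlued g i I ψ RX RB RY ∧ (∀ R', IsGlued g i I ψ RX RB R' → R' = RY) ∧
        IsAspire sY I RY := by
  classical
  have hB : ∀ y : Stratum sY (I (Fin.last n)), y.1 ∉ Set.range i →
      ∃ b : Stratum sB (I (Fin.last n)), g b.1 = y.1 := fun y hy => by
    obtain ⟨b, hb⟩ := (hc y.1).resolve_left hy
    exact ⟨⟨b, (g.map_strat b).symm.trans ((congrArg sY hb).trans y.2)⟩, hb⟩
  choose pre hpre using hB
  let RY : Stratum sY (I (Fin.last n)) → Simplex n → Y := fun y u =>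
    if h : y.1 ∈ Set.range i then extendByPoint i I RX y.1 u else starMap g i ψ RX RB (pre y h) u
  -- The two prescriptions agree where they overlap: a point of B landing in i(X) has level 1, and
  -- elsewhere the preimage under `g` is unique.
  have hX : ∀ x u, RY (i.onStratum _ x) u = i (RX x u) := fun x u =>
    (dif_pos ⟨x.1, rfl⟩).trans (extendByPoint_apply hi.injective x u)
  have hgB : ∀ b u, RY (g.onStratum _ b) u = starMap g i ψ RX RB b u := fun b u => by
    by_cases h : g b.1 ∈ Set.range i
    · rw [starMap_of_eq_one hRB (by rw [hψ b h]; rfl)]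
      exact dif_pos h
    · refine (dif_neg h).trans ?_
      have := hpre (g.onStratum _ b) h
      have e : pre (g.onStratum _ b) h = b :=
        Subtype.ext ((hinj _ _ this).resolve_right (this ▸ h))
      rw [e]
  have hcases : ∀ y : Stratum sY (I (Fin.last n)), (∃ x, i.onStratum _ x = y) ∨
      ∃ b, g.onStratum _ b = y := fun y => by
    by_cases h : y.1 ∈ Set.range i
    · obtain ⟨x, hx⟩ := h
      exact Or.inl ⟨⟨x, (i.map_strat x).symm.trans ((congrArg sY hx).trans y.2)⟩, Subtype.ext hx⟩
    · exact Or.inr ⟨pre y h, Subtype.ext (hpre y h)⟩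
  have hglued : IsGlued g i I ψ RX RB RY := by
    refine ⟨fun b => ?_, hX⟩
    rw [show RY (g.onStratum _ b) = starMap g i ψ RX RB b from funext (hgB b)]
    exact isStar_starMap hi.injective hRX hRB b
  refine ⟨RY, hglued, fun R' hR' => ?_, IsAspire.of_eventually_mem ?_ ?_ ?_ ?_⟩
  · funext y u
    rcases hcases y with ⟨x, rfl⟩ | ⟨b, rfl⟩
    · rw [hR'.on_X, hX]
    · obtain ⟨k, y₀, y₁, h₀, h₁, rfl⟩ := exists_combo (ψ b) u
      rw [hR'.on_B b k y₀ y₁ h₀ h₁, hglued.on_B b k y₀ y₁ h₀ h₁]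
  · refine continuous_of_closed_cover
      (i := Prod.map (i.onStratum (I (Fin.last n))) (id : Simplex n → Simplex n))
      (g := Prod.map (g.onStratum (I (Fin.last n))) (id : Simplex n → Simplex n))
      ((StratMap.isProperMap_onStratum hi.isProperMap _).prodMap isProperMap_id).isClosedMap
      ((StratMap.isProperMap_onStratum hg _).prodMap isProperMap_id).isClosedMap ?_ ?_ ?_
    · rintro ⟨y, u⟩
      exact (hcases y).imp (fun ⟨x, hx⟩ => ⟨(x, u), Prod.ext hx rfl⟩)
        (fun ⟨x, hx⟩ => ⟨(x, u), Prod.ext hx rfl⟩)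
    · exact (i.continuous_toFun.comp hRX.continuous).congr fun z => (hX z.1 z.2).symm
    · exact (continuous_starMap hi hRX hRB hmem).congr fun z => (hgB z.1 z.2).symm
  · intro y u
    rcases hcases y with ⟨x, rfl⟩ | ⟨b, rfl⟩
    · rw [hX, i.map_strat, hRX.strat]
    · rw [hgB, strat_starMap hi.injective hRX hRB hmem]
  · intro y
    rcases hcases y with ⟨x, rfl⟩ | ⟨b, rfl⟩
    · rw [hX, hRX.apply_last]; rfl
    · rw [hgB, starMap_of_le hi.injective hRX, hRB.apply_last]
      · rfl
      · rw [vertex_last_apply, if_pos rfl]; exact (ψ b).2.2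
  · intro k y₀ hk hy V hV
    have h1 := extendByPoint_eventually_mem (RX := RX) hi hRX hy hV
    have h2 := hg.isClosedMap.eventually_nhds_fiber (y₀ := y₀) (p := fun b =>
      ∀ (hb : sB b = I (Fin.last n)) (u : Simplex n), (∀ j < k, u j = 0) →
        starMap g i ψ RX RB ⟨b, hb⟩ u ∈ V) (fun b₀ hb₀ => by
      obtain rfl : g b₀ = y₀ := hb₀
      exact starMap_eventually_mem hi hRX hRB hk ((g.map_strat b₀).symm.trans_le hy) hV)
    filter_upwards [h1, h2] with y h1 h2 hy u hu
    rcases hcases ⟨y, hy⟩ with ⟨x, hx⟩ | ⟨b, hb⟩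
    · rw [← hx, hX, ← extendByPoint_apply hi.injective]
      rw [show i x.1 = y from congrArg Subtype.val hx]
      exact h1 u hu
    · rw [← hb, hgB]
      exact h2 b.1 (congrArg Subtype.val hb) b.2 u hu

end Glue

/-! ### Pushouts along closed subspaces of compact spaces -/

section Pushout

open CategoryTheory

variable {B X Y : Type u} [TopologicalSpace B] [TopologicalSpace X] [TopologicalSpace Y]
  {A : Set B} {f : C(A, X)} {g : C(B, Y)} {i : C(X, Y)}

lemma pushout_exists_desc
    (h : IsPushout (TopCat.ofHom (⟨Subtype.val, continuous_subtype_val⟩ : C(A, B)))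
      (TopCat.ofHom f) (TopCat.ofHom g) (TopCat.ofHom i))
    {Z : Type u} [TopologicalSpace Z] (p : C(B, Z)) (q : C(X, Z)) (hpq : ∀ a : A, p a.1 = q (f a)) :
    ∃ k : C(Y, Z), (∀ b, k (g b) = p b) ∧ ∀ x, k (i x) = q x := by
  have w : TopCat.ofHom (⟨Subtype.val, continuous_subtype_val⟩ : C(A, B)) ≫ TopCat.ofHom p =
      TopCat.ofHom f ≫ TopCat.ofHom q := by
    ext a
    exact hpq a
  refine ⟨(h.desc _ _ w).hom, fun b => ?_, fun x => ?_⟩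
  · exact ConcreteCategory.congr_hom (h.inl_desc _ _ w) b
  · exact ConcreteCategory.congr_hom (h.inr_desc _ _ w) x

lemma pushout_comm
    (h : IsPushout (TopCat.ofHom (⟨Subtype.val, continuous_subtype_val⟩ : C(A, B)))
      (TopCat.ofHom f) (TopCat.ofHom g) (TopCat.ofHom i)) (a : A) : g a.1 = i (f a) :=
  ConcreteCategory.congr_hom h.w a

/-- Every function to an indiscrete space is continuous, so the indicator of the union of the two
images can be compared with the constant function `True`; they agree on both legs. -/
lemma pushout_cover
    (h : IsPushout (TopCat.ofHom (⟨Subtype.val, continuous_subtype_val⟩ : C(A, B)))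
      (TopCat.ofHom f) (TopCat.ofHom g) (TopCat.ofHom i)) (y : Y) :
    y ∈ Set.range i ∨ y ∈ Set.range g := by
  let _ : TopologicalSpace (ULift.{u} Prop) := ⊤
  let a : C(Y, ULift.{u} Prop) := ⟨fun _ => ⟨True⟩, continuous_const⟩
  let b : C(Y, ULift.{u} Prop) := ⟨fun y => ⟨y ∈ Set.range i ∨ y ∈ Set.range g⟩, continuous_top⟩
  have e : TopCat.ofHom a = TopCat.ofHom b := by
    refine h.hom_ext ?_ ?_
    · ext x
      exact ⟨fun _ => Or.inr ⟨x, rfl⟩, fun _ => trivial⟩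
    · ext x
      exact ⟨fun _ => Or.inl ⟨x, rfl⟩, fun _ => trivial⟩
  have := congrArg ULift.down (ConcreteCategory.congr_hom e y)
  exact this.mp trivial

/-- Open sets are classified by continuous maps to the Sierpiński space `Prop`, so the universal
property glues two compatible open sets. -/
lemma pushout_isOpen_iff
    (h : IsPushout (TopCat.ofHom (⟨Subtype.val, continuous_subtype_val⟩ : C(A, B)))
      (TopCat.ofHom f) (TopCat.ofHom g) (TopCat.ofHom i)) {U : Set Y}
    (hg : IsOpen (g ⁻¹' U)) (hi : IsOpen (i ⁻¹' U)) : IsOpen U := by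
  obtain ⟨k, hk1, hk2⟩ := pushout_exists_desc h
    (Z := ULift.{u} Prop) ⟨fun b => ⟨g b ∈ U⟩, continuous_uliftUp.comp
      (isOpen_iff_continuous_mem.1 hg)⟩ ⟨fun b => ⟨i b ∈ U⟩, continuous_uliftUp.comp
      (isOpen_iff_continuous_mem.1 hi)⟩ (fun a => by
        simp only [ContinuousMap.coe_mk, pushout_comm h a])
  have hk : ∀ y, (k y).down = (y ∈ U) := fun y => by
    rcases pushout_cover h y with ⟨x, rfl⟩ | ⟨x, rfl⟩
    · rw [hk2]; rfl
    · rw [hk1]; rfl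
  refine isOpen_iff_continuous_mem.2 ?_
  exact (continuous_uliftDown.comp k.continuous).congr hk

lemma pushout_isClosed_iff
    (h : IsPushout (TopCat.ofHom (⟨Subtype.val, continuous_subtype_val⟩ : C(A, B)))
      (TopCat.ofHom f) (TopCat.ofHom g) (TopCat.ofHom i)) {K : Set Y}
    (hg : IsClosed (g ⁻¹' K)) (hi : IsClosed (i ⁻¹' K)) : IsClosed K :=
  ⟨pushout_isOpen_iff h hg.isOpen_compl hi.isOpen_compl⟩

/-- Fibers are read off by mapping Y to the set-theoretic pushout X ⊔ (B ∖ A), realized inside the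
indiscrete space `X ⊕ B`. -/
lemma pushout_fibers
    (h : IsPushout (TopCat.ofHom (⟨Subtype.val, continuous_subtype_val⟩ : C(A, B)))
      (TopCat.ofHom f) (TopCat.ofHom g) (TopCat.ofHom i)) :
    Function.Injective i ∧ (∀ b x, g b = i x → ∃ hb : b ∈ A, f ⟨b, hb⟩ = x) ∧
      ∀ b b', g b = g b' → b = b' ∨ ∃ (hb : b ∈ A) (hb' : b' ∈ A), f ⟨b, hb⟩ = f ⟨b', hb'⟩ := by
  classical
  let _ : TopologicalSpace (X ⊕ B) := ⊤
  obtain ⟨k, hk1, hk2⟩ := pushout_exists_desc h (Z := X ⊕ B)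
    ⟨fun b => if hb : b ∈ A then Sum.inl (f ⟨b, hb⟩) else Sum.inr b, continuous_top⟩
    ⟨Sum.inl, continuous_top⟩ (fun a => dif_pos a.2)
  simp only [ContinuousMap.coe_mk] at hk1 hk2
  refine ⟨fun x x' e => ?_, fun b x e => ?_, fun b b' e => ?_⟩
  · have := congrArg k e
    rw [hk2, hk2] at this
    exact Sum.inl_injective this
  · have := congrArg k e
    rw [hk1, hk2] at this
    split_ifs at this with hb
    exact ⟨hb, Sum.inl_injective this⟩
  · have := congrArg k e
    rw [hk1, hk1] at this
    split_ifs at this with hb hb' hb'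
    · exact Or.inr ⟨hb, hb', Sum.inl_injective this⟩
    · exact Or.inl (Sum.inr_injective this)

lemma pushout_isClosedEmbedding (hA : IsClosed A)
    (h : IsPushout (TopCat.ofHom (⟨Subtype.val, continuous_subtype_val⟩ : C(A, B)))
      (TopCat.ofHom f) (TopCat.ofHom g) (TopCat.ofHom i)) : IsClosedEmbedding i := by
  obtain ⟨h1, h2, -⟩ := pushout_fibers h
  refine .of_continuous_injective_isClosedMap i.continuous h1 fun K hK => ?_
  refine pushout_isClosed_iff h ?_ (by rwa [Set.preimage_image_eq _ h1])
  convert hA.isClosedEmbedding_subtypeVal.isClosedMap _ (hK.preimage f.continuous) using 1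
  ext b
  constructor
  · rintro ⟨x, hx, e⟩
    obtain ⟨hb, rfl⟩ := h2 b x e.symm
    exact ⟨⟨b, hb⟩, hx, rfl⟩
  · rintro ⟨a, ha, rfl⟩
    exact ⟨f a, ha, (pushout_comm h a).symm⟩

/-- For closed K one has g⁻¹(g K) = K ∪ f⁻¹(f(K ∩ A)) and i⁻¹(g K) = f(K ∩ A), and f is closed as a
map from a compact space to a Hausdorff space. Fibers are closed in the compact space B. -/
lemma pushout_isProperMap [CompactSpace B] [T1Space B] [T2Space X] (hA : IsClosed A)
    (h : IsPushout (TopCat.ofHom (⟨Subtype.val, continuous_subtype_val⟩ : C(A, B)))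
      (TopCat.ofHom f) (TopCat.ofHom g) (TopCat.ofHom i)) : IsProperMap g := by
  obtain ⟨h1, h2, h3⟩ := pushout_fibers h
  have : CompactSpace A := isCompact_iff_compactSpace.1 hA.isCompact
  have hcl : IsClosedMap g := fun K hK => by
    have hfK : IsClosed (f '' (Subtype.val ⁻¹' K)) :=
      f.continuous.isClosedMap _ (hK.preimage continuous_subtype_val)
    refine pushout_isClosed_iff h ?_ ?_
    · convert hK.union (hA.isClosedEmbedding_subtypeVal.isClosedMap _
        (hfK.preimage f.continuous)) using 1
      ext b
      constructor
      · rintro ⟨b', hb', e⟩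
        rcases h3 _ _ e with rfl | ⟨h4, h5, h6⟩
        · exact Or.inl hb'
        · exact Or.inr ⟨⟨b, h5⟩, ⟨⟨b', h4⟩, hb', h6⟩, rfl⟩
      · rintro (hb | ⟨a, ⟨a', ha', e⟩, rfl⟩)
        · exact ⟨b, hb, rfl⟩
        · exact ⟨a', ha', by rw [pushout_comm h, pushout_comm h, e]⟩
    · convert hfK using 1
      ext x
      constructor
      · rintro ⟨b, hb, e⟩
        obtain ⟨hbA, rfl⟩ := h2 _ _ e
        exact ⟨⟨b, hbA⟩, hb, rfl⟩
      · rintro ⟨a, ha, rfl⟩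
        exact ⟨a, ha, pushout_comm h a⟩
  refine isProperMap_iff_isClosedMap_and_compact_fibers.2 ⟨g.continuous, hcl, fun y => ?_⟩
  refine IsClosed.isCompact ?_
  have hi : ∀ x, IsClosed (g ⁻¹' {i x}) := fun x => by
    have := (pushout_isClosedEmbedding hA h).isClosedMap _ (isClosed_singleton (x := x))
    rw [Set.image_singleton] at this
    exact this.preimage g.continuous
  rcases pushout_cover h y with ⟨x, rfl⟩ | ⟨b, rfl⟩
  · exact hi x
  · by_cases hb : b ∈ A
    · rw [pushout_comm h ⟨b, hb⟩]
      exact hi _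
    · convert isClosed_singleton (x := b) using 1
      ext b'
      constructor
      · intro e
        exact (h3 b' b e).resolve_right fun h' => hb h'.2.1
      · rintro rfl
        rfl

end Pushout

/-! ### Finite cell complexes -/

namespace CellStructure

variable {P : Type*} [PartialOrder P] {X : Type*} [TopologicalSpace X]
  {s : Stratification P X} {ι : Type*} (C : CellStructure s ι)

lemma map_boundary_prec {i j : ι} {u : Simplex (C.dim j)} (hu : u ∈ simplexBoundary (C.dim j))
    (h : C.map j u ∈ C.openCell i) : C.Prec i j :=
  Relation.TransGen.single ⟨_, h, u, hu, rfl⟩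

variable {C}

lemma mem_interior_or_boundary {n : ℕ} (u : Simplex n) :
    u ∈ simplexInterior n ∨ u ∈ simplexBoundary n := by
  by_cases h : ∃ j, u j = 0
  · exact Or.inr h
  · push Not at h
    exact Or.inl fun j => lt_of_le_of_ne (stdSimplex.zero_le u j) (h j).symm

/-- A boundary point of a cell lies in an open cell that precedes it, which the subcomplex also
contains. -/
lemma Subcomplex.map_mem_carrier (A : C.Subcomplex) {i : ι} (hi : i ∈ A.cells)
    (u : Simplex (C.dim i)) : C.map i u ∈ A.carrier := by
  obtain ⟨j, hj, -⟩ := C.disjoint_union (C.map i u)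
  rcases mem_interior_or_boundary u with hu | hu
  · exact Set.mem_biUnion hi ⟨u, hu, rfl⟩
  · exact Set.mem_biUnion (A.closed_below j i (C.map_boundary_prec hu hj) hi) hj

lemma Subcomplex.carrier_eq (A : C.Subcomplex) :
    A.carrier = ⋃ i ∈ A.cells, Set.range (C.map i) := by
  refine subset_antisymm (Set.iUnion₂_mono fun i _ => Set.image_subset_range _ _) ?_
  refine Set.iUnion₂_subset fun i hi => ?_
  rintro _ ⟨u, rfl⟩
  exact A.map_mem_carrier hi u

lemma Subcomplex.isCompact_carrier [Finite ι] (A : C.Subcomplex) : IsCompact A.carrier := by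
  rw [A.carrier_eq]
  exact A.cells.toFinite.isCompact_biUnion fun i _ =>
    isCompact_range (C.map i).continuous_toFun

lemma whole_carrier : C.whole.carrier = Set.univ :=
  Set.eq_univ_of_forall fun x => by
    obtain ⟨j, hj, -⟩ := C.disjoint_union x
    exact Set.mem_biUnion (Set.mem_univ j) hj

lemma compactSpace (C : CellStructure s ι) [Finite ι] : CompactSpace X :=
  ⟨whole_carrier (C := C) ▸ C.whole.isCompact_carrier⟩

end CellStructure

/-- Gluing of aspires along pushouts of finite stratified cell complexes. -/
theorem exists_isGlued_of_isPushout {P : Type*} [PartialOrder P] {n : ℕ} {I : Fin (n + 1) ↪o P}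
    {B X Y : Type u} [TopologicalSpace B] [TopologicalSpace X] [TopologicalSpace Y]
    [T2Space B] [T2Space X] {sB : Stratification P B} {sX : Stratification P X}
    {sY : Stratification P Y} {ιB : Type*} [Finite ιB] {CB : CellStructure sB ιB}
    (A : CB.Subcomplex) (f : StratMap (sB.restrict A.carrier) sX)
    (g : StratMap sB sY) (i : StratMap sX sY)
    (h : CategoryTheory.IsPushout
      (TopCat.ofHom (⟨Subtype.val, continuous_subtype_val⟩ : C(A.carrier, B)))
      (TopCat.ofHom f.toContinuousMap) (TopCat.ofHom g.toContinuousMap)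
      (TopCat.ofHom i.toContinuousMap))
    (ψ : C(Stratum sB (I (Fin.last n)), unitInterval))
    (RX : Stratum sX (I (Fin.last n)) → Simplex n → X)
    (RB : Stratum sB (I (Fin.last n)) → Simplex n → B)
    (hψ : ∀ b, ψ b = 1 ↔ b.1 ∈ A.carrier) (hRX : IsAspire sX I RX) (hRB : IsAspire sB I RB)
    (hmem : ∀ b u, u (Fin.last n) = (ψ b : ℝ) → RB b u ∈ A.carrier) :
    ∃ RY : Stratum sY (I (Fin.last n)) → Simplex n → Y,
      IsGlued g i I ψ RX RB RY ∧ (∀ R', IsGlued g i I ψ RX RB R' → R' = RY) ∧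
        IsAspire sY I RY := by
  have : CompactSpace B := CB.compactSpace
  have hA := A.isCompact_carrier.isClosed
  obtain ⟨-, h2, h3⟩ := pushout_fibers h
  refine exists_isGlued (pushout_isClosedEmbedding hA h) (pushout_isProperMap hA h)
    (pushout_cover h) (fun b b' e => (h3 b b' e).imp_right ?_) ?_ hRX hRB fun b u hu => ?_
  · rintro ⟨hb, -⟩
    exact ⟨_, (pushout_comm h ⟨b, hb⟩).symm⟩
  · rintro b ⟨x, hx⟩
    exact (hψ b).2 (h2 b.1 x hx.symm).1
  · exact ⟨_, (pushout_comm h ⟨_, hmem b u hu⟩).symm⟩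

/-! ### Cubical coordinates on the barycentric subdivision -/

section Height

variable {m : ℕ}

/-- The cubical model of `|sd Δᵐ|`: functions on the vertices of `Δᵐ` with maximum `1`. -/
abbrev CubeFace (m : ℕ) : Type :=
  {h : Fin (m + 1) → ℝ // (∀ j, 0 ≤ h j) ∧ (∀ j, h j ≤ 1) ∧ ∃ j, h j = 1}

/-- The total weight of the vertices of `sd Δᵐ` which contain `j`. -/
def height (w : SdSimplex m) (j : Fin (m + 1)) : ℝ :=
  ∑ S : SdVertex m, if j ∈ S.1 then w.1 S else 0

lemma sdSimplex_total (w : SdSimplex m) {S T : SdVertex m} (hS : 0 < w.1 S) (hT : 0 < w.1 T) :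
    S.1 ⊆ T.1 ∨ T.1 ⊆ S.1 := w.2.total hS hT

lemma exists_weight_pos (w : SdSimplex m) : ∃ S : SdVertex m, 0 < w.1 S := by
  by_contra h
  push Not at h
  have h0 : ∀ S, w.1 S = 0 := fun S => le_antisymm (h S) (stdSimplex.zero_le _ _)
  have := stdSimplex.sum_eq_one w.1
  simp [h0] at this

lemma height_term_nonneg (w : SdSimplex m) (j : Fin (m + 1)) (S : SdVertex m) :
    0 ≤ if j ∈ S.1 then w.1 S else 0 := by
  split_ifs
  exacts [stdSimplex.zero_le _ _, le_rfl]

lemma height_nonneg (w : SdSimplex m) (j : Fin (m + 1)) : 0 ≤ height w j :=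
  Finset.sum_nonneg fun S _ => height_term_nonneg w j S

lemma height_le_one (w : SdSimplex m) (j : Fin (m + 1)) : height w j ≤ 1 := by
  rw [← stdSimplex.sum_eq_one w.1]
  refine Finset.sum_le_sum fun S _ => ?_
  split_ifs
  exacts [le_rfl, stdSimplex.zero_le _ _]

lemma weight_le_height (w : SdSimplex m) {j : Fin (m + 1)} {S : SdVertex m} (h : j ∈ S.1) :
    w.1 S ≤ height w j := by
  have := Finset.single_le_sum (fun T _ => height_term_nonneg w j T) (Finset.mem_univ S)
  rwa [if_pos h] at this

lemma height_pos_iff (w : SdSimplex m) (j : Fin (m + 1)) :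
    0 < height w j ↔ ∃ S : SdVertex m, 0 < w.1 S ∧ j ∈ S.1 := by
  constructor
  · intro h
    obtain ⟨S, -, hS⟩ := (Finset.sum_pos_iff_of_nonneg fun S _ => height_term_nonneg w j S).1 h
    split_ifs at hS with hj
    · exact ⟨S, hS, hj⟩
    · exact absurd hS (lt_irrefl _)
  · rintro ⟨S, hS, hj⟩
    exact hS.trans_le (weight_le_height w hj)

lemma height_mono (w : SdSimplex m) {j l : Fin (m + 1)}
    (h : ∀ S : SdVertex m, 0 < w.1 S → j ∈ S.1 → l ∈ S.1) : height w j ≤ height w l := by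
  refine Finset.sum_le_sum fun S _ => ?_
  by_cases hS : 0 < w.1 S
  · by_cases hj : j ∈ S.1
    · rw [if_pos hj, if_pos (h S hS hj)]
    · rw [if_neg hj]
      exact height_term_nonneg w l S
  · have : w.1 S = 0 := le_antisymm (not_lt.1 hS) (stdSimplex.zero_le _ _)
    simp [this]

/-- For a point of `|sd Δᵐ|` and any set `S` of vertices, some vertex of `S` is contained only in
those sets of the supporting chain which contain `S`. -/
lemma exists_mem_forall_subset (w : SdSimplex m) (S : SdVertex m) :
    ∃ j ∈ S.1, ∀ T : SdVertex m, 0 < w.1 T → j ∈ T.1 → S.1 ⊆ T.1 := by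
  classical
  let F := Finset.univ.filter fun T : SdVertex m => 0 < w.1 T ∧ ¬ S.1 ⊆ T.1
  by_cases hF : F.Nonempty
  · obtain ⟨T₀, hT₀⟩ := F.exists_maximal hF
    obtain ⟨-, h1, h2⟩ := Finset.mem_filter.1 hT₀.1
    obtain ⟨j, hj, hjT⟩ := Finset.not_subset.1 h2
    refine ⟨j, hj, fun T hT hjT' => ?_⟩
    by_contra hc
    rcases sdSimplex_total w h1 hT with h | h
    · exact hjT ((hT₀.2 (Finset.mem_filter.2 ⟨Finset.mem_univ T, hT, hc⟩) h) hjT')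
    · exact hjT (h hjT')
  · obtain ⟨j, hj⟩ := S.2
    refine ⟨j, hj, fun T hT _ => ?_⟩
    by_contra hc
    exact hF ⟨T, Finset.mem_filter.2 ⟨Finset.mem_univ T, hT, hc⟩⟩

/-- The total weight of the sets containing `S` is the minimal height on `S`, so it is determined by
the heights. Comparing two points at a maximal `S` where their weights differ then gives a
contradiction. -/
lemma height_injective : Function.Injective (height : SdSimplex m → Fin (m + 1) → ℝ) := by
  classical
  let U (w : SdSimplex m) (S : SdVertex m) : ℝ := ∑ T : SdVertex m, if S.1 ⊆ T.1 then w.1 T else 0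
  have hle : ∀ w w' : SdSimplex m, height w = height w' → ∀ S, U w S ≤ U w' S := by
    intro w w' e S
    obtain ⟨j, hj, h⟩ := exists_mem_forall_subset w' S
    refine (Finset.sum_le_sum fun T _ => ?_ : U w S ≤ height w j).trans
      ((congrFun e j).trans_le (Finset.sum_le_sum fun T _ => ?_))
    · split_ifs with h1 h2 h2
      exacts [le_rfl, absurd (h1 hj) h2, stdSimplex.zero_le _ _, le_rfl]
    · split_ifs with h1 h2 h2
      · exact le_rfl
      · exact not_lt.1 fun hT => h2 (h T hT h1)
      · exact stdSimplex.zero_le _ _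
      · exact le_rfl
  intro w w' e
  by_contra hne
  have hF : (Finset.univ.filter fun S : SdVertex m => w.1 S ≠ w'.1 S).Nonempty := by
    by_contra hF
    rw [Finset.not_nonempty_iff_eq_empty, Finset.filter_eq_empty_iff] at hF
    exact hne (Subtype.ext (stdSimplex.ext (funext fun S => not_not.1 (hF (Finset.mem_univ S)))))
  obtain ⟨S, hS⟩ := Finset.exists_maximal hF
  have hU : U w S - U w' S = w.1 S - w'.1 S := by
    simp only [U, ← Finset.sum_sub_distrib]
    rw [Finset.sum_eq_single S]
    · simp
    · intro T _ hT
      by_cases h : S.1 ⊆ T.1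
      · rw [if_pos h, if_pos h, sub_eq_zero]
        by_contra hc
        exact hT (le_antisymm (hS.2 (Finset.mem_filter.2 ⟨Finset.mem_univ T, hc⟩) h) h)
      · rw [if_neg h, if_neg h, sub_zero]
    · simp
  rw [le_antisymm (hle w w' e S) (hle w' w e.symm S), sub_self] at hU
  exact (Finset.mem_filter.1 hS.1).2 (sub_eq_zero.1 hU.symm)

/-- Layer-cake formula: the weight of `S` is the length of the set of levels c ∈ (0, 1] whose
superlevel set {j | c ≤ h j} is `S`. Superlevel sets are nested, so the support is a chain, and the
sets containing `j` account for the levels in (0, h j]. -/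
lemma exists_height_eq (h : CubeFace m) : ∃ w : SdSimplex m, ∀ j, height w j = h.1 j := by
  classical
  let L (S : SdVertex m) : Set ℝ := {c | c ∈ Set.Ioc 0 1 ∧ ∀ j, j ∈ S.1 ↔ c ≤ h.1 j}
  have hL : ∀ S, MeasurableSet (L S) := fun S => by
    have : L S = Set.Ioc 0 1 ∩ ⋂ j, {c | j ∈ S.1 ↔ c ≤ h.1 j} := by
      ext c
      rw [Set.mem_inter_iff, Set.mem_iInter]
      rfl
    rw [this]
    refine measurableSet_Ioc.inter (MeasurableSet.iInter fun j => ?_)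
    by_cases hj : j ∈ S.1
    · simp only [hj, true_iff]
      exact measurableSet_Iic
    · simp only [hj, false_iff, not_le]
      exact measurableSet_Ioi
  have hdis : Pairwise (Function.onFun Disjoint L) := fun S T hST =>
    Set.disjoint_left.2 fun c hS hT => hST (Subtype.ext (Finset.ext fun j =>
      (hS.2 j).trans (hT.2 j).symm))
  let μ : Set ℝ → ℝ := MeasureTheory.volume.real
  have hfin : ∀ S, MeasureTheory.volume (L S) ≠ ⊤ := fun S =>
    ((MeasureTheory.measure_mono fun c hc => hc.1).trans_lt measure_Ioc_lt_top).ne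
  have hsum : ∀ (p : SdVertex m → Prop) [DecidablePred p] (j : Fin (m + 1)),
      (∀ S, (L S).Nonempty → (p S ↔ j ∈ S.1)) → ∑ S, (if p S then μ (L S) else 0) = h.1 j := by
    intro p _ j hp
    rw [← Finset.sum_filter, ← MeasureTheory.measureReal_biUnion_finset
      (fun S _ T _ hST => hdis hST) (fun S _ => hL S) (fun S _ => hfin S)]
    have : (⋃ S ∈ Finset.univ.filter p, L S) = Set.Ioc 0 (h.1 j) := by
      ext c
      simp only [Set.mem_iUnion, Finset.mem_filter, Finset.mem_univ, true_and, exists_prop]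
      constructor
      · rintro ⟨S, hS, hc⟩
        exact ⟨hc.1.1, (hc.2 j).1 ((hp S ⟨c, hc⟩).1 hS)⟩
      · rintro ⟨h0, h1⟩
        have hj : j ∈ Finset.univ.filter fun l => c ≤ h.1 l := by simpa using h1
        have hc : c ∈ L ⟨Finset.univ.filter fun l => c ≤ h.1 l, ⟨j, hj⟩⟩ :=
          ⟨⟨h0, h1.trans (h.2.2.1 j)⟩, fun l => by simp⟩
        exact ⟨_, (hp _ ⟨c, hc⟩).2 hj, hc⟩
    rw [this, Real.volume_real_Ioc_of_le (h.2.1 j), sub_zero]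
  have hpos : ∀ S, 0 < μ (L S) → (L S).Nonempty := fun S hS => by
    by_contra hc
    rw [Set.not_nonempty_iff_eq_empty] at hc
    simp [μ, hc] at hS
  refine ⟨⟨⟨fun S => μ (L S), fun S => MeasureTheory.measureReal_nonneg, ?_⟩, ?_⟩, fun j => ?_⟩
  · obtain ⟨j, hj⟩ := h.2.2.2
    rw [← hj, ← hsum (fun _ => True) j fun S ⟨c, hc⟩ => ?_]
    · simp
    · exact ⟨fun _ => (hc.2 j).2 (hc.1.2.trans hj.ge), fun _ => trivial⟩
  · intro S hS T hT _
    obtain ⟨c, hc⟩ := hpos S hS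
    obtain ⟨d, hd⟩ := hpos T hT
    rcases le_total c d with hcd | hcd
    · exact Or.inr fun j hj => (hc.2 j).2 (hcd.trans ((hd.2 j).1 hj))
    · exact Or.inl fun j hj => (hd.2 j).2 (hcd.trans ((hc.2 j).1 hj))
  · exact hsum (fun S => j ∈ S.1) j fun S _ => Iff.rfl

lemma continuous_height : Continuous (height : SdSimplex m → Fin (m + 1) → ℝ) := by
  refine continuous_pi fun j => continuous_finsetSum _ fun S _ => ?_
  split_ifs
  · exact (continuous_apply S).comp (continuous_subtype_val.comp continuous_subtype_val)
  · exact continuous_const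

instance : CompactSpace (SdSimplex m) := by
  refine isCompact_iff_compactSpace.1 (IsClosed.isCompact ?_)
  have hc : ∀ S : SdVertex m, Continuous fun w : stdSimplex ℝ (SdVertex m) => w S := fun S =>
    (continuous_apply S).comp continuous_subtype_val
  have : {w : stdSimplex ℝ (SdVertex m) | IsChain (· ≤ ·) {S : SdVertex m | 0 < w S}} =
      ⋂ (S : SdVertex m) (T : SdVertex m) (_ : ¬ (S ≤ T ∨ T ≤ S)), {w | w S ≤ 0} ∪ {w | w T ≤ 0} := by
    ext w
    simp only [Set.mem_iInter]
    constructor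
    · intro hw S T hST
      by_contra hn
      have hn' : ¬ (w S ≤ 0 ∨ w T ≤ 0) := hn
      push Not at hn'
      exact hST (hw.total hn'.1 hn'.2)
    · intro hw S hS T hT _
      by_contra hn
      have hn' : w S ≤ 0 ∨ w T ≤ 0 := hw S T hn
      exact hn'.elim (not_le.2 hS) (not_le.2 hT)
  change IsClosed {w : stdSimplex ℝ (SdVertex m) | IsChain (· ≤ ·) {S : SdVertex m | 0 < w S}}
  rw [this]
  exact isClosed_iInter fun S => isClosed_iInter fun T => isClosed_iInter fun _ =>
    (isClosed_le (hc S) continuous_const).union (isClosed_le (hc T) continuous_const)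

/-- An element of the smallest set of the supporting chain belongs to all of its sets. -/
lemma exists_height_eq_one (w : SdSimplex m) : ∃ j, height w j = 1 := by
  by_contra hc
  push Not at hc
  classical
  obtain ⟨S, hS⟩ := Finset.exists_minimal (s := Finset.univ.filter fun S => 0 < w.1 S)
    (by simpa [Finset.filter_nonempty_iff] using exists_weight_pos w)
  have hS0 := (Finset.mem_filter.1 hS.1).2
  obtain ⟨l, hl⟩ := S.2
  refine hc l (le_antisymm (height_le_one w l) ?_)
  rw [← stdSimplex.sum_eq_one w.1]
  refine Finset.sum_le_sum fun T _ => ?_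
  split_ifs with hT
  · exact le_rfl
  · refine not_lt.1 fun hT0 => hT ?_
    rcases sdSimplex_total w hS0 hT0 with h' | h'
    · exact h' hl
    · exact hS.2 (Finset.mem_filter.2 ⟨Finset.mem_univ T, hT0⟩) h' hl

/-- `|sd Δᵐ|` in cubical coordinates. -/
def sdHomeo (m : ℕ) : SdSimplex m ≃ₜ CubeFace m :=
  Continuous.homeoOfEquivCompactToT2
    (f := Equiv.ofBijective (fun w : SdSimplex m => (⟨height w, height_nonneg w, height_le_one w,
      exists_height_eq_one w⟩ : CubeFace m))
      ⟨fun _ _ h => height_injective (congrArg Subtype.val h), fun h =>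
        (exists_height_eq h).imp fun _ hw => Subtype.ext (funext hw)⟩)
    (continuous_height.subtype_mk _)

lemma sdHomeo_apply (w : SdSimplex m) (j : Fin (m + 1)) : (sdHomeo m w).1 j = height w j := rfl

lemma height_sdHomeo_symm (h : CubeFace m) (j : Fin (m + 1)) :
    height ((sdHomeo m).symm h) j = h.1 j := by
  rw [← sdHomeo_apply, Homeomorph.apply_symm_apply]

/-! ### Faces, strata and neighborhoods in cubical coordinates -/

lemma mem_sdFace_iff (w : SdSimplex m) (F : Finset (Fin (m + 1))) :
    w ∈ sdFace F ↔ ∀ j ∉ F, height w j = 0 := by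
  constructor
  · intro h j hj
    by_contra hc
    obtain ⟨S, hS, hjS⟩ := (height_pos_iff w j).1 (lt_of_le_of_ne (height_nonneg w j) (Ne.symm hc))
    exact hj (h S hS hjS)
  · intro h S hS j hj
    by_contra hc
    exact ((height_pos_iff w j).2 ⟨S, hS, hj⟩).ne' (h j hc)

lemma mem_sdBoundary_iff (w : SdSimplex m) : w ∈ sdBoundary m ↔ ∃ j, height w j = 0 := by
  constructor
  · intro h
    by_contra hc
    push Not at hc
    obtain ⟨j, -, hj⟩ := exists_mem_forall_subset w ⟨Finset.univ, Finset.univ_nonempty⟩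
    obtain ⟨S, hS, hjS⟩ :=
      (height_pos_iff w j).1 (lt_of_le_of_ne (height_nonneg w j) (hc j).symm)
    exact h S hS (Finset.univ_subset_iff.1 (hj S hS hjS))
  · rintro ⟨j, hj⟩ S hS hSu
    exact ((height_pos_iff w j).2 ⟨S, hS, hSu ▸ Finset.mem_univ j⟩).ne' hj

/-- The last vertex of the carrier of a point of `|sd Δᵐ|`. -/
def sdMaxIndex (w : SdSimplex m) : Fin (m + 1) := maxIndex (stdSimplex.map lastVertex w.1)

lemma map_lastVertex_pos_iff (w : SdSimplex m) (j : Fin (m + 1)) :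
    0 < stdSimplex.map lastVertex w.1 j ↔ ∃ S : SdVertex m, 0 < w.1 S ∧ lastVertex S = j := by
  rw [stdSimplex.map_coe, FunOnFinite.linearMap_apply_apply,
    Finset.sum_pos_iff_of_nonneg fun S _ => stdSimplex.zero_le _ _]
  simp only [Finset.mem_filter, Finset.mem_univ, true_and]
  exact ⟨fun ⟨S, h1, h2⟩ => ⟨S, h2, h1⟩, fun ⟨S, h1, h2⟩ => ⟨S, h2, h1⟩⟩

lemma height_sdMaxIndex_pos (w : SdSimplex m) : 0 < height w (sdMaxIndex w) := by
  obtain ⟨S, hS, e⟩ := (map_lastVertex_pos_iff w _).1 (maxIndex_pos (stdSimplex.map lastVertex w.1))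
  refine (height_pos_iff w _).2 ⟨S, hS, ?_⟩
  rw [sdMaxIndex, ← e]
  exact Finset.max'_mem _ _

lemma le_sdMaxIndex {w : SdSimplex m} {j : Fin (m + 1)} (h : 0 < height w j) :
    j ≤ sdMaxIndex w := by
  obtain ⟨S, hS, hj⟩ := (height_pos_iff w j).1 h
  exact (Finset.le_max' _ _ hj).trans (le_maxIndex ((map_lastVertex_pos_iff w _).2 ⟨S, hS, rfl⟩))

variable {P : Type*} [PartialOrder P]

/-- Comparison of heights reflects the supporting chain. The smallest chain member containing `j`
supplies a vertex labelled `p`, which then lies in all members containing `j`. Conversely, if a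
member `S` contains `j` but misses `l`, every member containing `l` contains `S`, so `j` is strictly
higher than `l`. -/
lemma mem_sdNbhd_iff (J : Fin (m + 1) →o P) (p : P) (w : SdSimplex m) :
    w ∈ sdNbhd J p ↔ ∀ j, 0 < height w j → ¬ J j < p → ∃ l, J l = p ∧ height w j ≤ height w l := by
  classical
  constructor
  · intro h j hj hp
    obtain ⟨S, hS⟩ := Finset.exists_minimal
      (s := Finset.univ.filter fun S : SdVertex m => 0 < w.1 S ∧ j ∈ S.1)
      (by simpa [Finset.filter_nonempty_iff] using (height_pos_iff w j).1 hj)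
    obtain ⟨-, hS0, hjS⟩ := Finset.mem_filter.1 hS.1
    obtain ⟨l, hl, hlp⟩ := (h S hS0).resolve_right fun h' => hp (h' j hjS)
    refine ⟨l, hlp, height_mono w fun T hT hjT => ?_⟩
    rcases sdSimplex_total w hS0 hT with h' | h'
    · exact h' hl
    · exact hS.2 (Finset.mem_filter.2 ⟨Finset.mem_univ T, hT, hjT⟩) h' hl
  · intro h S hS
    by_contra hc
    push Not at hc
    obtain ⟨hc1, j, hj, hjp⟩ := hc
    obtain ⟨l, hl, hle⟩ := h j ((height_pos_iff w j).2 ⟨S, hS, hj⟩) hjp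
    have hlS : l ∉ S.1 := fun h' => hc1 l h' hl
    refine hle.not_gt ?_
    refine Finset.sum_lt_sum (fun T _ => ?_) ⟨S, Finset.mem_univ S, by rwa [if_neg hlS, if_pos hj]⟩
    split_ifs with h1 h2 h2
    · exact le_rfl
    · refine not_lt.1 fun hT => ?_
      rcases sdSimplex_total w hS hT with h' | h'
      · exact h2 (h' hj)
      · exact hlS (h' h1)
    · exact stdSimplex.zero_le _ _
    · exact le_rfl

lemma isClosed_sdNbhd (J : Fin (m + 1) →o P) (p : P) : IsClosed (sdNbhd J p) := by
  have : sdNbhd J p = ⋂ (S : SdVertex m) (_ : ¬ ((∃ j ∈ S.1, J j = p) ∨ ∀ j ∈ S.1, J j < p)),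
      {w | w.1 S ≤ 0} := by
    ext w
    simp only [Set.mem_iInter]
    exact ⟨fun h S hS => not_lt.1 fun h' => hS (h S h'), fun h S hS => by
      by_contra hc
      exact (show ¬ w.1 S ≤ 0 from not_le.2 hS) (h S hc)⟩
  rw [this]
  exact isClosed_iInter fun S => isClosed_iInter fun _ => isClosed_le
    ((continuous_apply S).comp (continuous_subtype_val.comp continuous_subtype_val))
    continuous_const

end Height

/-! ### The standard aspire on the neighborhood of a flag in a subdivided simplex -/

section StandardAspire

variable {P : Type*} [PartialOrder P] {n m : ℕ}

/-- The map `x ↦ max 0 ((x - c) / (1 - c))`. -/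
def shrink (c x : ℝ) : ℝ := max 0 ((x - c) / (1 - c))

lemma shrink_nonneg (c x : ℝ) : 0 ≤ shrink c x := le_max_left _ _

lemma shrink_zero {x : ℝ} (h : 0 ≤ x) : shrink 0 x = x := by simp [shrink, h]

lemma shrink_one {c : ℝ} (hc : c ≤ 1 / 2) : shrink c 1 = 1 := by
  rw [shrink, div_self (by linarith), max_eq_right zero_le_one]

lemma shrink_mono {c : ℝ} (hc : c ≤ 1 / 2) {x y : ℝ} (h : x ≤ y) : shrink c x ≤ shrink c y :=
  max_le_max_left _ (div_le_div_of_nonneg_right (by linarith) (by linarith))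

lemma shrink_pos {c : ℝ} (hc : c ≤ 1 / 2) {x : ℝ} (h : c < x) : 0 < shrink c x :=
  lt_max_of_lt_right (div_pos (by linarith) (by linarith))

lemma shrink_eq_zero {c : ℝ} (hc : c ≤ 1 / 2) {x : ℝ} (h : x ≤ c) : shrink c x = 0 :=
  max_eq_left (div_nonpos_of_nonpos_of_nonneg (by linarith) (by linarith))

open Classical in
/-- The maximal height of the vertices of label `p`. -/
def topHeight (J : Fin (m + 1) →o P) (p : P) (w : SdSimplex m) : ℝ :=
  Finset.univ.sup' Finset.univ_nonempty fun j => if J j = p then height w j else 0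

/-- The minimal height of all vertices. -/
def minHeight (w : SdSimplex m) : ℝ := Finset.univ.inf' Finset.univ_nonempty (height w)

open Classical in
/-- The mass of `u` at the vertices of `I` above `q`. -/
def upperMass (I : Fin (n + 1) ↪o P) (u : Simplex n) (q : P) : ℝ :=
  ∑ l, if q ≤ I l then u l else 0

variable (J : Fin (m + 1) →o P) (I : Fin (n + 1) ↪o P)

lemma continuous_height_apply (j : Fin (m + 1)) : Continuous fun w : SdSimplex m => height w j :=
  (continuous_apply j).comp continuous_height

lemma continuous_topHeight (p : P) : Continuous (topHeight J p) := by
  refine Continuous.finset_sup'_apply _ fun j _ => ?_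
  split_ifs
  · exact continuous_height_apply j
  · exact continuous_const

lemma continuous_minHeight : Continuous (minHeight : SdSimplex m → ℝ) :=
  Continuous.finset_inf'_apply _ fun j _ => continuous_height_apply j

lemma continuous_upperMass (q : P) : Continuous fun u : Simplex n => upperMass I u q := by
  refine continuous_finsetSum _ fun l _ => ?_
  split_ifs
  · exact continuous_coord l
  · exact continuous_const

variable {J I}

lemma topHeight_nonneg (p : P) (w : SdSimplex m) : 0 ≤ topHeight J p w := by
  refine le_trans ?_ (Finset.le_sup' _ (Finset.mem_univ 0))
  split_ifs
  exacts [height_nonneg w _, le_rfl]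

lemma topHeight_le_one (p : P) (w : SdSimplex m) : topHeight J p w ≤ 1 := by
  refine Finset.sup'_le _ _ fun j _ => ?_
  split_ifs
  exacts [height_le_one w _, zero_le_one]

lemma height_le_topHeight {p : P} (w : SdSimplex m) {j : Fin (m + 1)} (h : J j = p) :
    height w j ≤ topHeight J p w := by
  classical
  have := Finset.le_sup' (fun j => if J j = p then height w j else 0) (Finset.mem_univ j)
  rwa [if_pos h] at this

lemma exists_height_eq_topHeight {p : P} {w : SdSimplex m} (h : 0 < topHeight J p w) :
    ∃ j, J j = p ∧ height w j = topHeight J p w := by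
  classical
  obtain ⟨j, -, hj⟩ := Finset.exists_mem_eq_sup' (Finset.univ_nonempty (α := Fin (m + 1)))
    fun j => if J j = p then height w j else 0
  change topHeight J p w = _ at hj
  rw [hj] at h
  split_ifs at h hj with hp
  · exact ⟨j, hp, hj.symm⟩
  · exact absurd h (lt_irrefl _)

lemma minHeight_le (w : SdSimplex m) (j : Fin (m + 1)) : minHeight w ≤ height w j :=
  Finset.inf'_le _ (Finset.mem_univ j)

lemma exists_height_eq_minHeight (w : SdSimplex m) : ∃ j, height w j = minHeight w := by
  obtain ⟨j, -, hj⟩ := Finset.exists_mem_eq_inf' (Finset.univ_nonempty (α := Fin (m + 1)))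
    (height w)
  exact ⟨j, hj.symm⟩

lemma upperMass_nonneg (u : Simplex n) (q : P) : 0 ≤ upperMass I u q :=
  Finset.sum_nonneg fun l _ => by
    split_ifs
    exacts [stdSimplex.zero_le _ _, le_rfl]

lemma upperMass_antitone (u : Simplex n) {p q : P} (h : p ≤ q) :
    upperMass I u q ≤ upperMass I u p := by
  refine Finset.sum_le_sum fun l _ => ?_
  split_ifs with h1 h2 h2
  exacts [le_rfl, absurd (h.trans h1) h2, stdSimplex.zero_le _ _, le_rfl]

lemma upperMass_eq_one {u : Simplex n} {q : P} (h : ∀ l, ¬ q ≤ I l → u l = 0) :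
    upperMass I u q = 1 := by
  rw [← stdSimplex.sum_eq_one u]
  refine Finset.sum_congr rfl fun l _ => ?_
  split_ifs with hl
  exacts [rfl, (h l hl).symm]

lemma upperMass_le_one (u : Simplex n) (q : P) : upperMass I u q ≤ 1 := by
  rw [← stdSimplex.sum_eq_one u]
  refine Finset.sum_le_sum fun l _ => ?_
  split_ifs
  exacts [le_rfl, stdSimplex.zero_le _ _]

lemma le_upperMass (u : Simplex n) {q : P} {l : Fin (n + 1)} (h : q ≤ I l) :
    u l ≤ upperMass I u q := by
  classical
  have := Finset.single_le_sum (f := fun l => if q ≤ I l then u l else 0) (fun l _ => by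
    split_ifs
    exacts [stdSimplex.zero_le _ _, le_rfl]) (Finset.mem_univ l)
  rw [if_pos h] at this
  exact this

lemma exists_of_upperMass_pos {u : Simplex n} {q : P} (h : 0 < upperMass I u q) :
    ∃ l, 0 < u l ∧ q ≤ I l := by
  by_contra hc
  push Not at hc
  refine h.ne' (Finset.sum_eq_zero fun l _ => ?_)
  split_ifs with hl
  · exact le_antisymm (not_lt.1 fun h' => hc l h' hl) (stdSimplex.zero_le _ _)
  · rfl

variable (J I)

/-- The neighborhood of the flag `I` in `|sd Δ^J|`. -/
def sdFlagNbhd : Set (SdSimplex m) := ⋂ k, sdNbhd J (I k)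

lemma isClosed_sdFlagNbhd : IsClosed (sdFlagNbhd J I) :=
  isClosed_iInter fun _ => isClosed_sdNbhd _ _

/-- The amount by which the standard aspire lowers the heights. -/
def drop (w : SdSimplex m) (u : Simplex n) : ℝ :=
  -- The first factor makes the drop vanish at the last vertex of `|Δ^I|`. The second makes it
  -- vanish at points of strata at most p_k with k < n. The division by 2 keeps it below the top
  -- height of label p_n and at most 1/2.
  (1 - u (Fin.last n)) * topHeight J (I (Fin.last n)) w / 2

lemma drop_nonneg (w : SdSimplex m) (u : Simplex n) : 0 ≤ drop J I w u :=
  div_nonneg (mul_nonneg (sub_nonneg.2 (stdSimplex.le_one _ _)) (topHeight_nonneg _ _)) zero_le_two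

lemma drop_le (w : SdSimplex m) (u : Simplex n) :
    drop J I w u ≤ topHeight J (I (Fin.last n)) w / 2 :=
  div_le_div_of_nonneg_right (mul_le_of_le_one_left (topHeight_nonneg _ _)
    (sub_le_self _ (stdSimplex.zero_le _ _))) zero_le_two

lemma drop_le_half (w : SdSimplex m) (u : Simplex n) : drop J I w u ≤ 1 / 2 :=
  (drop_le J I w u).trans (div_le_div_of_nonneg_right (topHeight_le_one _ _) zero_le_two)

/-- The heights of the image of a point under the standard aspire. -/
def retractHeight (w : SdSimplex m) (u : Simplex n) (j : Fin (m + 1)) : ℝ :=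
  -- The same monotone function is applied to all heights and `upperMass` decreases with the label,
  -- so domination by a lower label survives. A label below no vertex of I in the support of `u`
  -- gets height 0.
  shrink (drop J I w u) (height w j) * upperMass I u (J j)

lemma retractHeight_nonneg (w : SdSimplex m) (u : Simplex n) (j : Fin (m + 1)) :
    0 ≤ retractHeight J I w u j := mul_nonneg (shrink_nonneg _ _) (upperMass_nonneg _ _)

lemma continuous_retractHeight (j : Fin (m + 1)) :
    Continuous fun z : SdSimplex m × Simplex n => retractHeight J I z.1 z.2 j := by
  have hd : Continuous fun z : SdSimplex m × Simplex n => drop J I z.1 z.2 :=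
    ((continuous_const.sub ((continuous_coord _).comp continuous_snd)).mul
      ((continuous_topHeight J _).comp continuous_fst)).div_const _
  refine Continuous.mul (continuous_const.max (Continuous.div
    (((continuous_height_apply j).comp continuous_fst).sub hd) (continuous_const.sub hd)
    fun z => ?_)) ((continuous_upperMass I _).comp continuous_snd)
  have := drop_le_half J I z.1 z.2
  linarith

variable {J I}

lemma height_pos_of_retractHeight_pos {w : SdSimplex m} {u : Simplex n} {j : Fin (m + 1)}
    (h : 0 < retractHeight J I w u j) : 0 < height w j := by
  by_contra hc
  rw [retractHeight, shrink_eq_zero (drop_le_half J I w u)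
    ((not_lt.1 hc).trans (drop_nonneg J I w u)), zero_mul] at h
  exact lt_irrefl _ h

lemma retractHeight_le_one (w : SdSimplex m) (u : Simplex n) (j : Fin (m + 1)) :
    retractHeight J I w u j ≤ 1 :=
  mul_le_one₀ ((shrink_mono (drop_le_half J I w u) (height_le_one w j)).trans_eq
    (shrink_one (drop_le_half J I w u))) (upperMass_nonneg _ _) (upperMass_le_one _ _)

/-- In the neighborhood of p_0 the height 1 is attained at a label at most p_0. There `upperMass` is
1, and shrinking fixes the value 1. -/
lemma exists_retractHeight_eq_one {w : SdSimplex m} (hw : w ∈ sdFlagNbhd J I) (u : Simplex n) :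
    ∃ j, retractHeight J I w u j = 1 := by
  have key : ∃ j, J j ≤ I 0 ∧ height w j = 1 := by
    obtain ⟨j, hj⟩ := exists_height_eq_one w
    by_cases h : J j < I 0
    · exact ⟨j, h.le, hj⟩
    · obtain ⟨l, hl, hle⟩ := (mem_sdNbhd_iff J _ w).1 (Set.mem_iInter.1 hw 0) j
        (hj ▸ zero_lt_one) h
      exact ⟨l, hl.le, le_antisymm (height_le_one w l) (hj ▸ hle)⟩
  obtain ⟨j, hj, h1⟩ := key
  refine ⟨j, ?_⟩
  rw [retractHeight, h1, shrink_one (drop_le_half J I w u), upperMass_eq_one, one_mul]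
  exact fun l hl => absurd (hj.trans (I.monotone (Fin.zero_le l))) hl

/-- The standard aspire, as a map on the whole neighborhood of the flag. -/
def sdRetract (w : sdFlagNbhd J I) (u : Simplex n) : SdSimplex m :=
  (sdHomeo m).symm ⟨retractHeight J I w.1 u, retractHeight_nonneg J I w.1 u,
    retractHeight_le_one w.1 u, exists_retractHeight_eq_one w.2 u⟩

lemma height_sdRetract (w : sdFlagNbhd J I) (u : Simplex n) (j : Fin (m + 1)) :
    height (sdRetract w u) j = retractHeight J I w.1 u j := height_sdHomeo_symm _ _

lemma continuous_sdRetract :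
    Continuous fun z : sdFlagNbhd J I × Simplex n => sdRetract z.1 z.2 :=
  (sdHomeo m).symm.continuous.comp (Continuous.subtype_mk (continuous_pi fun j =>
    (continuous_retractHeight J I j).comp
      ((continuous_subtype_val.comp continuous_fst).prodMk continuous_snd)) _)

lemma flag_le_of_not_lt {j l : Fin (m + 1)} (h : ¬ J j < J l) : J l ≤ J j := by
  rcases le_total l j with h' | h'
  · exact J.monotone h'
  · exact ((J.monotone h').eq_or_lt.resolve_right h).ge

lemma sdRetract_mem (w : sdFlagNbhd J I) (u : Simplex n) : sdRetract w u ∈ sdFlagNbhd J I := by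
  refine Set.mem_iInter.2 fun k => (mem_sdNbhd_iff J _ _).2 fun j hj hk => ?_
  rw [height_sdRetract] at hj
  obtain ⟨l, hl, hle⟩ := (mem_sdNbhd_iff J _ w.1).1 (Set.mem_iInter.1 w.2 k) j
    (height_pos_of_retractHeight_pos hj) hk
  refine ⟨l, hl, ?_⟩
  rw [height_sdRetract, height_sdRetract]
  exact mul_le_mul (shrink_mono (drop_le_half J I w.1 u) hle)
    (upperMass_antitone u (flag_le_of_not_lt (hl.symm ▸ hk))) (upperMass_nonneg _ _)
    (shrink_nonneg _ _)

lemma le_sdStrat {w : SdSimplex m} {j : Fin (m + 1)} (h : 0 < height w j) :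
    J j ≤ sdStrat J w := J.monotone (le_sdMaxIndex h)

/-- Since this holds for all points of the lower strata, `sdRetract` is itself the continuous
extension required of an aspire, for every `k`. -/
lemma sdRetract_eq_self {w : sdFlagNbhd J I} {k : Fin (n + 1)} (hw : sdStrat J w.1 ≤ I k)
    {u : Simplex n} (hu : ∀ j < k, u j = 0) : sdRetract w u = w.1 := by
  have hd : drop J I w.1 u = 0 := by
    rcases eq_or_ne k (Fin.last n) with rfl | hk
    · rw [drop, eq_vertex_last hu, vertex_last_apply, if_pos rfl]
      ring
    · have : topHeight J (I (Fin.last n)) w.1 = 0 := by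
        refine le_antisymm (not_lt.1 fun h => ?_) (topHeight_nonneg _ _)
        obtain ⟨j, hj, e⟩ := exists_height_eq_topHeight h
        have h1 := (le_sdStrat (J := J) (e ▸ h : 0 < height w.1 j)).trans hw
        rw [hj, I.le_iff_le] at h1
        exact hk (le_antisymm (Fin.le_last k) h1)
      rw [drop, this]
      ring
  refine height_injective (funext fun j => ?_)
  rw [height_sdRetract, retractHeight, hd, shrink_zero (height_nonneg _ _)]
  rcases (height_nonneg w.1 j).eq_or_lt with h | h
  · rw [← h, zero_mul]
  · rw [upperMass_eq_one, mul_one]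
    intro l hl
    refine hu l (lt_of_not_ge fun hkl => hl ?_)
    exact ((le_sdStrat h).trans hw).trans (I.monotone hkl)

lemma topHeight_last_pos {w : SdSimplex m} (hs : sdStrat J w = I (Fin.last n)) :
    0 < topHeight J (I (Fin.last n)) w :=
  (height_sdMaxIndex_pos w).trans_le (height_le_topHeight w hs)

/-- No label outside the reach of the support of `u` survives, which bounds the stratum above. The
label of the highest vertex of `u` does survive: a vertex carrying it dominates the top p_n-vertex,
whose height exceeds the drop. -/
lemma sdStrat_sdRetract {w : sdFlagNbhd J I} (hs : sdStrat J w.1 = I (Fin.last n))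
    (u : Simplex n) : sdStrat J (sdRetract w u) = simplexStrat I.toOrderHom u := by
  change J (sdMaxIndex _) = I (maxIndex u)
  have hH := topHeight_last_pos hs
  obtain ⟨j, hj, hjH⟩ := exists_height_eq_topHeight hH
  refine le_antisymm ?_ ?_
  · have h := height_sdMaxIndex_pos (sdRetract w u)
    rw [height_sdRetract] at h
    obtain ⟨l, hl, hle⟩ := exists_of_upperMass_pos (pos_of_mul_pos_right h (shrink_nonneg _ _))
    exact hle.trans (I.monotone (le_maxIndex hl))
  · obtain ⟨l, hl, hle⟩ := (mem_sdNbhd_iff J _ w.1).1 (Set.mem_iInter.1 w.2 (maxIndex u)) j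
      (hjH ▸ hH) (by rw [hj]; exact (I.monotone (Fin.le_last _)).not_gt)
    refine hl.symm.trans_le (le_sdStrat ?_)
    rw [height_sdRetract]
    refine mul_pos (shrink_pos (drop_le_half J I w.1 u) ?_)
      ((maxIndex_pos u).trans_le (le_upperMass u hl.le))
    have := drop_le J I w.1 u
    linarith

/-- The function which controls the gluing of the standard aspire. -/
def sdLevel (w : SdSimplex m) : ℝ :=
  -- With H the top height of label p_n, this is the solution t of (1 - t) H / 2 = `minHeight w`,
  -- truncated at 0.
  max 0 (1 - 2 * (minHeight w / topHeight J (I (Fin.last n)) w))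

lemma minHeight_nonneg (w : SdSimplex m) : 0 ≤ minHeight w := by
  obtain ⟨j, hj⟩ := exists_height_eq_minHeight w
  exact hj ▸ height_nonneg w j

variable (J I) in
/-- The standard aspire on the neighborhood of a flag in `|sd Δ^J|`. -/
theorem exists_standardAspire :
    ∃ (ψ : C(Stratum ((sdStrat J).restrict (sdFlagNbhd J I)) (I (Fin.last n)), unitInterval))
      (R : Stratum ((sdStrat J).restrict (sdFlagNbhd J I)) (I (Fin.last n)) → Simplex n →
        sdFlagNbhd J I),
      IsAspire ((sdStrat J).restrict (sdFlagNbhd J I)) I R ∧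
      (∀ b, b.1.1 ∈ sdBoundary m → ψ b = 1) ∧
      ∀ b u, u (Fin.last n) = (ψ b : ℝ) → (R b u).1 ∈ sdBoundary m := by
  have hpos : ∀ b : Stratum ((sdStrat J).restrict (sdFlagNbhd J I)) (I (Fin.last n)),
      0 < topHeight J (I (Fin.last n)) b.1.1 := fun b => topHeight_last_pos b.2
  have hval : Continuous fun b : Stratum ((sdStrat J).restrict (sdFlagNbhd J I))
      (I (Fin.last n)) => b.1.1 := continuous_subtype_val.comp continuous_subtype_val
  let ψ : C(Stratum ((sdStrat J).restrict (sdFlagNbhd J I)) (I (Fin.last n)), unitInterval) :=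
    ⟨fun b => ⟨sdLevel (J := J) (I := I) b.1.1, le_max_left _ _, max_le zero_le_one
      (sub_le_self _ (mul_nonneg zero_le_two (div_nonneg (minHeight_nonneg _) (hpos b).le)))⟩,
      Continuous.subtype_mk (continuous_const.max (continuous_const.sub (continuous_const.mul
        ((continuous_minHeight.comp hval).div ((continuous_topHeight J _).comp hval)
          fun b => (hpos b).ne')))) _⟩
  refine ⟨ψ, fun b u => ⟨sdRetract b.1 u, sdRetract_mem b.1 u⟩, ⟨?_, ?_, ?_⟩, ?_, ?_⟩
  · exact Continuous.subtype_mk (continuous_sdRetract.comp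
      ((continuous_subtype_val.comp continuous_fst).prodMk continuous_snd)) _
  · exact fun b u => sdStrat_sdRetract b.2 u
  · refine fun k => ⟨fun z => ⟨sdRetract z.1.1 z.2.1, sdRetract_mem z.1.1 z.2.1⟩, ?_,
      fun z h => rfl, fun z h => Subtype.ext (sdRetract_eq_self h z.2.2)⟩
    exact Continuous.subtype_mk (continuous_sdRetract.comp
      ((continuous_subtype_val.comp continuous_fst).prodMk
        (continuous_subtype_val.comp continuous_snd))) _
  · intro b hb
    obtain ⟨j, hj⟩ := (mem_sdBoundary_iff _).1 hb
    have h0 : minHeight b.1.1 = 0 := le_antisymm ((minHeight_le _ j).trans_eq hj) (minHeight_nonneg _)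
    refine Subtype.ext ?_
    change max 0 (1 - 2 * (minHeight b.1.1 / _)) = 1
    rw [h0]
    simp
  · intro b u hu
    have hu' : u (Fin.last n) = max 0 (1 - 2 * (minHeight b.1.1 /
      topHeight J (I (Fin.last n)) b.1.1)) := hu
    refine (mem_sdBoundary_iff _).2 ?_
    simp only [height_sdRetract]
    rcases le_total (1 - 2 * (minHeight b.1.1 / topHeight J (I (Fin.last n)) b.1.1)) 0
      with h | h
    -- Truncated case: `u` has no mass at p_n, so the vertices labelled p_n lose all their height.
    · rw [max_eq_left h] at hu'
      obtain ⟨j, hj, -⟩ := exists_height_eq_topHeight (hpos b)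
      refine ⟨j, ?_⟩
      rw [retractHeight, hj, upperMass, Finset.sum_eq_zero, mul_zero]
      intro l _
      split_ifs with hl
      · rw [I.le_iff_le] at hl
        rwa [le_antisymm (Fin.le_last l) hl]
      · rfl
    -- Otherwise the drop equals the minimal height, so a lowest vertex is brought to height 0.
    · rw [max_eq_right h] at hu'
      obtain ⟨j, hj⟩ := exists_height_eq_minHeight b.1.1
      refine ⟨j, ?_⟩
      rw [retractHeight, shrink_eq_zero (drop_le_half J I _ u), zero_mul]
      rw [hj, drop, hu']
      have := (hpos b).ne'
      field_simp
      ring_nf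
      rfl

end StandardAspire

/-! ### Mod 2 chains on lists -/

section Chains

variable {α : Type*}

/-- Mod 2 chains with ordered simplices given by lists. -/
abbrev ListChain (α : Type*) : Type _ := List α →₀ ZMod 2

/-- The cone over a chain. -/
def cone (b : α) : ListChain α →ₗ[ZMod 2] ListChain α :=
  Finsupp.lmapDomain (ZMod 2) (ZMod 2) (List.cons b)

/-- The augmented boundary of a simplex. -/
def listBoundary : List α → ListChain α
  | [] => 0
  | b :: l => Finsupp.single l 1 + cone b (listBoundary l)

/-- The augmented boundary of a chain. -/
def boundary : ListChain α →ₗ[ZMod 2] ListChain α := Finsupp.linearCombination (ZMod 2) listBoundary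

lemma cone_single (b : α) (l : List α) :
    cone b (Finsupp.single l (1 : ZMod 2)) = Finsupp.single (b :: l) 1 :=
  Finsupp.mapDomain_single

lemma linearCombination_single_one {M : Type*} [AddCommGroup M] [Module (ZMod 2) M]
    (F : List α → M) (l : List α) :
    Finsupp.linearCombination (ZMod 2) F (Finsupp.single l 1) = F l := by
  rw [Finsupp.linearCombination_single, one_smul]

lemma boundary_single (l : List α) : boundary (Finsupp.single l 1) = listBoundary l :=
  linearCombination_single_one _ _

lemma chain_add_self {M : Type*} [AddCommGroup M] [Module (ZMod 2) M] (c : M) : c + c = 0 := by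
  rw [← two_smul (ZMod 2) c, show (2 : ZMod 2) = 0 from rfl, zero_smul]

lemma boundary_cone (b : α) (c : ListChain α) : boundary (cone b c) = c + cone b (boundary c) := by
  have : boundary ∘ₗ cone b = LinearMap.id + cone b ∘ₗ boundary := by
    refine Finsupp.lhom_ext' fun l => LinearMap.ext_ring ?_
    simp only [LinearMap.comp_apply, LinearMap.add_apply, LinearMap.id_apply,
      Finsupp.lsingle_apply]
    rw [cone_single, boundary_single, boundary_single]
    rfl
  exact LinearMap.congr_fun this c

lemma boundary_listBoundary (l : List α) : boundary (listBoundary l) = 0 := by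
  induction l with
  | nil => exact map_zero _
  | cons b l ih =>
    rw [listBoundary, map_add, boundary_single, boundary_cone, ih, map_zero, add_zero,
      chain_add_self]

lemma mem_of_supported {M : Type*} [AddCommGroup M] [Module (ZMod 2) M] {s : Set (List α)}
    (T : ListChain α →ₗ[ZMod 2] M) (p : Submodule (ZMod 2) M)
    (h : ∀ l ∈ s, T (Finsupp.single l 1) ∈ p) {c : ListChain α}
    (hc : c ∈ Finsupp.supported (ZMod 2) (ZMod 2) s) : T c ∈ p := by
  rw [Finsupp.supported_eq_span_single] at hc
  have : Submodule.span (ZMod 2) ((fun l => Finsupp.single l (1 : ZMod 2)) '' s) ≤ p.comap T :=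
    Submodule.span_le.2 (by rintro _ ⟨l, hl, rfl⟩; exact h l hl)
  exact this hc

lemma eq_of_supported {M : Type*} [AddCommGroup M] [Module (ZMod 2) M] {s : Set (List α)}
    {T T' : ListChain α →ₗ[ZMod 2] M}
    (h : ∀ l ∈ s, T (Finsupp.single l 1) = T' (Finsupp.single l 1)) {c : ListChain α}
    (hc : c ∈ Finsupp.supported (ZMod 2) (ZMod 2) s) : T c = T' c := by
  have := mem_of_supported (T - T') ⊥ (fun l hl => by
    rw [Submodule.mem_bot, LinearMap.sub_apply, h l hl, sub_self]) hc
  rwa [Submodule.mem_bot, LinearMap.sub_apply, sub_eq_zero] at this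

lemma single_mem_supported {s : Set (List α)} {l : List α} (h : l ∈ s) :
    Finsupp.single l (1 : ZMod 2) ∈ Finsupp.supported (ZMod 2) (ZMod 2) s :=
  Finsupp.single_mem_supported _ _ h

lemma cone_mem_supported {s t : Set (List α)} {b : α} (h : ∀ l ∈ s, b :: l ∈ t)
    {c : ListChain α} (hc : c ∈ Finsupp.supported (ZMod 2) (ZMod 2) s) :
    cone b c ∈ Finsupp.supported (ZMod 2) (ZMod 2) t :=
  mem_of_supported (cone b) _ (fun l hl => by
    rw [cone_single]
    exact single_mem_supported (h l hl)) hc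

lemma listBoundary_mem_supported (l : List α) :
    listBoundary l ∈ Finsupp.supported (ZMod 2) (ZMod 2)
      {m | m.Sublist l ∧ m.length + 1 = l.length} := by
  induction l with
  | nil => exact Submodule.zero_mem _
  | cons b l ih =>
    refine Submodule.add_mem _ (single_mem_supported ⟨List.sublist_cons_self b l, rfl⟩)
      (cone_mem_supported (fun m hm => ?_) ih)
    exact ⟨hm.1.cons_cons b, by simp [hm.2]⟩

variable (bar : List α → α)

/-- Subdivision of simplices of dimension `k - 1`, coning off at the points `bar l`. -/
def subdivAux : ℕ → List α → ListChain α
  | 0, _ => Finsupp.single [] 1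
  | k + 1, l => cone (bar l) (Finsupp.linearCombination (ZMod 2) (subdivAux k) (listBoundary l))

/-- Subdivision of chains, coning off at the points `bar l`. -/
def subdiv : ListChain α →ₗ[ZMod 2] ListChain α :=
  Finsupp.linearCombination (ZMod 2) fun l => subdivAux bar l.length l

lemma subdiv_nil : subdiv bar (Finsupp.single [] 1) = Finsupp.single [] 1 :=
  linearCombination_single_one _ _

lemma subdiv_single {l : List α} (hl : l ≠ []) :
    subdiv bar (Finsupp.single l 1) = cone (bar l) (subdiv bar (listBoundary l)) := by
  obtain ⟨k, hk⟩ := Nat.exists_eq_succ_of_ne_zero (mt List.length_eq_zero_iff.1 hl)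
  rw [subdiv, linearCombination_single_one, hk, subdivAux]
  congr 1
  refine eq_of_supported (fun m hm => ?_) (listBoundary_mem_supported l)
  rw [linearCombination_single_one, linearCombination_single_one]
  rw [show m.length = k by have := hm.2; omega]

/-- Induction on the length: the boundary of a cone is its base plus the cone over the boundary of
the base, and the latter vanishes as the base is the subdivision of a cycle. -/
lemma boundary_subdiv_of_length (k : ℕ) : ∀ c ∈ Finsupp.supported (ZMod 2) (ZMod 2)
    {l : List α | l.length = k}, boundary (subdiv bar c) = subdiv bar (boundary c) := by
  induction k with
  | zero =>
    intro c hc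
    refine eq_of_supported (T := boundary ∘ₗ subdiv bar) (T' := subdiv bar ∘ₗ boundary)
      (fun l hl => ?_) hc
    obtain rfl := List.length_eq_zero_iff.1 hl
    rw [LinearMap.comp_apply, LinearMap.comp_apply, subdiv_nil, boundary_single, listBoundary,
      map_zero]
  | succ k ih =>
    intro c hc
    refine eq_of_supported (T := boundary ∘ₗ subdiv bar) (T' := subdiv bar ∘ₗ boundary)
      (fun l hl => ?_) hc
    have hl' : l.length = k + 1 := hl
    have hne : l ≠ [] := by rintro rfl; simp at hl'
    rw [LinearMap.comp_apply, LinearMap.comp_apply, subdiv_single bar hne, boundary_cone,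
      boundary_single, ih _ (Finsupp.supported_mono (fun m hm => ?_) (listBoundary_mem_supported l)),
      boundary_listBoundary, map_zero, map_zero, add_zero]
    have := hm.2
    change m.length = k
    omega

lemma boundary_subdiv (c : ListChain α) : boundary (subdiv bar c) = subdiv bar (boundary c) := by
  have : boundary ∘ₗ subdiv bar = subdiv bar ∘ₗ boundary :=
    Finsupp.lhom_ext' fun l => LinearMap.ext_ring
      (boundary_subdiv_of_length bar l.length _ (single_mem_supported rfl))
  exact LinearMap.congr_fun this c

lemma boundary_subdiv_iterate (N : ℕ) (c : ListChain α) :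
    boundary ((subdiv bar)^[N] c) = (subdiv bar)^[N] (boundary c) := by
  induction N generalizing c with
  | zero => rfl
  | succ N ih => rw [Function.iterate_succ_apply, Function.iterate_succ_apply, ih, boundary_subdiv]

lemma subdiv_iterate_add (N : ℕ) (c d : ListChain α) :
    (subdiv bar)^[N] (c + d) = (subdiv bar)^[N] c + (subdiv bar)^[N] d := by
  induction N generalizing c d with
  | zero => rfl
  | succ N ih => simp only [Function.iterate_succ_apply, map_add, ih]

/-- Subdivision maps chains in a class of simplices to chains in a class of smaller simplices. -/
lemma subdiv_iterate_mem_supported {s : ℕ → Set (List α)}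
    (h : ∀ N, ∀ l ∈ s N, subdiv bar (Finsupp.single l 1) ∈
      Finsupp.supported (ZMod 2) (ZMod 2) (s (N + 1))) (N : ℕ) {c : ListChain α}
    (hc : c ∈ Finsupp.supported (ZMod 2) (ZMod 2) (s 0)) :
    (subdiv bar)^[N] c ∈ Finsupp.supported (ZMod 2) (ZMod 2) (s N) := by
  induction N with
  | zero => exact hc
  | succ N ih =>
    rw [Function.iterate_succ_apply']
    exact mem_of_supported (subdiv bar) _ (h N) ih

end Chains

/-! ### Sperner's lemma -/

section Sperner

variable {α V : Type*} [DecidableEq V] (lab : α → V)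

/-- The cochain which detects the simplices with label set `t`. -/
def labelCochain (t : List V) : ListChain α →ₗ[ZMod 2] ZMod 2 :=
  Finsupp.linearCombination (ZMod 2) fun m => if (m.map lab).Perm t then 1 else 0

lemma labelCochain_single (t : List V) (m : List α) :
    labelCochain lab t (Finsupp.single m 1) = if (m.map lab).Perm t then 1 else 0 :=
  linearCombination_single_one _ _

lemma labelCochain_cone (t : List V) (b : α) (c : ListChain α) :
    labelCochain lab t (cone b c) =
      if lab b ∈ t then labelCochain lab (t.erase (lab b)) c else 0 := by
  have : labelCochain lab t ∘ₗ cone b =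
      if lab b ∈ t then labelCochain lab (t.erase (lab b)) else 0 := by
    refine Finsupp.lhom_ext' fun l => LinearMap.ext_ring ?_
    simp only [LinearMap.comp_apply, Finsupp.lsingle_apply]
    rw [cone_single, labelCochain_single, List.map_cons]
    split_ifs with h1 h2 h2
    · rw [labelCochain_single, if_pos (List.cons_perm_iff_perm_erase.1 h1).2]
    · exact absurd (List.cons_perm_iff_perm_erase.1 h1).1 h2
    · rw [labelCochain_single, if_neg fun h => h1 (List.cons_perm_iff_perm_erase.2 ⟨h2, h⟩)]
    · rfl
  have := LinearMap.congr_fun this c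
  rw [LinearMap.comp_apply] at this
  rw [this]
  split_ifs <;> rfl

open Classical in
-- A simplex labelled by `t` and one extra label outside `t` has exactly one face labelled `t`. If
-- the extra label repeats one in `t`, there are two such faces, which cancel mod 2.
lemma labelCochain_listBoundary (m : List α) : ∀ t : List V, t.Nodup →
    labelCochain lab t (listBoundary m) =
      if ∃ a, a ∉ t ∧ (m.map lab).Perm (a :: t) then 1 else 0 := by
  induction m with
  | nil =>
    intro t _
    rw [listBoundary, map_zero, if_neg]
    rintro ⟨a, -, h⟩
    simpa using h.length_eq
  | cons b m ih =>
    intro t ht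
    rw [listBoundary, map_add, labelCochain_single, labelCochain_cone, List.map_cons]
    by_cases hb : lab b ∈ t
    · have hperm := List.perm_cons_erase hb
      have hnd := hperm.nodup_iff.1 ht
      rw [if_pos hb, ih _ (ht.erase _)]
      have hcons : ∀ a, a ∉ t → ((lab b :: m.map lab).Perm (a :: t) ↔
          (m.map lab).Perm (a :: t.erase (lab b))) := fun a _ => by
        have hsw : (a :: t).Perm (lab b :: a :: t.erase (lab b)) :=
          (hperm.cons a).trans (List.Perm.swap _ _ _)
        exact ⟨fun h => (List.perm_cons _).1 (h.trans hsw),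
          fun h => (h.cons _).trans hsw.symm⟩
      by_cases h1 : (m.map lab).Perm t
      · rw [if_pos h1, if_pos, if_neg, show (1 : ZMod 2) + 1 = 0 from rfl]
        · rintro ⟨a, ha, h⟩
          have h2 := (hcons a ha).1 h
          exact ha ((h2.symm.trans h1).subset List.mem_cons_self)
        · exact ⟨lab b, (List.nodup_cons.1 hnd).1, h1.trans hperm⟩
      · rw [if_neg h1, zero_add]
        refine if_congr ⟨?_, ?_⟩ rfl rfl
        · rintro ⟨a, ha, h⟩
          have hab : a ≠ lab b := fun e => h1 (h.trans (e ▸ hperm.symm))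
          have hat : a ∉ t := fun h' => ha ((List.mem_erase_of_ne hab).2 h')
          exact ⟨a, hat, (hcons a hat).2 h⟩
        · rintro ⟨a, ha, h⟩
          exact ⟨a, fun h' => ha (List.mem_of_mem_erase h'), (hcons a ha).1 h⟩
    · rw [if_neg hb, add_zero]
      refine if_congr ⟨fun h => ⟨lab b, hb, h.cons _⟩, ?_⟩ rfl rfl
      rintro ⟨a, ha, h⟩
      have : lab b ∈ a :: t := h.subset List.mem_cons_self
      obtain rfl := (List.mem_cons.1 this).resolve_right hb
      exact (List.perm_cons _).1 h

/-- With all labels in `v :: t`, the only extra label outside `t` is `v`, so faces labelled `t`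
count the fully labelled simplices mod 2. -/
lemma labelCochain_boundary_eq {v : V} {t : List V} (ht : (v :: t).Nodup) {c : ListChain α}
    (hc : c ∈ Finsupp.supported (ZMod 2) (ZMod 2) {m | ∀ x ∈ m, lab x ∈ v :: t}) :
    labelCochain lab t (boundary c) = labelCochain lab (v :: t) c := by
  classical
  refine eq_of_supported (T := labelCochain lab t ∘ₗ boundary) (fun m hm => ?_) hc
  rw [LinearMap.comp_apply, boundary_single, labelCochain_single,
    labelCochain_listBoundary lab m t (List.nodup_cons.1 ht).2]
  refine if_congr ⟨?_, fun h => ⟨v, (List.nodup_cons.1 ht).1, h⟩⟩ rfl rfl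
  rintro ⟨a, ha, h⟩
  obtain ⟨x, hx, rfl⟩ := List.mem_map.1 (h.symm.subset List.mem_cons_self)
  obtain rfl := (List.mem_cons.1 (hm x hx)).resolve_right ha
  exact h

/-- Sperner's lemma for iterated subdivisions: if the points of the face spanned by a set of
vertices carry labels in that set, then the number of fully labelled simplices is odd. -/
lemma sperner (bar : List α → α) (e : V → α) (K : List V → Set α) (N : ℕ)
    (he : ∀ v t, v ∈ t → e v ∈ K t)
    (hbar : ∀ t l, l ≠ [] → (∀ x ∈ l, x ∈ K t) → bar l ∈ K t)
    (hlab : ∀ t, ∀ x ∈ K t, lab x ∈ t) :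
    ∀ t : List V, t.Nodup →
      labelCochain lab t ((subdiv bar)^[N] (Finsupp.single (t.map e) 1)) = 1 := by
  have hsub : ∀ t : List V, ∀ k (l : List α), l.length = k → (∀ x ∈ l, x ∈ K t) →
      subdiv bar (Finsupp.single l 1) ∈
        Finsupp.supported (ZMod 2) (ZMod 2) {m : List α | ∀ x ∈ m, x ∈ K t} := by
    intro t k
    induction k with
    | zero =>
      intro l hl _
      obtain rfl := List.length_eq_zero_iff.1 hl
      rw [subdiv_nil]
      exact single_mem_supported (by simp)
    | succ k ih =>
      intro l hl hlt
      have hne : l ≠ [] := by rintro rfl; simp at hl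
      rw [subdiv_single bar hne]
      refine cone_mem_supported (s := {m : List α | ∀ x ∈ m, x ∈ K t})
        (t := {m : List α | ∀ x ∈ m, x ∈ K t}) (fun m hm x hx => ?_)
        (mem_of_supported (subdiv bar) _ (fun m hm => ?_) (listBoundary_mem_supported l))
      · rcases List.mem_cons.1 hx with rfl | hx
        exacts [hbar t l hne hlt, hm x hx]
      · refine ih m ?_ fun x hx => hlt x (hm.1.subset hx)
        have := hm.2
        omega
  have hiter : ∀ (t : List V) (c : ListChain α),
      c ∈ Finsupp.supported (ZMod 2) (ZMod 2) {m : List α | ∀ x ∈ m, x ∈ K t} →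
      (subdiv bar)^[N] c ∈
        Finsupp.supported (ZMod 2) (ZMod 2) {m : List α | ∀ x ∈ m, x ∈ K t} := fun t c hc =>
    subdiv_iterate_mem_supported bar (s := fun _ => {m : List α | ∀ x ∈ m, x ∈ K t})
      (fun _ l hl => hsub t l.length l rfl hl) N hc
  intro t
  induction t with
  | nil =>
    intro _
    have : (subdiv bar)^[N] (Finsupp.single ([] : List α) 1) = Finsupp.single [] 1 :=
      Function.iterate_fixed (subdiv_nil bar) N
    rw [List.map_nil, this, labelCochain_single, if_pos (by simp)]
  | cons v t ih =>
    intro ht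
    -- Count instead the simplices labelled `t` in the boundary. The face opposite `v` contributes 1
    -- by induction.
    rw [← labelCochain_boundary_eq lab ht, boundary_subdiv_iterate, boundary_single, List.map_cons,
      listBoundary, subdiv_iterate_add, map_add, ih (List.nodup_cons.1 ht).2]
    · have hc : cone (e v) (listBoundary (t.map e)) ∈ Finsupp.supported (ZMod 2) (ZMod 2)
          {m : List α | ∃ r : List V, r.Sublist t ∧ r.length + 1 = t.length ∧
            m = (v :: r).map e} := by
        refine cone_mem_supported (fun l hl => ?_) (listBoundary_mem_supported _)
        obtain ⟨r, hr, rfl⟩ := List.sublist_map_iff.1 hl.1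
        exact ⟨r, hr, by simpa using hl.2, rfl⟩
      rw [add_eq_left]
      have hz : ∀ l : List α, (∃ r : List V, r.Sublist t ∧ r.length + 1 = t.length ∧
          l = (v :: r).map e) →
          labelCochain lab t ((subdiv bar)^[N] (Finsupp.single l 1)) = 0 := by
        rintro _ ⟨r, hr, hlen, rfl⟩
        -- Each other face contains `v` but omits some `w` of `t`, so the label `w` cannot occur on
        -- it and it contributes 0.
        have hw : ∃ w ∈ t, w ∉ r := by
          by_contra hcon
          push Not at hcon
          have := ((List.nodup_cons.1 ht).2.subperm hcon).length_le
          omega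
        obtain ⟨w, hwt, hwr⟩ := hw
        have := hiter (v :: r) (Finsupp.single ((v :: r).map e) 1)
          (single_mem_supported fun x hx => by
            obtain ⟨y, hy, rfl⟩ := List.mem_map.1 hx
            exact he y _ hy)
        refine eq_of_supported (T' := 0) (fun m hm => ?_) this
        rw [labelCochain_single, LinearMap.zero_apply, if_neg]
        intro hp
        obtain ⟨x, hx, hxw⟩ := List.mem_map.1 (hp.symm.subset hwt)
        rcases List.mem_cons.1 (hxw ▸ hlab _ x (hm x hx)) with rfl | h'
        · exact (List.nodup_cons.1 ht).1 hwt
        · exact hwr h'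
      have hlin : ∀ c, labelCochain lab t ((subdiv bar)^[N] c) =
          (labelCochain lab t ∘ₗ (subdiv bar ^ N : Module.End _ (ListChain α))) c := fun c => by
        rw [LinearMap.comp_apply, Module.End.pow_apply]
      rw [hlin]
      refine eq_of_supported (T' := 0) (fun l hl => ?_) hc
      rw [← hlin, hz l hl, LinearMap.zero_apply]
    · refine Finsupp.supported_mono (s := {m : List α | ∀ x ∈ m, x ∈ K (v :: t)})
        (fun m hm x hx => hlab _ x (hm x hx))
        (hiter (v :: t) _ (single_mem_supported fun x hx => ?_))
      obtain ⟨y, hy, rfl⟩ := List.mem_map.1 hx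
      exact he y _ hy

end Sperner

/-! ### The mesh of iterated barycentric subdivisions -/

section Mesh

variable {E : Type*} [NormedAddCommGroup E] [NormedSpace ℝ E]

/-- The centroid of a list of points. -/
def centroid (l : List E) : E := (l.length : ℝ)⁻¹ • l.sum

lemma centroid_mem {K : Set E} (hK : Convex ℝ K) : ∀ l : List E, l ≠ [] → (∀ x ∈ l, x ∈ K) →
    centroid l ∈ K
  | [], h, _ => absurd rfl h
  | [x], _, h => by simpa [centroid] using h
  | x :: y :: l, _, h => by
    have ih := centroid_mem hK (y :: l) (List.cons_ne_nil _ _)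
      fun z hz => h z (List.mem_cons_of_mem _ hz)
    have hpos : (0 : ℝ) < (y :: l).length := by
      rw [List.length_cons]; positivity
    have key : centroid (x :: y :: l) = (1 / ((y :: l).length + 1 : ℝ)) • x +
        ((y :: l).length / ((y :: l).length + 1 : ℝ)) • centroid (y :: l) := by
      rw [centroid, centroid, smul_smul, List.length_cons (a := x), List.sum_cons (a := x), smul_add]
      push_cast
      congr 2
      · rw [one_div]
      · field_simp
    rw [key]
    refine hK (h x List.mem_cons_self) ih (by positivity) (by positivity) ?_
    field_simp
    ring

lemma norm_sum_sub_le {D : ℝ} (x : E) : ∀ l : List E, (∀ y ∈ l, dist y x ≤ D) →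
    ‖l.sum - (l.length : ℝ) • x‖ ≤ l.length * D
  | [], _ => by simp
  | y :: l, h => by
    have ih := norm_sum_sub_le x l fun z hz => h z (List.mem_cons_of_mem _ hz)
    have hy := h y List.mem_cons_self
    rw [dist_eq_norm] at hy
    have : (y :: l).sum - ((y :: l).length : ℝ) • x = (y - x) + (l.sum - (l.length : ℝ) • x) := by
      rw [List.sum_cons, List.length_cons]
      push_cast
      rw [add_smul, one_smul]
      abel
    rw [this, List.length_cons]
    push_cast
    linarith [norm_add_le (y - x) (l.sum - (l.length : ℝ) • x)]

/-- In the average one of the at most d + 1 differences is zero, which gives the contraction factor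
d / (d + 1). -/
lemma dist_centroid_le {D : ℝ} (hD : 0 ≤ D) {d : ℕ} {l : List E} (hl : l.length ≤ d + 1)
    (h : ∀ x ∈ l, ∀ y ∈ l, dist x y ≤ D) {x : E} (hx : x ∈ l) :
    dist (centroid l) x ≤ d / (d + 1) * D := by
  classical
  have hp := List.perm_cons_erase hx
  set r := l.erase x
  have hlen : (l.length : ℝ) = r.length + 1 := by
    rw [hp.length_eq, List.length_cons]; push_cast; ring
  have hr := norm_sum_sub_le x r fun y hy => h y (hp.symm.subset (List.mem_cons_of_mem _ hy)) x hx
  have key : centroid l - x = (l.length : ℝ)⁻¹ • (r.sum - (r.length : ℝ) • x) := by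
    have h0 : (r.length : ℝ) + 1 ≠ 0 := by positivity
    rw [centroid, hp.sum_eq, List.sum_cons, hlen, eq_inv_smul_iff₀ h0, smul_sub,
      smul_inv_smul₀ h0, add_smul, one_smul]
    abel
  rw [dist_eq_norm, key, norm_smul, norm_inv, hlen, Real.norm_of_nonneg (by positivity)]
  have hle : (r.length : ℝ) ≤ d := by
    have : (l.length : ℝ) ≤ d + 1 := by exact_mod_cast hl
    linarith
  calc ((r.length : ℝ) + 1)⁻¹ * ‖r.sum - (r.length : ℝ) • x‖
      ≤ ((r.length : ℝ) + 1)⁻¹ * (r.length * D) := by gcongr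
    _ = (r.length / (r.length + 1)) * D := by ring
    _ ≤ _ := by
      refine mul_le_mul_of_nonneg_right ?_ hD
      rw [div_le_div_iff₀ (by positivity) (by positivity)]
      linarith

/-- Pairs involving the new apex are controlled because the convex hull of `l` lies in a ball around
its centroid; the remaining pairs lie in the subdivision of a face and are handled by induction. -/
lemma subdiv_mesh {D : ℝ} (hD : 0 ≤ D) (d k : ℕ) : ∀ l : List E, l.length = k → k ≤ d + 1 →
    (∀ x ∈ l, ∀ y ∈ l, dist x y ≤ D) →
    subdiv centroid (Finsupp.single l 1) ∈ Finsupp.supported (ZMod 2) (ZMod 2)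
      {m | m.length = k ∧ (∀ x ∈ m, x ∈ convexHull ℝ {y | y ∈ l}) ∧
        ∀ x ∈ m, ∀ y ∈ m, dist x y ≤ d / (d + 1) * D} := by
  induction k with
  | zero =>
    intro l hl _ _
    obtain rfl := List.length_eq_zero_iff.1 hl
    rw [subdiv_nil]
    exact single_mem_supported (by simp)
  | succ k ih =>
    intro l hl hk h
    have hne : l ≠ [] := by rintro rfl; simp at hl
    have hbar : centroid l ∈ convexHull ℝ {y | y ∈ l} :=
      centroid_mem (convex_convexHull ℝ _) l hne fun x hx => subset_convexHull ℝ _ hx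
    have hball : convexHull ℝ {y | y ∈ l} ⊆ Metric.closedBall (centroid l) (d / (d + 1) * D) :=
      convexHull_min (fun x hx => by
        rw [Metric.mem_closedBall, dist_comm]
        exact dist_centroid_le hD (hl.trans_le hk) h hx) (convex_closedBall _ _)
    have hρ : 0 ≤ d / (d + 1) * D := by positivity
    rw [subdiv_single _ hne]
    refine cone_mem_supported (s := {m | m.length = k ∧
      (∀ x ∈ m, x ∈ convexHull ℝ {y | y ∈ l}) ∧ ∀ x ∈ m, ∀ y ∈ m, dist x y ≤ d / (d + 1) * D})
      ?_ (mem_of_supported (subdiv centroid) _ (fun m hm => ?_) (listBoundary_mem_supported l))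
    · rintro m ⟨h1, h2, h3⟩
      refine ⟨by rw [List.length_cons, h1], ?_, ?_⟩
      · intro x hx
        rcases List.mem_cons.1 hx with rfl | hx
        exacts [hbar, h2 x hx]
      · intro x hx y hy
        rcases List.mem_cons.1 hx with rfl | hx <;> rcases List.mem_cons.1 hy with rfl | hy
        · rwa [dist_self]
        · rw [dist_comm]
          exact hball (h2 y hy)
        · exact hball (h2 x hx)
        · exact h3 x hx y hy
    · refine Finsupp.supported_mono ?_ (ih m (by have := hm.2; omega) (by omega)
        fun x hx y hy => h x (hm.1.subset hx) y (hm.1.subset hy))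
      rintro r ⟨h1, h2, h3⟩
      exact ⟨h1, fun x hx => convexHull_mono (fun y hy => hm.1.subset hy) (h2 x hx), h3⟩

end Mesh

/-! ### Face-preserving self-maps of a simplex are surjective -/

section Surjective

variable {V : Type*} [Fintype V]

/-- Provides vertices of a fully labelled simplex of the `N`-th subdivision of the face spanned by
`t`; the odd count makes such a simplex exist. -/
lemma exists_sperner_points [DecidableEq V] (lab : (V → ℝ) → V)
    (hlab : ∀ x ∈ stdSimplex ℝ V, x (lab x) ≠ 0) (t : List V) (ht : t.Nodup) (N : ℕ) :
    ∃ p : V → V → ℝ, (∀ v ∈ t, p v ∈ stdSimplex ℝ V ∧ lab (p v) = v ∧ ∀ w ∉ t, p v w = 0) ∧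
      ∀ v ∈ t, ∀ w ∈ t, dist (p v) (p w) ≤ ((t.length : ℝ) / (t.length + 1)) ^ N := by
  let K : List V → Set (V → ℝ) := fun t => {x | x ∈ stdSimplex ℝ V ∧ ∀ w ∉ t, x w = 0}
  let e : V → V → ℝ := fun v => Pi.single v 1
  have hconv : ∀ t, Convex ℝ (K t) := fun t x hx y hy a b ha hb hab =>
    ⟨convex_stdSimplex ℝ V hx.1 hy.1 ha hb hab, fun w hw => by
      simp [hx.2 w hw, hy.2 w hw]⟩
  have heK : ∀ v t, v ∈ t → e v ∈ K t := fun v t hv =>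
    ⟨single_mem_stdSimplex ℝ v, fun w hw => Pi.single_eq_of_ne (fun h : w = v => hw (by rw [h]; exact hv)) 1⟩
  have hd : ∀ v w, dist (e v) (e w) ≤ 1 := fun v w =>
    (Metric.dist_le_diam_of_mem (bounded_stdSimplex V) (single_mem_stdSimplex ℝ v)
      (single_mem_stdSimplex ℝ w)).trans diam_stdSimplex_le
  let ρ : ℝ := (t.length : ℝ) / (t.length + 1)
  have hρ : 0 ≤ ρ := by positivity
  let s : ℕ → Set (List (V → ℝ)) := fun N => {l | l.length ≤ t.length + 1 ∧ (∀ x ∈ l, x ∈ K t) ∧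
    ∀ x ∈ l, ∀ y ∈ l, dist x y ≤ ρ ^ N}
  have hs := subdiv_iterate_mem_supported centroid (s := s) (fun N l hl => by
    refine Finsupp.supported_mono ?_ (subdiv_mesh (pow_nonneg hρ N) t.length l.length l rfl hl.1
      hl.2.2)
    rintro m ⟨h1, h2, h3⟩
    refine ⟨h1.trans_le hl.1, fun x hx => convexHull_min hl.2.1 (hconv t) (h2 x hx), ?_⟩
    intro x hx y hy
    rw [pow_succ']
    exact h3 x hx y hy) N (c := Finsupp.single (t.map e) 1) (single_mem_supported (by
      refine ⟨by simp, fun x hx => ?_, fun x hx y hy => ?_⟩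
      · obtain ⟨v, hv, rfl⟩ := List.mem_map.1 hx
        exact heK v t hv
      · obtain ⟨v, hv, rfl⟩ := List.mem_map.1 hx
        obtain ⟨w, hw, rfl⟩ := List.mem_map.1 hy
        exact (hd v w).trans_eq (pow_zero _).symm))
  have hsp := sperner lab centroid e K N heK (fun t l hl h => centroid_mem (hconv t) l hl h)
    (fun t x hx => by
      by_contra h
      exact hlab x hx.1 (hx.2 _ h)) t ht
  have hm : ∃ m ∈ s N, (m.map lab).Perm t := by
    by_contra hc
    push Not at hc
    rw [eq_of_supported (T := labelCochain lab t) (T' := 0) (fun m hm => by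
      rw [labelCochain_single, if_neg (hc m hm), LinearMap.zero_apply]) hs,
      LinearMap.zero_apply] at hsp
    exact zero_ne_one hsp
  obtain ⟨m, hm, hp⟩ := hm
  have hex : ∀ v ∈ t, ∃ x ∈ m, lab x = v := fun v hv => List.mem_map.1 (hp.symm.subset hv)
  choose! p hp1 hp2 using hex
  exact ⟨p, fun v hv => ⟨(hm.2.1 _ (hp1 v hv)).1, hp2 v hv, (hm.2.1 _ (hp1 v hv)).2⟩,
    fun v hv w hw => hm.2.2 _ (hp1 v hv) _ (hp1 w hw)⟩

/-- A continuous self-map of a simplex which preserves all faces maps each face onto itself. -/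
theorem surjective_of_face_preserving {f : stdSimplex ℝ V → stdSimplex ℝ V} (hf : Continuous f)
    (hface : ∀ x v, x v = 0 → f x v = 0) (c : stdSimplex ℝ V) :
    ∃ x, f x = c ∧ ∀ v, c v = 0 → x v = 0 := by
  classical
  have hcV : ∃ v, 0 < c v := by
    by_contra h
    push Not at h
    have h0 : ∀ v, c v = 0 := fun v => le_antisymm (h v) (stdSimplex.zero_le _ _)
    have := stdSimplex.sum_eq_one c
    simp [h0] at this
  obtain ⟨v₀, hv₀⟩ := hcV
  -- The Sperner labelling: some vertex of the support of `x` has f(x)_v ≥ c_v, since otherwise the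
  -- coordinates of f(x) would sum to less than those of c.
  have hex : ∀ x : stdSimplex ℝ V, ∃ v, x v ≠ 0 ∧ c v ≤ f x v := fun x => by
    by_contra h
    push Not at h
    have hle : ∀ v ∈ Finset.univ, f x v ≤ c v := fun v _ => by
      by_cases hv : x v = 0
      · exact (hface x v hv).trans_le (stdSimplex.zero_le _ _)
      · exact (h v hv).le
    have hlt : ∃ v ∈ Finset.univ, f x v < c v := by
      by_contra hn
      push Not at hn
      have h0 : ∀ v, x v = 0 := fun v => by
        by_contra hv
        exact (h v hv).not_ge (hn v (Finset.mem_univ v))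
      have := stdSimplex.sum_eq_one x
      simp [h0] at this
    have := Finset.sum_lt_sum hle hlt
    rw [stdSimplex.sum_eq_one, stdSimplex.sum_eq_one] at this
    exact lt_irrefl _ this
  choose lab' hlab1 hlab2 using hex
  let lab : (V → ℝ) → V := fun x => if h : x ∈ stdSimplex ℝ V then lab' ⟨x, h⟩ else v₀
  have hlab : ∀ x (h : x ∈ stdSimplex ℝ V), lab x = lab' ⟨x, h⟩ := fun x h => dif_pos h
  -- Working in the face spanned by the support of `c` ensures that the limit point lies in that
  -- face.
  let t := (Finset.univ.filter fun v => 0 < c v).toList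
  have htm : ∀ v, v ∈ t ↔ 0 < c v := fun v => by simp [t]
  have key := exists_sperner_points lab (fun x hx => by
    rw [hlab x hx]; exact hlab1 ⟨x, hx⟩) t (Finset.nodup_toList _)
  choose p hp hdist using key
  have hv₀t := (htm v₀).2 hv₀
  let q : ℕ → stdSimplex ℝ V := fun N => ⟨p N v₀, (hp N v₀ hv₀t).1⟩
  obtain ⟨x, -, φ, hφ, hlim⟩ := isCompact_univ.tendsto_subseq (fun N => Set.mem_univ (q N))
  have hρ : Filter.Tendsto (fun N : ℕ => ((t.length : ℝ) / (t.length + 1)) ^ φ N) Filter.atTop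
      (𝓝 0) :=
    (tendsto_pow_atTop_nhds_zero_of_lt_one (by positivity)
      ((div_lt_one (by positivity)).2 (lt_add_one _))).comp hφ.tendsto_atTop
  have hlimv : ∀ v (hv : v ∈ t), Filter.Tendsto
      (fun N => (⟨p (φ N) v, (hp (φ N) v hv).1⟩ : stdSimplex ℝ V)) Filter.atTop (𝓝 x) :=
    fun v hv => hlim.congr_dist (squeeze_zero (fun _ => dist_nonneg)
      (fun N => hdist (φ N) v₀ hv₀t v hv) hρ)
  have hcoord : ∀ v, Continuous fun y : stdSimplex ℝ V => y v := fun v =>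
    (continuous_apply v).comp continuous_subtype_val
  -- The points of each label in `t` converge to the same `x`, so all the inequalities c_v ≤ f(x)_v
  -- hold at once; equal coordinate sums then force equality.
  have hle : ∀ v ∈ Finset.univ, c v ≤ f x v := fun v _ => by
    by_cases hv : v ∈ t
    · refine ge_of_tendsto' (((hcoord v).comp hf).continuousAt.tendsto.comp (hlimv v hv))
        fun N => ?_
      have h1 := (hp (φ N) v hv).2.1
      rw [hlab _ (hp (φ N) v hv).1] at h1
      have h2 := hlab2 ⟨p (φ N) v, (hp (φ N) v hv).1⟩
      rwa [h1] at h2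
    · exact (not_lt.1 fun h => hv ((htm v).2 h)).trans (stdSimplex.zero_le _ _)
  refine ⟨x, stdSimplex.ext (funext fun v => ?_), fun v hv => ?_⟩
  · exact ((Finset.sum_eq_sum_iff_of_le hle).1 (by
      rw [stdSimplex.sum_eq_one, stdSimplex.sum_eq_one]) v (Finset.mem_univ v)).symm
  · refine tendsto_nhds_unique ((hcoord v).continuousAt.tendsto.comp hlim) ?_
    refine tendsto_const_nhds.congr fun N => ((hp (φ N) v₀ hv₀t).2.2 v ?_).symm
    rw [htm, hv]
    exact lt_irrefl _

end Surjective

/-! ### Face-preserving parametrizations of a simplex by its subdivision -/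

section Parametrization

variable {m : ℕ}

lemma sup'_coord_pos (u : Simplex m) :
    0 < Finset.univ.sup' Finset.univ_nonempty (fun j => u j) :=
  (maxIndex_pos u).trans_le (Finset.le_sup' (fun j => u j) (Finset.mem_univ _))

/-- The homeomorphism `|Δᵐ| → |sd Δᵐ|` given by rescaling to maximum `1`. -/
def simplexToSd (u : Simplex m) : SdSimplex m :=
  (sdHomeo m).symm ⟨fun j => u j / Finset.univ.sup' Finset.univ_nonempty (fun j => u j),
    fun j => div_nonneg (stdSimplex.zero_le _ _) (sup'_coord_pos u).le,
    fun j => (div_le_one (sup'_coord_pos u)).2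
      (Finset.le_sup' (fun j => u j) (Finset.mem_univ j)), by
    obtain ⟨j, -, hj⟩ := Finset.exists_mem_eq_sup' (Finset.univ_nonempty (α := Fin (m + 1)))
      (fun j => u j)
    exact ⟨j, (div_eq_one_iff_eq (sup'_coord_pos u).ne').2 hj.symm⟩⟩

lemma continuous_simplexToSd : Continuous (simplexToSd : Simplex m → SdSimplex m) :=
  (sdHomeo m).symm.continuous.comp (Continuous.subtype_mk (continuous_pi fun j =>
    (continuous_coord j).div (Continuous.finset_sup'_apply _ fun j _ => continuous_coord j)
      fun u => (sup'_coord_pos u).ne') _)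

lemma height_simplexToSd_eq_zero {u : Simplex m} {j : Fin (m + 1)} (h : u j = 0) :
    height (simplexToSd u) j = 0 :=
  (height_sdHomeo_symm _ j).trans (by simp only [h, zero_div])

/-- Precomposing with the rescaling map gives a face-preserving self-map of the simplex. It hits the
boundary point Φ(w) from a point of the same face, and injectivity identifies the image of that
point in the subdivision with `w`. -/
lemma mem_sdBoundary_of_face_preserving {Φ : SdSimplex m → Simplex m} (hc : Continuous Φ)
    (hinj : Function.Injective Φ) (hface : ∀ F, Set.MapsTo Φ (sdFace F) (simplexFace F))
    {w : SdSimplex m} (hw : Φ w ∈ simplexBoundary m) : w ∈ sdBoundary m := by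
  classical
  obtain ⟨x, hx, h0⟩ := surjective_of_face_preserving (hc.comp continuous_simplexToSd)
    (fun u j hj => hface (Finset.univ.erase j) ((mem_sdFace_iff _ _).2 fun l hl => by
      have : l = j := by simpa using hl
      subst this
      exact height_simplexToSd_eq_zero hj) j (Finset.notMem_erase _ _)) (Φ w)
  obtain ⟨j, hj⟩ := hw
  rw [← hinj hx]
  exact (mem_sdBoundary_iff _).2 ⟨j, height_simplexToSd_eq_zero (h0 j hj)⟩

lemma mem_simplexBoundary_of_mem_sdBoundary {Φ : SdSimplex m → Simplex m}
    (hface : ∀ F, Set.MapsTo Φ (sdFace F) (simplexFace F)) {w : SdSimplex m}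
    (hw : w ∈ sdBoundary m) : Φ w ∈ simplexBoundary m := by
  classical
  obtain ⟨j, hj⟩ := (mem_sdBoundary_iff w).1 hw
  refine ⟨j, hface (Finset.univ.erase j) ((mem_sdFace_iff _ _).2 fun l hl => ?_) j
    (Finset.notMem_erase _ _)⟩
  have : l = j := by simpa using hl
  rwa [this]

end Parametrization

/-! ### Attaching a single cell -/

namespace CellStructure

variable {P : Type*} [PartialOrder P] {X : Type*} [TopologicalSpace X]
  {s : Stratification P X} {ι : Type*} {C : CellStructure s ι} {Ψ : C.Subdivision}
  {n : ℕ} {I : Fin (n + 1) ↪o P}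

lemma map_injOn_interior (C : CellStructure s ι) (i : ι) :
    Set.InjOn (C.map i) (simplexInterior (C.dim i)) := fun u hu v hv h =>
  congrArg Subtype.val ((C.isEmbedding i).injective (a₁ := ⟨u, hu⟩) (a₂ := ⟨v, hv⟩) h)

lemma continuous_cellMap (Ψ : C.Subdivision) (i : ι) : Continuous (Ψ.cellMap i) :=
  (C.map i).continuous_toFun.comp (Ψ.homeo i).continuous

lemma strat_cellMap (Ψ : C.Subdivision) (i : ι) (w : SdSimplex (C.dim i)) :
    s (Ψ.cellMap i w) = sdStrat (C.flag i) w :=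
  ((C.map i).map_strat _).trans (Ψ.homeo_strat i w)

lemma homeo_mem_interior (Ψ : C.Subdivision) {i : ι} {w : SdSimplex (C.dim i)}
    (hw : w ∉ sdBoundary (C.dim i)) : Ψ.homeo i w ∈ simplexInterior (C.dim i) :=
  (mem_interior_or_boundary _).resolve_right fun h => hw
    (mem_sdBoundary_of_face_preserving (Ψ.homeo i).continuous (Ψ.homeo i).injective
      (Ψ.homeo_face i) h)

lemma cellMap_mem_carrier (Ψ : C.Subdivision) (D : C.Subcomplex) {i : ι} (hi : i ∈ D.cells)
    (w : SdSimplex (C.dim i)) : Ψ.cellMap i w ∈ D.carrier :=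
  D.map_mem_carrier hi _

lemma cellMap_notMem_carrier (Ψ : C.Subdivision) {D : C.Subcomplex} {i : ι} (hi : i ∉ D.cells)
    {w : SdSimplex (C.dim i)} (hw : w ∉ sdBoundary (C.dim i)) : Ψ.cellMap i w ∉ D.carrier := by
  intro h
  obtain ⟨j, hj, hx⟩ := Set.mem_iUnion₂.1 h
  have := (C.disjoint_union (Ψ.cellMap i w)).unique hx ⟨_, homeo_mem_interior Ψ hw, rfl⟩
  exact hi (this ▸ hj)

lemma cellMap_mem_carrier_of_boundary (Ψ : C.Subdivision) {D : C.Subcomplex} {i : ι}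
    (hi : ∀ j, C.Prec j i → j ∈ D.cells) {w : SdSimplex (C.dim i)}
    (hw : w ∈ sdBoundary (C.dim i)) : Ψ.cellMap i w ∈ D.carrier := by
  obtain ⟨j, hj, -⟩ := C.disjoint_union (Ψ.cellMap i w)
  exact Set.mem_biUnion (hi j (C.map_boundary_prec
    (mem_simplexBoundary_of_mem_sdBoundary (Ψ.homeo_face i) hw) hj)) hj

lemma nbhd_subset_carrier (Ψ : C.Subdivision) (D : C.Subcomplex) (p : P) :
    Ψ.nbhd D p ⊆ D.carrier := by
  refine Set.iUnion₂_subset fun i hi => ?_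
  rintro _ ⟨w, -, rfl⟩
  exact cellMap_mem_carrier Ψ D hi w

lemma nbhd_mono (Ψ : C.Subdivision) {D D' : C.Subcomplex} (h : D.cells ⊆ D'.cells) (p : P) :
    Ψ.nbhd D p ⊆ Ψ.nbhd D' p := Set.biUnion_subset_biUnion_left h

lemma flagNbhd_mono (Ψ : C.Subdivision) {D D' : C.Subcomplex} (h : D.cells ⊆ D'.cells)
    (I : Fin (n + 1) ↪o P) : Ψ.flagNbhd D I ⊆ Ψ.flagNbhd D' I :=
  Set.iInter_mono fun _ => nbhd_mono Ψ h _

lemma cellMap_mem_flagNbhd (Ψ : C.Subdivision) {D : C.Subcomplex} {i : ι} (hi : i ∈ D.cells)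
    {w : SdSimplex (C.dim i)} (hw : w ∈ sdFlagNbhd (C.flag i) I) :
    Ψ.cellMap i w ∈ Ψ.flagNbhd D I :=
  Set.mem_iInter.2 fun k => Set.mem_biUnion hi ⟨w, Set.mem_iInter.1 hw k, rfl⟩

lemma isClosed_flagNbhd [T2Space X] [Finite ι] (Ψ : C.Subdivision) (D : C.Subcomplex)
    (I : Fin (n + 1) ↪o P) : IsClosed (Ψ.flagNbhd D I) :=
  isClosed_iInter fun _ => D.cells.toFinite.isClosed_biUnion fun i _ =>
    ((isClosed_sdNbhd _ _).isCompact.image (continuous_cellMap Ψ i)).isClosed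

lemma boundary_mem_nbhd (hΨ : Ψ.DefinesStandardNbhdSystem) {D : C.Subcomplex} {i : ι}
    (hi : ∀ j, C.Prec j i → j ∈ D.cells) {p : P} {w : SdSimplex (C.dim i)}
    (hw : w ∈ sdNbhd (C.flag i) p) (hb : w ∈ sdBoundary (C.dim i)) :
    Ψ.cellMap i w ∈ Ψ.nbhd D p :=
  Set.biUnion_subset_biUnion_left (fun j hj => hi j hj) (hΨ p i ⟨w, ⟨hw, hb⟩, rfl⟩)

/-- Identifies the part of the cell's neighborhood along which it is attached. The standard
neighborhood condition puts boundary points into the old neighborhood; interior points avoid the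
carrier of `D`. -/
lemma cellMap_mem_flagNbhd_iff (hΨ : Ψ.DefinesStandardNbhdSystem) {D : C.Subcomplex} {i : ι}
    (hiD : i ∉ D.cells) (hi : ∀ j, C.Prec j i → j ∈ D.cells) {w : SdSimplex (C.dim i)}
    (hw : w ∈ sdFlagNbhd (C.flag i) I) :
    Ψ.cellMap i w ∈ Ψ.flagNbhd D I ↔ w ∈ sdBoundary (C.dim i) := by
  constructor
  · intro h
    by_contra hb
    exact cellMap_notMem_carrier Ψ hiD hb (nbhd_subset_carrier Ψ D _ (Set.mem_iInter.1 h 0))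
  · exact fun hb => Set.mem_iInter.2 fun k => boundary_mem_nbhd hΨ hi (Set.mem_iInter.1 hw k) hb

lemma cellMap_injective_off_boundary (Ψ : C.Subdivision) {i : ι} {w w' : SdSimplex (C.dim i)}
    (hw : w ∉ sdBoundary (C.dim i)) (hw' : w' ∉ sdBoundary (C.dim i))
    (h : Ψ.cellMap i w = Ψ.cellMap i w') : w = w' :=
  (Ψ.homeo i).injective (C.map_injOn_interior i (homeo_mem_interior Ψ hw)
    (homeo_mem_interior Ψ hw') h)

/-- Membership for different p ∈ I could a priori come from different cells. A point of the carrier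
of `D` that comes from the new cell comes from its boundary, hence stays in the old neighborhoods;
any other point has a single preimage in the new cell, which serves all p. -/
lemma mem_flagNbhd_insert (hΨ : Ψ.DefinesStandardNbhdSystem) {D D' : C.Subcomplex} {i : ι}
    (hiD : i ∉ D.cells) (hD' : D'.cells = insert i D.cells)
    (hi : ∀ j, C.Prec j i → j ∈ D.cells) {x : X} (hx : x ∈ Ψ.flagNbhd D' I) :
    x ∈ Ψ.flagNbhd D I ∨ ∃ w ∈ sdFlagNbhd (C.flag i) I, Ψ.cellMap i w = x := by
  have hcase : ∀ k, x ∈ Ψ.nbhd D (I k) ∨ ∃ w ∈ sdNbhd (C.flag i) (I k), Ψ.cellMap i w = x :=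
    fun k => by
      obtain ⟨j, hj, w, hw, e⟩ := Set.mem_iUnion₂.1 (Set.mem_iInter.1 hx k)
      rw [hD'] at hj
      rcases hj with rfl | hj
      · exact Or.inr ⟨w, hw, e⟩
      · exact Or.inl (Set.mem_biUnion hj ⟨w, hw, e⟩)
  by_cases hxD : x ∈ D.carrier
  · refine Or.inl (Set.mem_iInter.2 fun k => (hcase k).elim id ?_)
    rintro ⟨w, hw, rfl⟩
    by_cases hb : w ∈ sdBoundary (C.dim i)
    · exact boundary_mem_nbhd hΨ hi hw hb
    · exact absurd hxD (cellMap_notMem_carrier Ψ hiD hb)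
  · have h : ∀ k, ∃ w ∈ sdNbhd (C.flag i) (I k), Ψ.cellMap i w = x := fun k =>
      (hcase k).resolve_left fun h => hxD (nbhd_subset_carrier Ψ D _ h)
    have hb : ∀ w, Ψ.cellMap i w = x → w ∉ sdBoundary (C.dim i) := fun w e hb =>
      hxD (e ▸ cellMap_mem_carrier_of_boundary Ψ hi hb)
    obtain ⟨w, -, e⟩ := h 0
    refine Or.inr ⟨w, Set.mem_iInter.2 fun k => ?_, e⟩
    obtain ⟨w', hw', e'⟩ := h k
    rwa [cellMap_injective_off_boundary Ψ (hb w e) (hb w' e') (e.trans e'.symm)]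

/-- The inclusion of the neighborhoods of a flag associated to subcomplexes. -/
def flagNbhdIncl (Ψ : C.Subdivision) (I : Fin (n + 1) ↪o P) {D D' : C.Subcomplex}
    (h : D.cells ⊆ D'.cells) :
    StratMap (s.restrict (Ψ.flagNbhd D I)) (s.restrict (Ψ.flagNbhd D' I)) where
  toFun := Set.inclusion (flagNbhd_mono Ψ h I)
  continuous_toFun := continuous_inclusion _
  map_strat _ := rfl

/-- The characteristic map of a cell, restricted to the neighborhood of a flag. -/
def flagNbhdCell (Ψ : C.Subdivision) (I : Fin (n + 1) ↪o P) {D : C.Subcomplex} {i : ι}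
    (hi : i ∈ D.cells) :
    StratMap ((sdStrat (C.flag i)).restrict (sdFlagNbhd (C.flag i) I))
      (s.restrict (Ψ.flagNbhd D I)) where
  toFun w := ⟨Ψ.cellMap i w.1, cellMap_mem_flagNbhd Ψ hi w.2⟩
  continuous_toFun := ((continuous_cellMap Ψ i).comp continuous_subtype_val).subtype_mk _
  map_strat w := strat_cellMap Ψ i w.1

section Attach

variable {i : ι}
  {ψ : C(Stratum ((sdStrat (C.flag i)).restrict (sdFlagNbhd (C.flag i) I)) (I (Fin.last n)),
    unitInterval)}
  {R₀ : Stratum ((sdStrat (C.flag i)).restrict (sdFlagNbhd (C.flag i) I)) (I (Fin.last n)) →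
    Simplex n → sdFlagNbhd (C.flag i) I}

lemma exists_isGlued_cell [T2Space X] [Finite ι]
    (hR₀ : IsAspire ((sdStrat (C.flag i)).restrict (sdFlagNbhd (C.flag i) I)) I R₀)
    (hψ : ∀ b, b.1.1 ∈ sdBoundary (C.dim i) → ψ b = 1)
    (hmem : ∀ b u, u (Fin.last n) = (ψ b : ℝ) → (R₀ b u).1 ∈ sdBoundary (C.dim i))
    (hΨ : Ψ.DefinesStandardNbhdSystem) {D D' : C.Subcomplex}
    (hiD : i ∉ D.cells) (hi' : i ∈ D'.cells) (hsub : D.cells ⊆ D'.cells)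
    (hD' : D'.cells = insert i D.cells) (hi : ∀ j, C.Prec j i → j ∈ D.cells)
    {R : Stratum (s.restrict (Ψ.flagNbhd D I)) (I (Fin.last n)) → Simplex n → Ψ.flagNbhd D I}
    (hR : IsAspire (s.restrict (Ψ.flagNbhd D I)) I R) :
    ∃ R' : Stratum (s.restrict (Ψ.flagNbhd D' I)) (I (Fin.last n)) → Simplex n →
        Ψ.flagNbhd D' I,
      IsGlued (flagNbhdCell Ψ I hi') (flagNbhdIncl Ψ I hsub) I ψ R R₀ R' ∧
        IsAspire (s.restrict (Ψ.flagNbhd D' I)) I R' := by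
  have : CompactSpace (sdFlagNbhd (C.flag i) I) :=
    isCompact_iff_compactSpace.1 (isClosed_sdFlagNbhd _ _).isCompact
  have hrange : ∀ b, flagNbhdCell Ψ I hi' b ∈ Set.range (flagNbhdIncl Ψ I hsub) ↔
      b.1 ∈ sdBoundary (C.dim i) := fun b => by
    rw [← cellMap_mem_flagNbhd_iff hΨ hiD hi b.2]
    constructor
    · rintro ⟨x, hx⟩
      have : x.1 = Ψ.cellMap i b.1 := congrArg Subtype.val hx
      exact this ▸ x.2
    · exact fun h => ⟨⟨_, h⟩, rfl⟩
  have hemb : IsClosedEmbedding (flagNbhdIncl Ψ I hsub) :=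
    ⟨IsEmbedding.inclusion (flagNbhd_mono Ψ hsub I), by
      have : Set.range (flagNbhdIncl Ψ I hsub) = Subtype.val ⁻¹' Ψ.flagNbhd D I :=
        Set.range_inclusion (flagNbhd_mono Ψ hsub I)
      rw [this]
      exact (isClosed_flagNbhd Ψ D I).preimage continuous_subtype_val⟩
  have hcover : ∀ y, y ∈ Set.range (flagNbhdIncl Ψ I hsub) ∨
      y ∈ Set.range (flagNbhdCell Ψ I hi') := fun y => by
    rcases mem_flagNbhd_insert hΨ hiD hD' hi y.2 with h | ⟨w, hw, e⟩
    · exact Or.inl ⟨⟨y.1, h⟩, rfl⟩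
    · exact Or.inr ⟨⟨w, hw⟩, Subtype.ext e⟩
  have hinj : ∀ b b', flagNbhdCell Ψ I hi' b = flagNbhdCell Ψ I hi' b' →
      b = b' ∨ flagNbhdCell Ψ I hi' b ∈ Set.range (flagNbhdIncl Ψ I hsub) := fun b b' e => by
    by_cases hb : b.1 ∈ sdBoundary (C.dim i)
    · exact Or.inr ((hrange b).2 hb)
    · refine Or.inl (Subtype.ext (cellMap_injective_off_boundary Ψ hb (fun hb' => hb ?_)
        (congrArg Subtype.val e)))
      rw [← hrange] at hb' ⊢
      rwa [e]
  obtain ⟨R', h1, -, h2⟩ := exists_isGlued (ψ := ψ) (RB := R₀) hemb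
    (flagNbhdCell Ψ I hi').continuous_toFun.isProperMap hcover hinj
    (fun b hb => hψ b ((hrange b.1).1 hb)) hR hR₀ (fun b u hu => (hrange _).2 (hmem b u hu))
  exact ⟨R', h1, h2⟩

lemma extends_of_isGlued_incl {D D' : C.Subcomplex} (hi' : i ∈ D'.cells)
    (hsub : D.cells ⊆ D'.cells)
    {R : Stratum (s.restrict (Ψ.flagNbhd D I)) (I (Fin.last n)) → Simplex n → Ψ.flagNbhd D I}
    {R' : Stratum (s.restrict (Ψ.flagNbhd D' I)) (I (Fin.last n)) → Simplex n → Ψ.flagNbhd D' I}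
    (h : IsGlued (flagNbhdCell Ψ I hi') (flagNbhdIncl Ψ I hsub) I ψ R R₀ R') :
    Extends s I R' R := fun x hS _ hx u =>
  congrArg Subtype.val (h.on_X ⟨⟨x, hS⟩, hx⟩ u)

/-- Gluing is natural in the subcomplex when the same ψ and R₀ are used for the new cell. -/
lemma extends_of_isGlued (hΨ : Ψ.DefinesStandardNbhdSystem) {A A' D D' : C.Subcomplex}
    (hiA : i ∉ A.cells) (hA' : i ∈ A'.cells) (hsubA : A.cells ⊆ A'.cells)
    (hiD : i ∉ D.cells) (hi' : i ∈ D'.cells) (hsub : D.cells ⊆ D'.cells)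
    (hD' : D'.cells = insert i D.cells) (hi : ∀ j, C.Prec j i → j ∈ D.cells)
    (hDA : D.cells ⊆ A.cells)
    {RA : Stratum (s.restrict (Ψ.flagNbhd A I)) (I (Fin.last n)) → Simplex n → Ψ.flagNbhd A I}
    {RA' : Stratum (s.restrict (Ψ.flagNbhd A' I)) (I (Fin.last n)) → Simplex n →
      Ψ.flagNbhd A' I}
    {R : Stratum (s.restrict (Ψ.flagNbhd D I)) (I (Fin.last n)) → Simplex n → Ψ.flagNbhd D I}
    {R' : Stratum (s.restrict (Ψ.flagNbhd D' I)) (I (Fin.last n)) → Simplex n → Ψ.flagNbhd D' I}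
    (hRA : IsGlued (flagNbhdCell Ψ I hA') (flagNbhdIncl Ψ I hsubA) I ψ RA R₀ RA')
    (hR : IsGlued (flagNbhdCell Ψ I hi') (flagNbhdIncl Ψ I hsub) I ψ R R₀ R')
    (hext : Extends s I RA R) : Extends s I RA' R' := by
  intro x hS hT hx u
  have hinjA : Function.Injective (flagNbhdIncl Ψ I hsubA) :=
    Set.inclusion_injective (flagNbhd_mono Ψ hsubA I)
  have hinjD : Function.Injective (flagNbhdIncl Ψ I hsub) :=
    Set.inclusion_injective (flagNbhd_mono Ψ hsub I)
  rcases mem_flagNbhd_insert hΨ hiD hD' hi hS with hxD | ⟨w, hw, rfl⟩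
  · have hxA := flagNbhd_mono Ψ hDA I hxD
    rw [extends_of_isGlued_incl hA' hsubA hRA x hxA hT hx u, hext x hxD hxA hx u,
      extends_of_isGlued_incl hi' hsub hR x hxD hS hx u]
  · let b : Stratum ((sdStrat (C.flag i)).restrict (sdFlagNbhd (C.flag i) I)) (I (Fin.last n)) :=
      ⟨⟨w, hw⟩, (strat_cellMap Ψ i w).symm.trans hx⟩
    obtain ⟨k, y₀, y₁, h₀, h₁, rfl⟩ := exists_combo (ψ b) u
    refine (congrArg Subtype.val (hRA.on_B b k y₀ y₁ h₀ h₁)).trans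
      (Eq.trans ?_ (congrArg Subtype.val (hR.on_B b k y₀ y₁ h₀ h₁)).symm)
    set v := R₀ b (combo (ψ b) y₀ (stdSimplex.vertex (Fin.last n)))
    -- Whether the extension by the identity moves the inner point depends only on its lying on the
    -- cell boundary and in the p_n-stratum, hence is the same test for `A` and for `D`.
    have hrange : ∀ {E E' : C.Subcomplex} (hiE : i ∉ E.cells) (hiE' : i ∈ E'.cells)
        (hsubE : E.cells ⊆ E'.cells), (∀ j, C.Prec j i → j ∈ E.cells) →
        (∃ x : Stratum (s.restrict (Ψ.flagNbhd E I)) (I (Fin.last n)),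
          flagNbhdIncl Ψ I hsubE x.1 = flagNbhdCell Ψ I hiE' v) →
        v.1 ∈ sdBoundary (C.dim i) ∧ s (Ψ.cellMap i v.1) = I (Fin.last n) := by
      rintro E E' hiE hiE' hsubE hiP ⟨x, hx⟩
      have e : x.1.1 = Ψ.cellMap i v.1 := congrArg Subtype.val hx
      refine ⟨(cellMap_mem_flagNbhd_iff hΨ hiE hiP v.2).1 (e ▸ x.1.2), ?_⟩
      rw [← e]
      exact x.2
    by_cases hv : v.1 ∈ sdBoundary (C.dim i) ∧ s (Ψ.cellMap i v.1) = I (Fin.last n)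
    · have hvD := (cellMap_mem_flagNbhd_iff hΨ hiD hi v.2).2 hv.1
      have hvA := flagNbhd_mono Ψ hDA I hvD
      refine (congrArg Subtype.val (extendByPoint_apply hinjA ⟨⟨_, hvA⟩, hv.2⟩ y₁)).trans
        (Eq.trans ?_
          (congrArg Subtype.val (extendByPoint_apply hinjD ⟨⟨_, hvD⟩, hv.2⟩ y₁)).symm)
      exact hext _ hvD hvA hv.2 y₁
    · refine (congrArg Subtype.val (extendByPoint_of_notMem (fun h => hv
        (hrange hiA hA' hsubA (fun j hj => hDA (hi j hj)) h)) y₁)).trans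
        (congrArg Subtype.val (extendByPoint_of_notMem (fun h => hv
          (hrange hiD hi' hsub hi h)) y₁)).symm

end Attach

/-! ### Induction over the cells -/

lemma prec_trans (C : CellStructure s ι) {i j k : ι} (h : C.Prec i j) (h' : C.Prec j k) :
    C.Prec i k := Relation.TransGen.trans h h'

lemma exists_minimal_cell [Finite ι] (A : C.Subcomplex) (hA : A.cells ≠ Set.univ) :
    ∃ i ∉ A.cells, ∀ j, C.Prec j i → j ∈ A.cells := by
  have : IsTrans ι C.Prec := ⟨fun _ _ _ => C.prec_trans⟩
  have : Std.Irrefl C.Prec := ⟨C.prec_irrefl⟩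
  obtain ⟨i, hi, hmin⟩ := (Finite.wellFounded_of_trans_of_irrefl C.Prec).has_min A.cellsᶜ
    (Set.nonempty_compl.2 hA)
  exact ⟨i, hi, fun j hj => by_contra fun hjA => hmin j hjA hj⟩

/-- The subcomplex obtained by adding a cell all of whose precursors are present. -/
def Subcomplex.insertCell (A : C.Subcomplex) (i : ι) (hi : ∀ j, C.Prec j i → j ∈ A.cells) :
    C.Subcomplex where
  cells := insert i A.cells
  closed_below := by
    rintro j k hjk (rfl | hk)
    · exact Or.inr (hi j hjk)
    · exact Or.inr (A.closed_below j k hjk hk)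

lemma exists_extension_insertCell [T2Space X] [Finite ι] (hΨ : Ψ.DefinesStandardNbhdSystem)
    (A : C.Subcomplex) {i : ι} (hiA : i ∉ A.cells) (hi : ∀ j, C.Prec j i → j ∈ A.cells)
    {RA : Stratum (s.restrict (Ψ.flagNbhd A I)) (I (Fin.last n)) → Simplex n → Ψ.flagNbhd A I}
    (hRA : IsAspire (s.restrict (Ψ.flagNbhd A I)) I RA) (hcomp : IsCompatible Ψ I A RA) :
    ∃ R : Stratum (s.restrict (Ψ.flagNbhd (A.insertCell i hi) I)) (I (Fin.last n)) →
        Simplex n → Ψ.flagNbhd (A.insertCell i hi) I,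
      IsAspire (s.restrict (Ψ.flagNbhd (A.insertCell i hi) I)) I R ∧
        IsCompatible Ψ I (A.insertCell i hi) R ∧ Extends s I R RA := by
  obtain ⟨ψ, R₀, hR₀, hψ, hmem⟩ := exists_standardAspire (C.flag i) I
  have hA' : i ∈ (A.insertCell i hi).cells := Set.mem_insert _ _
  have hsubA : A.cells ⊆ (A.insertCell i hi).cells := Set.subset_insert _ _
  obtain ⟨R, hglue, hR⟩ := exists_isGlued_cell hR₀ hψ hmem hΨ hiA hA' hsubA rfl hi hRA
  have hextA := extends_of_isGlued_incl hA' hsubA hglue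
  refine ⟨R, hR, fun B hB => ?_, hextA⟩
  by_cases hiB : i ∈ B.cells
  -- Removing the new cell from `B` leaves a subcomplex because no cell of `A` has `i` as a
  -- precursor. The aspire on `D` from compatibility is then glued with the same cell data.
  · let D : C.Subcomplex := ⟨B.cells \ {i}, fun j k hjk hk =>
      ⟨B.closed_below j k hjk hk.1, by
        rintro rfl
        exact hiA (A.closed_below j k hjk ((hB hk.1).resolve_left hk.2))⟩⟩
    have hiD : i ∉ D.cells := fun h => h.2 rfl
    have hDB : D.cells ⊆ B.cells := Set.sdiff_subset
    have hBD : B.cells = insert i D.cells := by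
      rw [Set.insert_sdiff_singleton, Set.insert_eq_of_mem hiB]
    have hDA : D.cells ⊆ A.cells := fun j hj => (hB hj.1).resolve_left hj.2
    have hiPD : ∀ j, C.Prec j i → j ∈ D.cells := fun j hj =>
      ⟨B.closed_below j i hj hiB, by
        rintro rfl
        exact C.prec_irrefl _ hj⟩
    obtain ⟨RD, hRD, hextD⟩ := hcomp D hDA
    obtain ⟨RB, hglueB, hRB⟩ := exists_isGlued_cell hR₀ hψ hmem hΨ hiD hiB hDB hBD hiPD hRD
    exact ⟨RB, hRB, extends_of_isGlued hΨ hiA hA' hsubA hiD hiB hDB hBD hiPD hDA hglue hglueB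
      hextD⟩
  · have hBA : B.cells ⊆ A.cells := fun j hj =>
      (hB hj).resolve_left fun e => hiB (e ▸ hj)
    obtain ⟨RB, hRB, hextB⟩ := hcomp B hBA
    refine ⟨RB, hRB, fun x hS hT hx u => ?_⟩
    have hxA := flagNbhd_mono Ψ hBA I hS
    rw [hextA x hxA hT hx u, hextB x hS hxA hx u]

/-- A compatible aspire on the neighborhood of a flag in a subcomplex extends to the whole
complex. -/
theorem exists_extension [T2Space X] [Finite ι] (hΨ : Ψ.DefinesStandardNbhdSystem)
    (A : C.Subcomplex)
    (RA : Stratum (s.restrict (Ψ.flagNbhd A I)) (I (Fin.last n)) → Simplex n → Ψ.flagNbhd A I)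
    (hRA : IsAspire (s.restrict (Ψ.flagNbhd A I)) I RA) (hcomp : IsCompatible Ψ I A RA) :
    ∃ R : Stratum (s.restrict (Ψ.flagNbhd C.whole I)) (I (Fin.last n)) → Simplex n →
        Ψ.flagNbhd C.whole I,
      IsAspire (s.restrict (Ψ.flagNbhd C.whole I)) I R ∧ IsCompatible Ψ I C.whole R ∧
        Extends s I R RA := by
  induction hk : A.cellsᶜ.ncard generalizing A with
  | zero =>
    have hu : A.cells = Set.univ := by
      rwa [Set.ncard_eq_zero, Set.compl_empty_iff] at hk
    obtain ⟨cells, hA⟩ := A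
    obtain rfl : cells = Set.univ := hu
    exact ⟨RA, hRA, hcomp, fun _ _ _ _ _ => rfl⟩
  | succ k ih =>
    obtain ⟨i, hiA, hi⟩ := exists_minimal_cell A fun h => by simp [h] at hk
    obtain ⟨R₁, h1, h2, h3⟩ := exists_extension_insertCell hΨ A hiA hi hRA hcomp
    have hcard : ((A.insertCell i hi).cellsᶜ).ncard = k := by
      have e : (A.insertCell i hi).cellsᶜ = A.cellsᶜ \ {i} := by
        ext j
        simp [Subcomplex.insertCell, and_comm]
      rw [e, Set.ncard_sdiff_singleton_of_mem (show i ∈ A.cellsᶜ from hiA), hk]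
      rfl
    obtain ⟨R, h4, h5, h6⟩ := ih (A.insertCell i hi) R₁ h1 h2 hcard
    refine ⟨R, h4, h5, fun x hS hT hx u => ?_⟩
    have hx1 := flagNbhd_mono Ψ (show A.cells ⊆ (A.insertCell i hi).cells from
      Set.subset_insert _ _) I hS
    rw [h6 x hx1 hT hx u, h3 x hS hx1 hx u]

/-- Extension from the empty subcomplex, whose flag neighborhood is empty because I has at least one
entry. -/
theorem exists_compatible_aspire [T2Space X] [Finite ι] (hΨ : Ψ.DefinesStandardNbhdSystem)
    (I : Fin (n + 1) ↪o P) :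
    ∃ R : Stratum (s.restrict (Ψ.flagNbhd C.whole I)) (I (Fin.last n)) → Simplex n →
        Ψ.flagNbhd C.whole I,
      IsAspire (s.restrict (Ψ.flagNbhd C.whole I)) I R ∧ IsCompatible Ψ I C.whole R := by
  let E : C.Subcomplex := ⟨∅, fun _ _ _ h => h.elim⟩
  have hE : ∀ x, x ∉ Ψ.flagNbhd E I := fun x hx => by
    obtain ⟨j, hj, -⟩ := Set.mem_iUnion₂.1 (Set.mem_iInter.1 hx 0)
    exact hj
  have hempty : IsEmpty (Ψ.flagNbhd E I) := ⟨fun x => hE x.1 x.2⟩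
  let RE : Stratum (s.restrict (Ψ.flagNbhd E I)) (I (Fin.last n)) → Simplex n →
    Ψ.flagNbhd E I := fun x _ => x.1
  have hRE : IsAspire (s.restrict (Ψ.flagNbhd E I)) I RE :=
    ⟨continuous_subtype_val.comp continuous_fst, fun x => hempty.elim x.1, fun k =>
      ⟨fun z => z.1.1, continuous_subtype_val.comp continuous_fst, fun _ _ => rfl,
        fun _ _ => rfl⟩⟩
  obtain ⟨R, h1, h2, -⟩ := exists_extension hΨ E RE hRE fun B hB => by
    obtain ⟨cells, hBc⟩ := B
    obtain rfl : cells = ∅ := Set.subset_empty_iff.1 hB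
    exact ⟨RE, hRE, fun _ _ _ _ _ => rfl⟩
  exact ⟨R, h1, h2⟩

end CellStructure

end

end StratCell

/-! ### Assembly of the gluing and standard neighborhood statements -/

theorem mainTheorem8 {P : Type w} [PartialOrder P] {n : ℕ} (I : Fin (n + 1) ↪o P) :
    -- gluing of aspires along pushouts of finite stratified cell complexes
    (∀ (B X Y : Type u) [TopologicalSpace B] [TopologicalSpace X] [TopologicalSpace Y]
        [T2Space B] [T2Space X]
        (sB : StratCell.Stratification P B) (sX : StratCell.Stratification P X)
        (sY : StratCell.Stratification P Y)
        (ιB ιX : Type v) [Finite ιB] [Finite ιX]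
        (CB : StratCell.CellStructure sB ιB) (_ : StratCell.CellStructure sX ιX)
        (A : CB.Subcomplex)
        (f : StratCell.StratMap (sB.restrict A.carrier) sX)
        (g : StratCell.StratMap sB sY) (i : StratCell.StratMap sX sY),
        CategoryTheory.IsPushout
          (TopCat.ofHom (⟨Subtype.val, continuous_subtype_val⟩ : C(A.carrier, B)))
          (TopCat.ofHom f.toContinuousMap)
          (TopCat.ofHom g.toContinuousMap) (TopCat.ofHom i.toContinuousMap) →
        ∀ (ψ : C(StratCell.Stratum sB (I (Fin.last n)), unitInterval))
          (RX : StratCell.Stratum sX (I (Fin.last n)) → StratCell.Simplex n → X)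
          (RB : StratCell.Stratum sB (I (Fin.last n)) → StratCell.Simplex n → B),
          (∀ b, ψ b = 1 ↔ b.1 ∈ A.carrier) →
          StratCell.IsAspire sX I RX →
          StratCell.IsAspire sB I RB →
          (∀ b u, u (Fin.last n) = (ψ b : ℝ) → RB b u ∈ A.carrier) →
          ∃ RY : StratCell.Stratum sY (I (Fin.last n)) → StratCell.Simplex n → Y,
            StratCell.IsGlued g i I ψ RX RB RY ∧
            (∀ R', StratCell.IsGlued g i I ψ RX RB R' → R' = RY) ∧
            StratCell.IsAspire sY I RY) ∧
    -- aspires on the standard neighborhoods of a finite stratified cell complex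
    (∀ (X : Type u) [TopologicalSpace X] [T2Space X] (s : StratCell.Stratification P X)
        (ι : Type v) [Finite ι] (C : StratCell.CellStructure s ι) (Ψ : C.Subdivision),
        Ψ.DefinesStandardNbhdSystem →
        (∃ R : StratCell.Stratum (s.restrict (Ψ.flagNbhd C.whole I)) (I (Fin.last n)) →
            StratCell.Simplex n → Ψ.flagNbhd C.whole I,
          StratCell.IsAspire (s.restrict (Ψ.flagNbhd C.whole I)) I R ∧
          StratCell.IsCompatible Ψ I C.whole R) ∧
        (∀ (A : C.Subcomplex)
          (RA : StratCell.Stratum (s.restrict (Ψ.flagNbhd A I)) (I (Fin.last n)) →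
            StratCell.Simplex n → Ψ.flagNbhd A I),
          StratCell.IsAspire (s.restrict (Ψ.flagNbhd A I)) I RA →
          StratCell.IsCompatible Ψ I A RA →
          ∃ R : StratCell.Stratum (s.restrict (Ψ.flagNbhd C.whole I)) (I (Fin.last n)) →
              StratCell.Simplex n → Ψ.flagNbhd C.whole I,
            StratCell.IsAspire (s.restrict (Ψ.flagNbhd C.whole I)) I R ∧
            StratCell.IsCompatible Ψ I C.whole R ∧
            StratCell.Extends s I R RA)) := by
  refine ⟨?_, ?_⟩
  · intro B X Y _ _ _ _ _ sB sX sY ιB ιX _ _ CB _ A f g i h ψ RX RB hψ hRX hRB hmem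
    exact StratCell.exists_isGlued_of_isPushout A f g i h ψ RX RB hψ hRX hRB hmem
  · intro X _ _ s ι _ C Ψ hΨ
    exact ⟨StratCell.CellStructure.exists_compatible_aspire hΨ I,
      fun A RA hRA hcomp => StratCell.CellStructure.exists_extension hΨ A RA hRA hcomp⟩
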